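/- Work over $\mathbb{C}$. For positive integers $u\le v$ let $S_{u,v}\subset\mathbb{P}^{u+v+1}$ be the rational normal scroll, that is, the set of points $$[c_0\sigma^u:c_0\sigma^{u-1}\tau:\dots:c_0\tau^u:c_1\sigma^v:c_1\sigma^{v-1}\tau:\dots:c_1\tau^v],\qquad [\sigma:\tau]\in\mathbb{P}^1,\ (c_0,c_1)\neq(0,0);$$ its rulings are the lines obtained by fixing $[\sigma:\tau]$. A rational scroll of type $(u,v)$ in $\mathbb{P}^N$ is the image $S$ of $S_{u,v}$ under a linear projection $q$, induced by a surjective linear map $\mathbb{C}^{u+v+2}\to\mathbb{C}^{N+1}$, whose center is disjoint from $S_{u,v}$ and which maps $S_{u,v}$ birationally onto $S$. It has isolated singularities if its singular locus is finite (possibly empty). **Proposition.** Let $v\ge 4$ and let $r\ge 0$ be an integer. Suppose there are odd integers $a\ge b\ge c\ge d>0$ with $$8r+4=a^2+b^2+c^2+d^2\qquad\text{and}\qquad a+b+c\le 2v-3 .$$ Then there is a rational scroll $S=q(S_{1,v})$ of type $(1,v)$ in $\mathbb{P}^5$ with isolated singularities which has at least $r$ singular points. In particular, it has at least $r$ singularities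 when each singular point $p$ is counted with multiplicity $\binom{m_p}{2}$, where $m_p$ is the number of rulings of $S_{1,v}$ whose images under $q$ pass through $p$. -/

import Mathlib

open scoped LinearAlgebra.Projectivization

noncomputable section

/-- The vector `(c₀ σᵘ, c₀ σᵘ⁻¹τ, …, c₀ τᵘ ; c₁ σᵛ, c₁ σᵛ⁻¹τ, …, c₁ τᵛ)` where `s = (σ, τ)`.
With `σ = 1` and `c = (1, t)` this is the standard parametrization
`(1, τ, …, τᵘ, t, tτ, …, tτᵛ)` of the rational normal scroll. -/
def scrollVec (u v : ℕ) (s c : Fin 2 → ℂ) : Fin (u + 1) ⊕ Fin (v + 1) → ℂ :=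
  Sum.elim (fun i => c 0 * (s 0 ^ (u - (i : ℕ)) * s 1 ^ (i : ℕ)))
    (fun j => c 1 * (s 0 ^ (v - (j : ℕ)) * s 1 ^ (j : ℕ)))

/-- The ruling over `s ∈ ℙ¹`: the line in `ℙ^(u+v+1)` that joins the two points corresponding to `s`
on the rational normal curves of degrees `u` and `v` in two complementary coordinate subspaces. -/
def ruling (u v : ℕ) (s : ℙ ℂ (Fin 2 → ℂ)) : Set (ℙ ℂ (Fin (u + 1) ⊕ Fin (v + 1) → ℂ)) :=
  {p | ∃ (c : Fin 2 → ℂ) (h : scrollVec u v s.rep c ≠ 0), p = Projectivization.mk ℂ _ h}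

/-- The rational normal scroll `S_{u,v} ⊆ ℙ^(u+v+1)`, the union of its rulings. -/
def rationalNormalScroll (u v : ℕ) : Set (ℙ ℂ (Fin (u + 1) ⊕ Fin (v + 1) → ℂ)) :=
  ⋃ s : ℙ ℂ (Fin 2 → ℂ), ruling u v s

/-- The image of `X ⊆ ℙ(V)` under the rational map `ℙ(V) ⇢ ℙ(W)` induced by a linear map `L`,
which is the linear projection with center `ℙ(ker L)`. -/
def projImage {V W : Type*} [AddCommGroup V] [Module ℂ V] [AddCommGroup W] [Module ℂ W]
    (L : V →ₗ[ℂ] W) (X : Set (ℙ ℂ V)) : Set (ℙ ℂ W) :=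
  {q | ∃ p ∈ X, ∃ h : L p.rep ≠ 0, q = Projectivization.mk ℂ (L p.rep) h}

/-- `S ⊆ ℙᴺ` is a rational scroll of type `(u, v)`, realized as the birational image of the rational
normal scroll `S_{u,v}` under the linear projection `L` (a projective isomorphism if `N = u+v+1`). -/
structure IsRationalScroll (u v : ℕ) {N : ℕ}
    (L : (Fin (u + 1) ⊕ Fin (v + 1) → ℂ) →ₗ[ℂ] (Fin (N + 1) → ℂ))
    (S : Set (ℙ ℂ (Fin (N + 1) → ℂ))) : Prop where
  pos : 1 ≤ u
  le : u ≤ v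
  surjective : Function.Surjective L
  /-- The center of the projection is disjoint from `S_{u,v}`. -/
  disjoint : ∀ p ∈ rationalNormalScroll u v, L p.rep ≠ 0
  /-- The projection has a rational inverse on its image: there are forms `G i` of one degree
  with `G (L x) = k • x` on `S_{u,v}`, not identically zero there. -/
  birational : ∃ (e : ℕ) (G : Fin (u + 1) ⊕ Fin (v + 1) → MvPolynomial (Fin (N + 1)) ℂ),
    (∀ i, (G i).IsHomogeneous e) ∧
    (∀ p ∈ rationalNormalScroll u v, ∃ k : ℂ,
      (fun i => MvPolynomial.eval (L p.rep) (G i)) = k • p.rep) ∧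
    (∃ p ∈ rationalNormalScroll u v, ∃ i, MvPolynomial.eval (L p.rep) (G i) ≠ 0)
  image_eq : S = projImage L (rationalNormalScroll u v)

/-- The Zariski tangent space at the point `x` of the affine cone over `S ⊆ ℙᴺ`: the common kernel
of the differentials at `x` of all forms that vanish on `S`. -/
def coneTangentSpace {N : ℕ} (S : Set (ℙ ℂ (Fin (N + 1) → ℂ))) (x : Fin (N + 1) → ℂ) :
    Submodule ℂ (Fin (N + 1) → ℂ) where
  carrier := {w | ∀ (k : ℕ) (F : MvPolynomial (Fin (N + 1)) ℂ), F.IsHomogeneous k →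
    (∀ p ∈ S, MvPolynomial.eval p.rep F = 0) →
      ∑ i, w i * MvPolynomial.eval x (MvPolynomial.pderiv i F) = 0}
  zero_mem' := fun k F _ _ => by simp
  add_mem' := fun {w w'} hw hw' k F hF hS => by
    simp [add_mul, Finset.sum_add_distrib, hw k F hF hS, hw' k F hF hS]
  smul_mem' := fun z w hw k F hF hS => by
    simp [mul_assoc, ← Finset.mul_sum, hw k F hF hS]

/-- The singular locus of a projective surface `S ⊆ ℙᴺ` (with its reduced structure): the points
where the affine cone, of dimension `3`, has a tangent space of dimension larger than `3`. -/
def surfaceSingularLocus {N : ℕ} (S : Set (ℙ ℂ (Fin (N + 1) → ℂ))) :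
    Set (ℙ ℂ (Fin (N + 1) → ℂ)) :=
  {p | p ∈ S ∧ 3 < Module.finrank ℂ (coneTangentSpace S p.rep)}

/-- The number of rulings whose images under the projection `L` pass through the point `q`. -/
def rulingsThrough (u v : ℕ) {N : ℕ}
    (L : (Fin (u + 1) ⊕ Fin (v + 1) → ℂ) →ₗ[ℂ] (Fin (N + 1) → ℂ))
    (q : ℙ ℂ (Fin (N + 1) → ℂ)) : ℕ :=
  {s : ℙ ℂ (Fin 2 → ℂ) | q ∈ projImage L (ruling u v s)}.ncard

/-- The number of singularities of a scroll with isolated singularities, where a singular point on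
exactly `m` rulings is counted `m.choose 2` times. -/
def singularityCount (u v : ℕ) {N : ℕ}
    (L : (Fin (u + 1) ⊕ Fin (v + 1) → ℂ) →ₗ[ℂ] (Fin (N + 1) → ℂ))
    (S : Set (ℙ ℂ (Fin (N + 1) → ℂ))) : ℕ :=
  ∑ᶠ q ∈ surfaceSingularLocus S, (rulingsThrough u v L q).choose 2

end

/-! Split ℂ⁶ as ℂ² × ℂ⁴ and send (s, c) to (c₀ s + c₁ e(s), c₁ f(s)), which is `xi`. The directrix
is carried isomorphically onto the line y = 0, and the ruling over s lies in the plane spanned by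
that line and the point f(s) of a rational curve f : ℙ¹ → ℙ³ of degree v. Two lines in a plane meet,
so the rulings over s ≠ t meet exactly when f(s) = f(t), and then in a single point off the
directrix. The problem becomes one about space curves: if f is base point free, immersed,
generically injective and passes mᵢ times through the i-th coordinate point, then the scroll gets mᵢ
choose 2 intersection points over that point. They are distinct for general e, since three
concurrent rulings impose a linear condition on e (`exists_no_three_concurrent`).

Intersection points are singular because the tangent space contains too many directions
(`three_lt_finrank_coneTangentSpace`). Finiteness needs the converse. If the image of a point of the
scroll lies on no other ruling, its fibre is a reduced point, and a graded Nakayama argument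
(`exists_form_mul_mem_range`, fed by `exists_degree_forall_mem_mul`) gives forms recovering s from
the image nearby (`exists_inverse_forms`). These forms yield birationality, the finiteness of the
double points of f, and, by lifting tangent vectors over the dual numbers, the bound 3 on the
tangent space of the cone (`finrank_coneTangentSpace_le`).

The curve (`exists_curve`) is (φ₁g₃g₄ : φ₂g₃g₄ : γg₄ : γg₃), with multiplicities m₁, m₂, m₃, m₃ and
v = m₁ + m₂ + m₃; a single free zero of g₃ suffices to make it immersed and generically injective.
Since ((2n+1)² - 1)/8 is n + 1 choose 2, the arithmetic hypotheses say that suitable mᵢ produce at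
least r pairs. -/

noncomputable section

/-! ### Binary forms and their zeros -/

/-- The determinant of two vectors of `ℂ²`. -/
def wd (s a : Fin 2 → ℂ) : ℂ := s 0 * a 1 - s 1 * a 0

/-- Binary forms of degree `n`, as functions on `ℂ²`. -/
def binaryForms (n : ℕ) : Submodule ℂ ((Fin 2 → ℂ) → ℂ) :=
  (Submodule.span ℂ {(fun s => s 0), (fun s => s 1)}) ^ n

lemma binaryForms_fg (n : ℕ) : (binaryForms n).FG :=
  Submodule.FG.pow (Submodule.fg_span (by simp)) n

lemma mul_mem_binaryForms {m n : ℕ} {F G : (Fin 2 → ℂ) → ℂ} (hF : F ∈ binaryForms m)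
    (hG : G ∈ binaryForms n) : (fun s => F s * G s) ∈ binaryForms (m + n) := by
  unfold binaryForms
  rw [pow_add]
  exact Submodule.mul_mem_mul hF hG

lemma const_mem_binaryForms (z : ℂ) : (fun _ => z) ∈ binaryForms 0 := by
  unfold binaryForms
  rw [pow_zero, Submodule.mem_one]
  exact ⟨z, rfl⟩

lemma const_mul_mem_binaryForms {n : ℕ} (z : ℂ) {F : (Fin 2 → ℂ) → ℂ} (hF : F ∈ binaryForms n) :
    (fun s => z * F s) ∈ binaryForms n :=
  (binaryForms n).smul_mem z hF

lemma add_mem_binaryForms {n : ℕ} {F G : (Fin 2 → ℂ) → ℂ} (hF : F ∈ binaryForms n)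
    (hG : G ∈ binaryForms n) : (fun s => F s + G s) ∈ binaryForms n :=
  (binaryForms n).add_mem hF hG

lemma sub_mem_binaryForms {n : ℕ} {F G : (Fin 2 → ℂ) → ℂ} (hF : F ∈ binaryForms n)
    (hG : G ∈ binaryForms n) : (fun s => F s - G s) ∈ binaryForms n :=
  (binaryForms n).sub_mem hF hG

lemma exists_const_of_mem_binaryForms_zero {F : (Fin 2 → ℂ) → ℂ} (hF : F ∈ binaryForms 0) :
    ∃ z, F = fun _ => z := by
  unfold binaryForms at hF
  rw [pow_zero, Submodule.mem_one] at hF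
  obtain ⟨z, hz⟩ := hF
  exact ⟨z, hz.symm⟩

lemma linear_mem_binaryForms (z w : ℂ) : (fun s => z * s 0 + w * s 1) ∈ binaryForms 1 := by
  unfold binaryForms
  rw [pow_one, Submodule.mem_span_pair]
  exact ⟨z, w, by ext s; simp⟩

lemma wd_mem_binaryForms (a : Fin 2 → ℂ) : (fun s => wd s a) ∈ binaryForms 1 := by
  convert linear_mem_binaryForms (a 1) (-a 0) using 2 with s
  unfold wd; ring

lemma pow_mem_binaryForms {m : ℕ} {F : (Fin 2 → ℂ) → ℂ} (hF : F ∈ binaryForms m) (n : ℕ) :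
    (fun s => F s ^ n) ∈ binaryForms (n * m) := by
  unfold binaryForms at *
  rw [mul_comm, pow_mul]
  exact Submodule.pow_mem_pow _ hF n

lemma binaryForms_smul {n : ℕ} {F : (Fin 2 → ℂ) → ℂ} (hF : F ∈ binaryForms n) (k : ℂ)
    (s : Fin 2 → ℂ) : F (k • s) = k ^ n * F s := by
  induction n generalizing F with
  | zero =>
    obtain ⟨z, rfl⟩ := exists_const_of_mem_binaryForms_zero hF
    simp
  | succ n ih =>
    unfold binaryForms at hF
    rw [pow_succ] at hF
    refine Submodule.mul_induction_on hF (fun F hF G hG => ?_) (fun F G hF hG => ?_)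
    · rw [Submodule.mem_span_pair] at hG
      obtain ⟨x, y, rfl⟩ := hG
      simp only [Pi.mul_apply, ih hF, Pi.add_apply, Pi.smul_apply, smul_eq_mul]
      ring
    · simp only [Pi.add_apply, hF, hG]; ring

lemma exists_linear_eq_one {a : Fin 2 → ℂ} (ha : a ≠ 0) : ∃ z w : ℂ, z * a 0 + w * a 1 = 1 := by
  by_cases h : a 0 = 0
  · have h1 : a 1 ≠ 0 := fun h1 => ha (by ext i; fin_cases i <;> simp [h, h1])
    exact ⟨0, (a 1)⁻¹, by field_simp; simp⟩
  · exact ⟨(a 0)⁻¹, 0, by field_simp; simp⟩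

lemma exists_mem_binaryForms_apply {a : Fin 2 → ℂ} (ha : a ≠ 0) (n : ℕ) (k : ℂ) :
    ∃ F ∈ binaryForms n, F a = k := by
  obtain ⟨z, w, h⟩ := exists_linear_eq_one ha
  refine ⟨fun s => k * (z * s 0 + w * s 1) ^ n, ?_, by simp [h]⟩
  have := pow_mem_binaryForms (linear_mem_binaryForms z w) n
  rw [mul_one] at this
  exact const_mul_mem_binaryForms k this

/-- Division with remainder of a binary form by the linear form vanishing at `a`. -/
lemma binaryForms_div {a : Fin 2 → ℂ} {z w : ℂ} (h : z * a 0 + w * a 1 = 1) {n : ℕ}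
    {F : (Fin 2 → ℂ) → ℂ} (hF : F ∈ binaryForms (n + 1)) :
    ∃ G ∈ binaryForms n, ∀ s, F s = wd s a * G s + F a * (z * s 0 + w * s 1) ^ (n + 1) := by
  induction n generalizing F with
  | zero =>
    unfold binaryForms at hF
    rw [zero_add, pow_one, Submodule.mem_span_pair] at hF
    obtain ⟨x, y, rfl⟩ := hF
    refine ⟨fun _ => x * w - y * z, const_mem_binaryForms _, fun s => ?_⟩
    simp [wd]
    linear_combination (-(x * s 0 + y * s 1)) * h
  | succ n ih =>
    unfold binaryForms at hF
    rw [pow_succ] at hF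
    refine Submodule.mul_induction_on hF (fun F hF G hG => ?_) (fun F G hF hG => ?_)
    · obtain ⟨F', hF', h1⟩ := ih hF
      rw [Submodule.mem_span_pair] at hG
      obtain ⟨x, y, rfl⟩ := hG
      refine ⟨fun s => F' s * (x * s 0 + y * s 1) +
        (F a * (x * w - y * z)) * (z * s 0 + w * s 1) ^ (n + 1), ?_, fun s => ?_⟩
      · refine add_mem_binaryForms (mul_mem_binaryForms hF' (linear_mem_binaryForms x y))
          (const_mul_mem_binaryForms _ ?_)
        have := pow_mem_binaryForms (linear_mem_binaryForms z w) (n + 1)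
        rwa [mul_one] at this
      · simp only [Pi.mul_apply, h1 s, Pi.add_apply, Pi.smul_apply, smul_eq_mul, wd]
        linear_combination (-(x * s 0 + y * s 1)) * F a * (z * s 0 + w * s 1) ^ (n + 1) * h
    · obtain ⟨F', hF', h1⟩ := hF
      obtain ⟨G', hG', h2⟩ := hG
      refine ⟨_, add_mem_binaryForms hF' hG', fun s => ?_⟩
      simp only [Pi.add_apply, h1 s, h2 s]
      ring

lemma exists_eq_wd_mul {a : Fin 2 → ℂ} (ha : a ≠ 0) {n : ℕ} {F : (Fin 2 → ℂ) → ℂ}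
    (hF : F ∈ binaryForms (n + 1)) (h0 : F a = 0) :
    ∃ G ∈ binaryForms n, ∀ s, F s = wd s a * G s := by
  obtain ⟨z, w, h⟩ := exists_linear_eq_one ha
  obtain ⟨G, hG, h1⟩ := binaryForms_div h hF
  exact ⟨G, hG, fun s => by rw [h1 s, h0]; ring⟩

/-- The binary form with coefficients `co`, evaluated in a `ℂ`-algebra. -/
def hev {A : Type*} [CommRing A] [Algebra ℂ A] (n : ℕ) (co : Fin (n + 1) → ℂ) (x : Fin 2 → A) : A :=
  ∑ j, algebraMap ℂ A (co j) * (x 0 ^ (n - (j : ℕ)) * x 1 ^ (j : ℕ))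

lemma map_hev {A B : Type*} [CommRing A] [Algebra ℂ A] [CommRing B] [Algebra ℂ B] (g : A →ₐ[ℂ] B)
    (n : ℕ) (co : Fin (n + 1) → ℂ) (x : Fin 2 → A) :
    g (hev n co x) = hev n co (fun i => g (x i)) := by
  simp [hev]

lemma hev_mul {A : Type*} [CommRing A] [Algebra ℂ A] (n : ℕ) (co : Fin (n + 1) → ℂ)
    (k : A) (x : Fin 2 → A) : hev n co (fun i => k * x i) = k ^ n * hev n co x := by
  unfold hev
  rw [Finset.mul_sum]
  refine Finset.sum_congr rfl fun j _ => ?_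
  have : k ^ n = k ^ (n - (j : ℕ)) * k ^ (j : ℕ) := by rw [← pow_add]; congr 1; omega
  rw [this]; ring

lemma hev_mem_binaryForms (n : ℕ) (co : Fin (n + 1) → ℂ) :
    (fun s : Fin 2 → ℂ => hev n co s) ∈ binaryForms n := by
  have : (fun s : Fin 2 → ℂ => hev n co s) =
      ∑ j : Fin (n + 1), co j • (fun s => (s 0) ^ (n - (j : ℕ)) * (s 1) ^ (j : ℕ)) := by
    ext s; simp [hev]
  rw [this]
  refine Submodule.sum_mem _ fun j _ => Submodule.smul_mem _ _ ?_
  have h0 := pow_mem_binaryForms (linear_mem_binaryForms 1 0) (n - (j : ℕ))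
  have h1 := pow_mem_binaryForms (linear_mem_binaryForms 0 1) (j : ℕ)
  have := mul_mem_binaryForms h0 h1
  simpa [show n - (j : ℕ) + j = n by omega] using this

lemma exists_hev_eq {n : ℕ} {F : (Fin 2 → ℂ) → ℂ} (hF : F ∈ binaryForms n) :
    ∃ co, ∀ s, F s = hev n co s := by
  induction n generalizing F with
  | zero =>
    obtain ⟨z, rfl⟩ := exists_const_of_mem_binaryForms_zero hF
    exact ⟨fun _ => z, fun s => by simp [hev]⟩
  | succ n ih =>
    unfold binaryForms at hF
    rw [pow_succ] at hF
    refine Submodule.mul_induction_on hF (fun F hF G hG => ?_) (fun F G hF hG => ?_)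
    · obtain ⟨co, h1⟩ := ih hF
      rw [Submodule.mem_span_pair] at hG
      obtain ⟨x, y, rfl⟩ := hG
      refine ⟨fun j => x * (Fin.snoc (α := fun _ => ℂ) co 0 j) +
        y * (Fin.cons (α := fun _ => ℂ) 0 co j), fun s => ?_⟩
      have e1 : ∑ j : Fin (n + 2), (Fin.snoc (α := fun _ => ℂ) co 0 j) *
          (s 0 ^ (n + 1 - (j : ℕ)) * s 1 ^ (j : ℕ)) = s 0 * hev n co s := by
        rw [Fin.sum_univ_castSucc, hev, Finset.mul_sum]
        simp only [Fin.snoc_castSucc, Fin.snoc_last, zero_mul, add_zero, Fin.val_castSucc]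
        refine Finset.sum_congr rfl fun j _ => ?_
        rw [show n + 1 - (j : ℕ) = n - j + 1 by omega]
        simp; ring
      have e2 : ∑ j : Fin (n + 2), (Fin.cons (α := fun _ => ℂ) 0 co j) *
          (s 0 ^ (n + 1 - (j : ℕ)) * s 1 ^ (j : ℕ)) = s 1 * hev n co s := by
        rw [Fin.sum_univ_succ, hev, Finset.mul_sum]
        simp only [Fin.cons_zero, Fin.cons_succ, zero_mul, zero_add, Fin.val_succ]
        refine Finset.sum_congr rfl fun j _ => ?_
        rw [show n + 1 - ((j : ℕ) + 1) = n - j by omega]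
        simp; ring
      rw [hev]
      simp only [Algebra.algebraMap_self, RingHom.id_apply, add_mul, Finset.sum_add_distrib, mul_assoc,
        ← Finset.mul_sum]
      rw [e1, e2]
      simp [h1]; ring
    · obtain ⟨c1, h1⟩ := hF
      obtain ⟨c2, h2⟩ := hG
      refine ⟨c1 + c2, fun s => ?_⟩
      simp [h1, h2, hev, add_mul, Finset.sum_add_distrib]

/-- Dehomogenisation. The coefficient in degree `n` is the value at infinity, so a drop in degree
records a zero at `![0, 1]`. -/
lemma exists_polynomial_of_mem_binaryForms {n : ℕ} {F : (Fin 2 → ℂ) → ℂ} (hF : F ∈ binaryForms n) :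
    ∃ p : Polynomial ℂ, p.natDegree ≤ n ∧ (∀ t, F ![1, t] = p.eval t) ∧ F ![0, 1] = p.coeff n ∧
      (p = 0 → ∀ s, F s = 0) := by
  obtain ⟨co, h⟩ := exists_hev_eq hF
  have hc : ∀ j : Fin (n + 1),
      (∑ j : Fin (n + 1), Polynomial.C (co j) * Polynomial.X ^ (j : ℕ)).coeff j = co j := by
    intro j
    simp only [Polynomial.finsetSum_coeff, Polynomial.coeff_C_mul, Polynomial.coeff_X_pow]
    rw [Finset.sum_eq_single j]
    · simp
    · intro b _ hb
      rw [if_neg (fun h => hb (Fin.ext h.symm)), mul_zero]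
    · simp
  refine ⟨∑ j : Fin (n + 1), Polynomial.C (co j) * Polynomial.X ^ (j : ℕ), ?_, ?_, ?_, ?_⟩
  · refine Polynomial.natDegree_sum_le_of_forall_le _ _ fun j _ => ?_
    exact (Polynomial.natDegree_C_mul_X_pow_le _ _).trans (by omega)
  · intro t
    simp [h, hev, Polynomial.eval_finsetSum]
  · refine Eq.trans ?_ (hc (Fin.last n)).symm
    rw [h]
    simp only [hev]
    rw [Finset.sum_eq_single (Fin.last n)]
    · simp
    · intro b _ hb
      have : (b : ℕ) ≠ n := fun h => hb (Fin.ext h)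
      have : n - (b : ℕ) ≠ 0 := by omega
      simp [this]
    · simp
  · intro h0 s
    have : ∀ j, co j = 0 := fun j => by rw [← hc j, h0]; simp
    simp [h, hev, this]

lemma finite_zeros_of_mem_binaryForms {n : ℕ} {F : (Fin 2 → ℂ) → ℂ} (hF : F ∈ binaryForms n)
    {s : Fin 2 → ℂ} (hs : F s ≠ 0) : ∃ Z : Finset ℂ, ∀ t, F ![1, t] = 0 → t ∈ Z := by
  obtain ⟨p, -, h1, -, h2⟩ := exists_polynomial_of_mem_binaryForms hF
  have hp : p ≠ 0 := fun h => hs (h2 h s)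
  exact ⟨p.roots.toFinset, fun t ht => by simp [hp, ← h1, ht]⟩

lemma exists_zero_of_mem_binaryForms {n : ℕ} {F : (Fin 2 → ℂ) → ℂ}
    (hF : F ∈ binaryForms (n + 1)) : ∃ b : Fin 2 → ℂ, b ≠ 0 ∧ F b = 0 := by
  obtain ⟨p, h0, h1, h2, -⟩ := exists_polynomial_of_mem_binaryForms hF
  -- If the polynomial is a nonzero constant, every zero of the form is at infinity. The zero
  -- polynomial has degree `⊥` and falls under the other case.
  by_cases hd : p.degree = 0
  · refine ⟨![0, 1], fun h => by simpa using congrFun h 1, ?_⟩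
    rw [h2]
    refine Polynomial.coeff_eq_zero_of_natDegree_lt ?_
    rw [Polynomial.natDegree_eq_of_degree_eq_some (n := 0) hd]; omega
  · obtain ⟨t, ht⟩ := IsAlgClosed.exists_root p hd
    exact ⟨![1, t], fun h => by simpa using congrFun h 0, by rw [h1]; exact ht⟩

lemma eq_zero_of_wd_mul_eq_zero {n : ℕ} {F : (Fin 2 → ℂ) → ℂ} (hF : F ∈ binaryForms n)
    {a : Fin 2 → ℂ} (ha : a ≠ 0) (h : ∀ s, wd s a * F s = 0) (s : Fin 2 → ℂ) : F s = 0 := by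
  by_contra hs
  obtain ⟨Z, hZ⟩ := finite_zeros_of_mem_binaryForms hF hs
  -- `a 1 / a 0` is the only affine zero of `wd · a`. For `a 0 = 0` there is none, and excluding the
  -- default value 0 is harmless.
  obtain ⟨t, ht⟩ := Infinite.exists_notMem_finset (insert (a 1 / a 0) Z)
  rw [Finset.mem_insert, not_or] at ht
  have h1 := (mul_eq_zero.1 (h ![1, t])).resolve_right (fun h => ht.2 (hZ t h))
  simp only [wd, Matrix.cons_val_zero, Matrix.cons_val_one, one_mul] at h1
  by_cases h0 : a 0 = 0
  · apply ha
    ext i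
    fin_cases i
    · exact h0
    · simpa [h0] using h1
  · exact ht.1 (by field_simp; linear_combination -h1)

lemma exists_smul_of_wd_eq_zero {a b : Fin 2 → ℂ} (ha : a ≠ 0) (h : wd b a = 0) :
    ∃ k : ℂ, b = k • a := by
  obtain ⟨z, w, h1⟩ := exists_linear_eq_one ha
  refine ⟨z * b 0 + w * b 1, ?_⟩
  unfold wd at h
  ext i
  fin_cases i <;> simp
  · linear_combination (-b 0) * h1 + w * h
  · linear_combination (-b 1) * h1 - z * h

lemma wd_self (a : Fin 2 → ℂ) : wd a a = 0 := by unfold wd; ring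

lemma wd_smul_left (k : ℂ) (a b : Fin 2 → ℂ) : wd (k • a) b = k * wd a b := by simp [wd]; ring

lemma wd_smul_right (k : ℂ) (a b : Fin 2 → ℂ) : wd a (k • b) = k * wd a b := by simp [wd]; ring

lemma wd_swap (a b : Fin 2 → ℂ) : wd a b = -wd b a := by simp [wd]; ring

/-! ### A graded Nakayama lemma -/

/-- The linear forms that vanish at `p`, as elements of an algebra over the polynomial ring. -/
def formsVanishingAt {A σ : Type*} [CommRing A] [Algebra ℂ A] (φ : MvPolynomial σ ℂ →ₐ[ℂ] A)
    (p : σ → ℂ) : Submodule ℂ A :=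
  (MvPolynomial.homogeneousSubmodule σ ℂ 1 ⊓
    LinearMap.ker (MvPolynomial.aeval p : MvPolynomial σ ℂ →ₐ[ℂ] ℂ).toLinearMap).map φ.toLinearMap

/-- A homogeneous form of Nakayama's lemma: if `W` is generated modulo the linear forms vanishing at
`p` by a power of a linear form `l₀`, then some form that does not vanish at `p` multiplies `W` into
the image of the polynomial ring. -/
lemma exists_form_mul_mem_range {A σ : Type*} [CommRing A] [Algebra ℂ A]
    (φ : MvPolynomial σ ℂ →ₐ[ℂ] A) (p : σ → ℂ) {l₀ : MvPolynomial σ ℂ} (hl₀ : l₀.IsHomogeneous 1)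
    (h₀ : MvPolynomial.eval p l₀ = 1) (N : ℕ) {W : Submodule ℂ A} (hW : W.FG)
    (h : ∀ t ∈ W, ∃ k : ℂ, φ l₀ * t - k • φ l₀ ^ (N + 1) ∈ formsVanishingAt φ p * W) :
    ∃ (n : ℕ) (M : MvPolynomial σ ℂ), M.IsHomogeneous n ∧ MvPolynomial.eval p M ≠ 0 ∧
      ∀ t ∈ W, ∃ G : MvPolynomial σ ℂ, G.IsHomogeneous (n + N) ∧ φ G = φ M * t := by
  classical
  obtain ⟨n, t, rfl⟩ := Submodule.fg_iff_exists_fin_generating_family.1 hW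
  have hJ : ∀ x ∈ formsVanishingAt φ p * Submodule.span ℂ (Set.range t),
      ∃ a : Fin n → MvPolynomial σ ℂ, (∀ j, (a j).IsHomogeneous 1) ∧
        (∀ j, MvPolynomial.eval p (a j) = 0) ∧ x = ∑ j, φ (a j) * t j := by
    intro x hx
    refine Submodule.mul_induction_on hx ?_ ?_
    · rintro l ⟨l, ⟨hl, hl0⟩, rfl⟩ w hw
      obtain ⟨c, rfl⟩ := (Submodule.mem_span_range_iff_exists_fun ℂ).1 hw
      refine ⟨fun j => c j • l, fun j => ?_, fun j => ?_, ?_⟩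
      · exact (MvPolynomial.homogeneousSubmodule σ ℂ 1).smul_mem _ hl
      · rw [MvPolynomial.smul_eval]
        exact mul_eq_zero_of_right _ (LinearMap.mem_ker.1 hl0)
      · rw [Finset.mul_sum]
        refine Finset.sum_congr rfl fun j _ => ?_
        simp
    · rintro x y ⟨a, h1, h2, rfl⟩ ⟨b, h3, h4, rfl⟩
      refine ⟨a + b, fun j => (h1 j).add (h3 j), fun j => by simp [h2, h4], ?_⟩
      simp [add_mul, Finset.sum_add_distrib]
  choose! k hk using h
  have hk' : ∀ i, ∃ a : Fin n → MvPolynomial σ ℂ, (∀ j, (a j).IsHomogeneous 1) ∧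
        (∀ j, MvPolynomial.eval p (a j) = 0) ∧
        φ l₀ * t i - k (t i) • φ l₀ ^ (N + 1) = ∑ j, φ (a j) * t j :=
    fun i => hJ _ (hk _ (Submodule.subset_span ⟨i, rfl⟩))
  choose a ha1 ha2 ha3 using hk'
  -- The determinant trick: `B` sends the generators `t` to multiples of `l₀ ^ (N + 1)`, so the
  -- adjugate of `B` writes `det B * t i` as the image of a polynomial.
  let B : Matrix (Fin n) (Fin n) (MvPolynomial σ ℂ) := Matrix.scalar (Fin n) l₀ - Matrix.of a
  have hB1 : ∀ i j, (B i j).IsHomogeneous 1 := by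
    intro i j
    simp only [B, Matrix.sub_apply, Matrix.of_apply, Matrix.scalar_apply, Matrix.diagonal_apply]
    refine MvPolynomial.IsHomogeneous.sub ?_ (ha1 i j)
    split_ifs
    exacts [hl₀, MvPolynomial.isHomogeneous_zero _ _ _]
  have hB2 : ∀ i, ∑ j, φ (B i j) * t j = φ (MvPolynomial.C (k (t i)) * l₀ ^ (N + 1)) := by
    intro i
    simp only [B, Matrix.sub_apply, Matrix.of_apply, Matrix.scalar_apply, Matrix.diagonal_apply,
      map_sub, sub_mul, Finset.sum_sub_distrib, ← ha3 i]
    rw [Finset.sum_eq_single i]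
    · simp [Algebra.smul_def, MvPolynomial.algHom_C]
    · intro j _ hj
      rw [if_neg hj.symm]; simp
    · simp
  refine ⟨n, B.det, ?_, ?_, ?_⟩
  · rw [Matrix.det_apply]
    refine MvPolynomial.IsHomogeneous.sum _ _ _ fun τ _ => ?_
    refine (MvPolynomial.homogeneousSubmodule σ ℂ n).toAddSubgroup.zsmul_mem ?_ _
    have := MvPolynomial.IsHomogeneous.prod Finset.univ (fun i => B (τ i) i) (fun _ => 1)
      fun i _ => hB1 _ _
    simpa using this
  -- At `p` the entries of `a` vanish and `l₀` is 1, so `det B` takes the value 1 there.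
  · have : (MvPolynomial.eval p).mapMatrix B = 1 := by
      ext i j
      simp only [B, RingHom.mapMatrix_apply, Matrix.map_apply, Matrix.sub_apply, Matrix.of_apply,
        Matrix.scalar_apply, map_sub, ha2, Matrix.diagonal_apply, Matrix.one_apply]
      split_ifs <;> simp [h₀]
    rw [RingHom.map_det, this]
    simp
  · have hadj : ∀ i j, (B.adjugate i j).IsHomogeneous (n - 1) := by
      intro i j
      rw [Matrix.adjugate_apply, Matrix.det_apply]
      refine MvPolynomial.IsHomogeneous.sum _ _ _ fun τ _ => ?_
      refine (MvPolynomial.homogeneousSubmodule σ ℂ (n - 1)).toAddSubgroup.zsmul_mem ?_ _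
      -- An adjugate entry is a determinant with one constant row; the factor from that row has
      -- degree 0, which leaves total degree `n - 1`.
      have := MvPolynomial.IsHomogeneous.prod Finset.univ
        (fun i' => B.updateRow j (Pi.single i 1) (τ i') i') (fun i' => if τ i' = j then 0 else 1) ?_
      · convert this using 1
        rw [← Equiv.sum_comp τ.symm]
        simp [Finset.sum_ite, Finset.filter_ne']
      · intro i' _
        simp only [Matrix.updateRow_apply]
        split_ifs
        · rw [Pi.single_apply]
          split_ifs
          exacts [MvPolynomial.isHomogeneous_one _ _, MvPolynomial.isHomogeneous_zero _ _ _]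
        · exact hB1 _ _
    have hgen : ∀ i, ∃ G : MvPolynomial σ ℂ, G.IsHomogeneous (n + N) ∧ φ G = φ B.det * t i := by
      intro i
      have hn : 0 < n := i.pos
      refine ⟨∑ j, B.adjugate i j * (MvPolynomial.C (k (t j)) * l₀ ^ (N + 1)), ?_, ?_⟩
      · refine MvPolynomial.IsHomogeneous.sum _ _ _ fun j _ => ?_
        have h1 := (hadj i j).mul
          ((MvPolynomial.isHomogeneous_C σ (k (t j))).mul (hl₀.pow (N + 1)))
        convert h1 using 1
        omega
      · rw [map_sum]
        simp only [map_mul φ (B.adjugate i _), ← hB2, Finset.mul_sum]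
        rw [Finset.sum_comm]
        simp only [← mul_assoc, ← Finset.sum_mul, ← map_mul, ← map_sum]
        simp only [← Matrix.mul_apply, Matrix.adjugate_mul, Matrix.smul_apply, Matrix.one_apply]
        rw [Finset.sum_eq_single i]
        · simp
        · intro j _ hj
          rw [if_neg hj.symm]; simp
        · simp
    intro x hx
    obtain ⟨c, rfl⟩ := (Submodule.mem_span_range_iff_exists_fun ℂ).1 hx
    choose G hG1 hG2 using hgen
    refine ⟨∑ i, c i • G i, ?_, ?_⟩
    · exact (MvPolynomial.homogeneousSubmodule σ ℂ (n + N)).sum_mem fun i _ =>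
        Submodule.smul_mem _ _ (hG1 i)
    · rw [map_sum, Finset.mul_sum]
      refine Finset.sum_congr rfl fun i _ => ?_
      rw [map_smul, hG2, mul_smul_comm]

/-! ### The coordinate ring of the scroll and the forms generated by a linear system -/

lemma mul_mem_binaryForms_of_eq {m n d : ℕ} (h : m + n = d) {F G : (Fin 2 → ℂ) → ℂ}
    (hF : F ∈ binaryForms m) (hG : G ∈ binaryForms n) : (fun s => F s * G s) ∈ binaryForms d :=
  h ▸ mul_mem_binaryForms hF hG

/-- The homogeneous coordinate ring in degree `N` of the scroll `S_{1,v}`. -/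
def scrollForms (v N : ℕ) : Submodule ℂ ((Fin 2 → ℂ) × (Fin 2 → ℂ) → ℂ) :=
  Submodule.span ℂ {t | ∃ i j, i + j = N ∧ ∃ G ∈ binaryForms (i + v * j),
    t = fun q => q.2 0 ^ i * q.2 1 ^ j * G q.1}

lemma mem_scrollForms {v N i j d : ℕ} (h : i + j = N) (hd : d = i + v * j) {G : (Fin 2 → ℂ) → ℂ}
    (hG : G ∈ binaryForms d) : (fun q => q.2 0 ^ i * q.2 1 ^ j * G q.1) ∈ scrollForms v N := by
  subst hd
  exact Submodule.subset_span ⟨i, j, h, G, hG, rfl⟩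

lemma mul_mem_scrollForms {v M N : ℕ} {x y : (Fin 2 → ℂ) × (Fin 2 → ℂ) → ℂ}
    (hx : x ∈ scrollForms v M) (hy : y ∈ scrollForms v N) : x * y ∈ scrollForms v (M + N) := by
  have : scrollForms v M * scrollForms v N ≤ scrollForms v (M + N) := by
    unfold scrollForms
    rw [Submodule.span_mul_span, Submodule.span_le]
    rintro _ ⟨_, ⟨i, j, h, G, hG, rfl⟩, _, ⟨i', j', h', G', hG', rfl⟩, rfl⟩
    have := mem_scrollForms (v := v) (N := M + N) (i := i + i') (j := j + j') (by omega) rfl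
      (mul_mem_binaryForms_of_eq (by ring) hG hG')
    refine (congrArg (· ∈ scrollForms v (M + N)) ?_).mpr this
    ext q
    simp only [Pi.mul_apply]
    ring
  exact this (Submodule.mul_mem_mul hx hy)

lemma pow_mem_scrollForms {v : ℕ} {x : (Fin 2 → ℂ) × (Fin 2 → ℂ) → ℂ}
    (hx : x ∈ scrollForms v 1) (N : ℕ) : x ^ (N + 1) ∈ scrollForms v (N + 1) := by
  induction N with
  | zero => simpa using hx
  | succ N ih => rw [pow_succ]; exact mul_mem_scrollForms ih hx

lemma scrollForms_fg (v N : ℕ) : (scrollForms v N).FG := by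
  have : scrollForms v N ≤ ⨆ i : Fin (N + 1), ⨆ j : Fin (N + 1), (binaryForms (i + v * j)).map
      ((LinearMap.mulLeft ℂ (fun q : (Fin 2 → ℂ) × (Fin 2 → ℂ) => q.2 0 ^ (i : ℕ) *
        q.2 1 ^ (j : ℕ))).comp (LinearMap.funLeft ℂ ℂ Prod.fst)) := by
    unfold scrollForms
    rw [Submodule.span_le]
    rintro _ ⟨i, j, h, G, hG, rfl⟩
    refine Submodule.mem_iSup_of_mem (⟨i, by omega⟩ : Fin (N + 1))
      (Submodule.mem_iSup_of_mem (⟨j, by omega⟩ : Fin (N + 1)) ⟨G, hG, ?_⟩)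
    rfl
  refine Submodule.FG.of_le ?_ this
  exact Submodule.fg_iSup _ fun i => Submodule.fg_iSup _ fun j => (binaryForms_fg _).map _

/-- In all large degrees, the multiples of the form `G` of degree `k` lie in `J · scrollForms`. -/
def EventuallyIn (v : ℕ) (J : Submodule ℂ ((Fin 2 → ℂ) × (Fin 2 → ℂ) → ℂ)) (k : ℕ)
    (G : (Fin 2 → ℂ) → ℂ) : Prop :=
  ∃ N₀, ∀ N ≥ N₀, ∀ i j d, i + j = N + 1 → k + d = i + v * j → ∀ r ∈ binaryForms d,
    (fun q => q.2 0 ^ i * q.2 1 ^ j * (G q.1 * r q.1)) ∈ J * scrollForms v N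

section
variable {v : ℕ} {J : Submodule ℂ ((Fin 2 → ℂ) × (Fin 2 → ℂ) → ℂ)}

/-- The system `J` has no base point on the ruling over `b`: it contains forms restricting there to
c₀ and to c₁ with value 1. Subtracting a multiple of such a form makes `r` divisible by `wd s b`,
and all error terms carry that factor, so they are covered by the hypothesis. -/
lemma EventuallyIn.of_mul_wd (hv : 1 ≤ v) {k : ℕ} {G : (Fin 2 → ℂ) → ℂ} (hG : G ∈ binaryForms k)
    {b : Fin 2 → ℂ} (hb : b ≠ 0)
    (hJ : ∀ x y : ℂ, ∃ α ∈ binaryForms 1, ∃ β ∈ binaryForms v,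
      (fun q => q.2 0 * α q.1 + q.2 1 * β q.1) ∈ J ∧ α b = x ∧ β b = y)
    (h : EventuallyIn v J (k + 1) (fun s => G s * wd s b)) : EventuallyIn v J k G := by
  obtain ⟨N₀, h⟩ := h
  -- This bound forces `d ≥ v` when `i = 0` and `d ≥ 1` otherwise, which leaves room for the
  -- quotients below.
  refine ⟨N₀ + k + v + 1, fun N hN i j d hij hd r hr => ?_⟩
  have hvj : j ≤ v * j := Nat.le_mul_of_pos_left _ hv
  rcases i with _ | i
  · rcases j with _ | j
    · omega
    have hvj' : j ≤ v * j := Nat.le_mul_of_pos_left _ hv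
    obtain ⟨d, rfl⟩ : ∃ d', d = d' + v := ⟨d - v, by rw [mul_add] at hd; omega⟩
    rw [mul_add, mul_one] at hd
    obtain ⟨v, rfl⟩ : ∃ v', v = v' + 1 := ⟨v - 1, by omega⟩
    obtain ⟨r', hr', hrb⟩ := exists_mem_binaryForms_apply hb d (r b)
    obtain ⟨α, hα, β, hβ, hl, hα1, hβ1⟩ := hJ 0 1
    obtain ⟨x, hx, hx1⟩ := exists_eq_wd_mul hb (n := d + v)
      (sub_mem_binaryForms (F := r) (G := fun s => β s * r' s) hr
        (mul_mem_binaryForms_of_eq (by omega) hβ hr')) (by simp [hβ1, hrb])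
    obtain ⟨y, hy, hy1⟩ := exists_eq_wd_mul hb (n := d)
      (mul_mem_binaryForms_of_eq (by omega) hα hr') (by simp [hα1])
    have m1 := Submodule.mul_mem_mul hl (mem_scrollForms (v := v + 1) (N := N) (i := 0) (j := j)
      (d := k + d) (by omega) (by omega) (mul_mem_binaryForms hG hr'))
    have m2 := h N (by omega) 0 (j + 1) (d + v) (by omega) (by rw [mul_add]; omega) x hx
    have m3 := h N (by omega) 1 j d (by omega) (by omega) y hy
    convert Submodule.sub_mem _ (Submodule.add_mem _ m1 m2) m3 using 1
    ext q
    simp only [Pi.add_apply, Pi.sub_apply, Pi.mul_apply]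
    linear_combination q.2 1 ^ (j + 1) * G q.1 * hx1 q.1 -
      q.2 0 * q.2 1 ^ j * G q.1 * hy1 q.1
  · obtain ⟨d, rfl⟩ : ∃ d', d = d' + 1 := ⟨d - 1, by omega⟩
    obtain ⟨v, rfl⟩ : ∃ v', v = v' + 1 := ⟨v - 1, by omega⟩
    obtain ⟨r', hr', hrb⟩ := exists_mem_binaryForms_apply hb d (r b)
    obtain ⟨α, hα, β, hβ, hl, hα1, hβ1⟩ := hJ 1 0
    obtain ⟨x, hx, hx1⟩ := exists_eq_wd_mul hb (n := d)
      (sub_mem_binaryForms (F := r) (G := fun s => α s * r' s) hr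
        (mul_mem_binaryForms_of_eq (by omega) hα hr')) (by simp [hα1, hrb])
    obtain ⟨y, hy, hy1⟩ := exists_eq_wd_mul hb (n := d + v)
      (mul_mem_binaryForms_of_eq (by omega) hβ hr') (by simp [hβ1])
    have m1 := Submodule.mul_mem_mul hl (mem_scrollForms (v := v + 1) (N := N) (i := i) (j := j)
      (d := k + d) (by omega) (by omega) (mul_mem_binaryForms hG hr'))
    have m2 := h N (by omega) (i + 1) j d (by omega) (by omega) x hx
    have m3 := h N (by omega) i (j + 1) (d + v) (by omega) (by rw [mul_add]; omega) y hy
    convert Submodule.sub_mem _ (Submodule.add_mem _ m1 m2) m3 using 1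
    ext q
    simp only [Pi.add_apply, Pi.sub_apply, Pi.mul_apply]
    linear_combination q.2 0 ^ (i + 1) * q.2 1 ^ j * G q.1 * hx1 q.1 -
      q.2 0 ^ i * q.2 1 ^ (j + 1) * G q.1 * hy1 q.1

/-- The zeros of `u` are peeled off one at a time. None of them is `a`, so `J` has no base point on
the corresponding ruling. -/
lemma EventuallyIn.of_mul (hv : 1 ≤ v) {a : Fin 2 → ℂ}
    (hJ : ∀ b : Fin 2 → ℂ, b ≠ 0 → wd b a ≠ 0 → ∀ x y : ℂ, ∃ α ∈ binaryForms 1,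
      ∃ β ∈ binaryForms v, (fun q => q.2 0 * α q.1 + q.2 1 * β q.1) ∈ J ∧ α b = x ∧ β b = y)
    (m : ℕ) {u : (Fin 2 → ℂ) → ℂ} (hu : u ∈ binaryForms m) (hua : u a ≠ 0) {k : ℕ}
    {G : (Fin 2 → ℂ) → ℂ} (hG : G ∈ binaryForms k)
    (h : EventuallyIn v J (k + m) (fun s => G s * u s)) : EventuallyIn v J k G := by
  induction m generalizing u k G with
  | zero =>
    obtain ⟨z, rfl⟩ := exists_const_of_mem_binaryForms_zero hu
    obtain ⟨N₀, h⟩ := h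
    refine ⟨N₀, fun N hN i j d hij hd r hr => ?_⟩
    convert h N hN i j d hij hd _ (const_mul_mem_binaryForms z⁻¹ hr) using 1
    ext q
    have : z ≠ 0 := hua
    field_simp
  | succ m ih =>
    obtain ⟨b, hb, hub⟩ := exists_zero_of_mem_binaryForms hu
    obtain ⟨u', hu', huu⟩ := exists_eq_wd_mul hb hu hub
    have hba : wd b a ≠ 0 := by
      intro h0
      apply hua
      rw [huu, wd_swap, h0]; simp
    refine ih hu' (fun h0 => hua (by rw [huu, h0, mul_zero])) hG ?_
    refine EventuallyIn.of_mul_wd hv (mul_mem_binaryForms hG hu') hb (hJ b hb hba) ?_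
    have e : (fun s => G s * u' s * wd s b) = fun s => G s * u s := by
      ext s
      rw [huu]; ring
    rw [e]
    exact h

lemma apply_eq_zero_of_mem_mul {N : ℕ} {q : (Fin 2 → ℂ) × (Fin 2 → ℂ)}
    (hJ : ∀ l ∈ J, l q = 0) {t : (Fin 2 → ℂ) × (Fin 2 → ℂ) → ℂ} (ht : t ∈ J * scrollForms v N) :
    t q = 0 := by
  refine Submodule.mul_induction_on ht (fun l hl w _ => by simp [hJ l hl]) ?_
  intro x y hx hy
  simp [hx, hy]

/-- The quotient of degree `N + 1` by `J * scrollForms v N` is spanned by the class of `m`.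
Evaluation at `q` kills `J` but not `m`, so it reads off the coefficient. -/
lemma mem_mul_of_monomial {N : ℕ} {q : (Fin 2 → ℂ) × (Fin 2 → ℂ)}
    (hJ : ∀ l ∈ J, l q = 0) {m : (Fin 2 → ℂ) × (Fin 2 → ℂ) → ℂ} (hm : m q ≠ 0)
    (h : ∀ i j, i + j = N + 1 → ∀ G ∈ binaryForms (i + v * j), ∃ k : ℂ,
      (fun q => q.2 0 ^ i * q.2 1 ^ j * G q.1) - k • m ∈ J * scrollForms v N)
    {t : (Fin 2 → ℂ) × (Fin 2 → ℂ) → ℂ} (ht : t ∈ scrollForms v (N + 1)) (htq : t q = 0) :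
    t ∈ J * scrollForms v N := by
  have : ∃ k : ℂ, t - k • m ∈ J * scrollForms v N := by
    clear htq
    rw [scrollForms] at ht
    induction ht using Submodule.span_induction with
    | mem x hx =>
      obtain ⟨i, j, hij, G, hG, rfl⟩ := hx
      exact h i j hij G hG
    | zero => exact ⟨0, by simp⟩
    | add x y hx hy h1 h2 =>
      obtain ⟨k, hk⟩ := h1
      obtain ⟨l, hl⟩ := h2
      exact ⟨k + l, by convert Submodule.add_mem _ hk hl using 1; module⟩
    | smul z x hx h1 =>
      obtain ⟨k, hk⟩ := h1
      exact ⟨z * k, by convert Submodule.smul_mem _ z hk using 1; module⟩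
  obtain ⟨k, hk⟩ := this
  have h1 := apply_eq_zero_of_mem_mul hJ hk
  simp only [Pi.sub_apply, htq, Pi.smul_apply, smul_eq_mul, zero_sub, neg_eq_zero, mul_eq_zero,
    hm, or_false] at h1
  simpa [h1] using hk

/-- Ruling directions: a linear form of the system that restricts to a nonzero form on the ruling
of `q` and the forms divisible by `wd s a` suffice to fill everything vanishing at `q`. -/
lemma exists_mem_mul_of_ne (hv : 1 ≤ v) {a g : Fin 2 → ℂ} (ha : a ≠ 0) (hg : g 1 ≠ 0)
    (hJ : ∀ l ∈ J, l (a, g) = 0) (h : EventuallyIn v J 1 (fun s => wd s a))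
    {α β : (Fin 2 → ℂ) → ℂ} (hα : α ∈ binaryForms 1) (hβ : β ∈ binaryForms v) (hα1 : α a = 1)
    (hl : (fun q => q.2 0 * α q.1 + q.2 1 * β q.1) ∈ J) :
    ∃ N ≥ 1, ∀ t ∈ scrollForms v (N + 1), t (a, g) = 0 → t ∈ J * scrollForms v N := by
  obtain ⟨N, h⟩ := h
  refine ⟨N + 1, by omega, fun t ht htq => ?_⟩
  replace h := h (N + 1) (by omega)
  obtain ⟨w, hw, hwa⟩ := exists_mem_binaryForms_apply ha (v * (N + 1 + 1)) 1
  refine mem_mul_of_monomial hJ (m := fun q => q.2 1 ^ (N + 1 + 1) * w q.1) (by simp [hwa, hg]) ?_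
    ht htq
  intro i
  obtain ⟨v, rfl⟩ : ∃ v', v = v' + 1 := ⟨v - 1, by omega⟩
  induction i with
  | zero =>
    intro j hj G hG
    obtain rfl : j = N + 1 + 1 := by omega
    rw [zero_add] at hG
    obtain ⟨d, hd⟩ : ∃ d, (v + 1) * (N + 1 + 1) = d + 1 :=
      ⟨(v + 1) * (N + 1 + 1) - 1, by
        have : 0 < (v + 1) * (N + 1 + 1) := by positivity
        omega⟩
    rw [hd] at hG hw
    obtain ⟨x, hx, hx1⟩ := exists_eq_wd_mul ha
      (sub_mem_binaryForms hG (const_mul_mem_binaryForms (G a) hw)) (by simp [hwa])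
    refine ⟨G a, ?_⟩
    convert h 0 (N + 1 + 1) d (by omega) (by omega) x hx using 1
    ext q
    simp only [Pi.sub_apply, Pi.smul_apply, smul_eq_mul]
    linear_combination q.2 1 ^ (N + 1 + 1) * hx1 q.1
  | succ i ih =>
    intro j hj G hG
    obtain ⟨d, hd⟩ : ∃ d, d = i + (v + 1) * j := ⟨_, rfl⟩
    have hd' : i + 1 + (v + 1) * j = d + 1 := by omega
    rw [hd'] at hG
    -- As `α a = 1`, `G` agrees with `α * r` modulo `wd s a`; modulo `J`, c₀α equals -c₁β. One
    -- factor c₀ is thus traded for c₁, and the induction on `i` ends at a pure power of c₁.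
    obtain ⟨r, hr, hra⟩ := exists_mem_binaryForms_apply ha d (G a)
    obtain ⟨x, hx, hx1⟩ := exists_eq_wd_mul ha
      (sub_mem_binaryForms hG (mul_mem_binaryForms_of_eq (add_comm _ _) hα hr))
      (by simp [hα1, hra])
    obtain ⟨k, hk⟩ := ih (j + 1) (by omega) (fun s => -1 * (β s * r s))
      (const_mul_mem_binaryForms _ (mul_mem_binaryForms_of_eq (by rw [hd]; ring) hβ hr))
    refine ⟨k, ?_⟩
    have m1 := Submodule.mul_mem_mul hl (mem_scrollForms (v := v + 1) (N := N + 1) (i := i) (j := j)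
      (by omega) hd hr)
    have m2 := h (i + 1) j d (by omega) (by omega) x hx
    convert Submodule.add_mem _ (Submodule.add_mem _ m1 m2) hk using 1
    ext q
    simp only [Pi.add_apply, Pi.sub_apply, Pi.mul_apply, Pi.smul_apply, smul_eq_mul]
    linear_combination q.2 0 ^ (i + 1) * q.2 1 ^ j * hx1 q.1

/-- Here the hypotheses force `g 1 = 0`, so the point lies on the directrix. Since `β a ≠ 0`, every
monomial containing c₁ lies in `J * scrollForms` up to a multiple of `wd s a`, and only powers of c₀
remain. -/
lemma exists_mem_mul_of_eq (hv : 1 ≤ v) {a g : Fin 2 → ℂ} (ha : a ≠ 0) (hg : g 0 ≠ 0)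
    (hJ : ∀ l ∈ J, l (a, g) = 0) (h : EventuallyIn v J 1 (fun s => wd s a))
    {β : (Fin 2 → ℂ) → ℂ} (hβ : β ∈ binaryForms v) (hβ1 : β a ≠ 0)
    (hl : (fun q => q.2 1 * β q.1) ∈ J) :
    ∃ N ≥ 1, ∀ t ∈ scrollForms v (N + 1), t (a, g) = 0 → t ∈ J * scrollForms v N := by
  obtain ⟨N, h⟩ := h
  refine ⟨N + 1, by omega, fun t ht htq => ?_⟩
  replace h := h (N + 1) (by omega)
  obtain ⟨w, hw, hwa⟩ := exists_mem_binaryForms_apply ha (N + 1 + 1) 1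
  refine mem_mul_of_monomial hJ (m := fun q => q.2 0 ^ (N + 1 + 1) * w q.1) (by simp [hwa, hg]) ?_
    ht htq
  intro i j hj G hG
  rcases j with _ | j
  · obtain rfl : i = N + 1 + 1 := by omega
    obtain ⟨x, hx, hx1⟩ := exists_eq_wd_mul ha
      (sub_mem_binaryForms hG (const_mul_mem_binaryForms (G a) hw)) (by simp [hwa])
    refine ⟨G a, ?_⟩
    convert h (N + 1 + 1) 0 (N + 1) (by omega) (by omega) x hx using 1
    ext q
    simp only [Pi.sub_apply, Pi.smul_apply, smul_eq_mul]
    linear_combination q.2 0 ^ (N + 1 + 1) * hx1 q.1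
  · obtain ⟨v, rfl⟩ : ∃ v', v = v' + 1 := ⟨v - 1, by omega⟩
    obtain ⟨d, hd⟩ : ∃ d, d = i + (v + 1) * j := ⟨_, rfl⟩
    have hd' : i + (v + 1) * (j + 1) = d + v + 1 := by rw [hd]; ring
    rw [hd'] at hG
    obtain ⟨r, hr, hra⟩ := exists_mem_binaryForms_apply ha d (G a / β a)
    obtain ⟨x, hx, hx1⟩ := exists_eq_wd_mul ha
      (sub_mem_binaryForms hG (mul_mem_binaryForms_of_eq (by omega) hβ hr))
      (by simp only [hra]; field_simp; simp)
    refine ⟨0, ?_⟩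
    have m1 := Submodule.mul_mem_mul hl (mem_scrollForms (v := v + 1) (N := N + 1) (i := i) (j := j)
      (by omega) hd hr)
    have m2 := h i (j + 1) (d + v) (by omega) (by omega) x hx
    convert Submodule.add_mem _ m1 m2 using 1
    ext q
    simp only [Pi.add_apply, Pi.sub_apply, Pi.mul_apply, Pi.smul_apply, smul_eq_mul]
    linear_combination q.2 0 ^ i * q.2 1 ^ (j + 1) * hx1 q.1

/-- The base step: a form `u` with `c₁ u ∈ J`, together with the form cutting out the ruling. -/
lemma eventuallyIn_of_mem {a : Fin 2 → ℂ} {k : ℕ} {u u' : (Fin 2 → ℂ) → ℂ}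
    (hu' : u' ∈ binaryForms k)
    (hl : (fun q => q.2 1 * u q.1) ∈ J)
    {β : (Fin 2 → ℂ) → ℂ}
    (hl' : (fun q => q.2 0 * wd q.1 a + q.2 1 * β q.1) ∈ J)
    {m : ℕ} (hm : k + 1 = v + m) {y w : (Fin 2 → ℂ) → ℂ} (hy : y ∈ binaryForms m)
    (hdiv : ∀ s, wd s a * u' s = u s * y s)
    (hw : w ∈ binaryForms k) (hdiv' : ∀ s, β s * u' s = u s * w s) :
    EventuallyIn v J (1 + k) (fun s => wd s a * u' s) := by
  refine ⟨k, fun N hN i j d hij hd r hr => ?_⟩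
  rcases j with _ | j
  · obtain rfl : i = N + 1 := by omega
    -- There is no c₁ to pair with `u`. The form cutting out the ruling replaces c₀ · wd by -c₁β,
    -- and `β * u'` is a multiple of `u`.
    have m1 := Submodule.mul_mem_mul hl' (mem_scrollForms (v := v) (N := N) (i := N) (j := 0)
      (d := k + d) (by omega) (by omega) (mul_mem_binaryForms hu' hr))
    have m2 := Submodule.mul_mem_mul hl (mem_scrollForms (v := v) (N := N) (i := N) (j := 0)
      (d := k + d) (by omega) (by omega) (mul_mem_binaryForms hw hr))
    convert Submodule.sub_mem _ m1 m2 using 1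
    ext q
    simp only [Pi.sub_apply, Pi.mul_apply]
    linear_combination -q.2 0 ^ N * q.2 1 * r q.1 * hdiv' q.1
  · have m2 := Submodule.mul_mem_mul hl (mem_scrollForms (v := v) (N := N) (i := i) (j := j)
      (d := m + d) (by omega) (by rw [mul_add] at hd; omega) (mul_mem_binaryForms hy hr))
    convert m2 using 1
    ext q
    simp only [Pi.mul_apply]
    linear_combination q.2 0 ^ i * q.2 1 ^ (j + 1) * r q.1 * hdiv q.1

end

/-! ### The projected scroll in coordinates and the recovery of the ruling from the image -/

/-- The parametrization of the cone over the projected scroll: the rulings join the points `(s, 0)`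
and `(e(s), f(s))` of `ℂ² × ℂ⁴`. -/
def xi {A : Type*} [CommRing A] [Algebra ℂ A] {v : ℕ} (e : Fin 2 → Fin (v + 1) → ℂ)
    (f : Fin 4 → Fin (v + 1) → ℂ) (s c : Fin 2 → A) : Fin (5 + 1) → A :=
  ![c 0 * s 0 + c 1 * hev v (e 0) s, c 0 * s 1 + c 1 * hev v (e 1) s, c 1 * hev v (f 0) s,
    c 1 * hev v (f 1) s, c 1 * hev v (f 2) s, c 1 * hev v (f 3) s]

section
variable {v : ℕ} {e : Fin 2 → Fin (v + 1) → ℂ} {f : Fin 4 → Fin (v + 1) → ℂ}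

lemma xi_smul {A : Type*} [CommRing A] [Algebra ℂ A] (k : A) (s c : Fin 2 → A) :
    xi e f s (k • c) = k • xi e f s c := by
  ext i
  fin_cases i <;> simp [xi] <;> ring

lemma xi_eq_iff {A : Type*} [CommRing A] [Algebra ℂ A] {s c : Fin 2 → A} {p : Fin (5 + 1) → A} :
    p = xi e f s c ↔ p 0 = c 0 * s 0 + c 1 * hev v (e 0) s ∧ p 1 = c 0 * s 1 + c 1 * hev v (e 1) s ∧
      ∀ i : Fin 4, p (Fin.natAdd 2 i) = c 1 * hev v (f i) s := by
  constructor
  · rintro rfl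
    refine ⟨rfl, rfl, fun i => ?_⟩
    fin_cases i <;> rfl
  · rintro ⟨h0, h1, h2⟩
    ext i
    fin_cases i
    exacts [h0, h1, h2 0, h2 1, h2 2, h2 3]

lemma xi_zero {A : Type*} [CommRing A] [Algebra ℂ A] (s c : Fin 2 → A) :
    xi e f s c 0 = c 0 * s 0 + c 1 * hev v (e 0) s := rfl

lemma xi_one {A : Type*} [CommRing A] [Algebra ℂ A] (s c : Fin 2 → A) :
    xi e f s c 1 = c 0 * s 1 + c 1 * hev v (e 1) s := rfl

lemma xi_natAdd {A : Type*} [CommRing A] [Algebra ℂ A] (s c : Fin 2 → A) (i : Fin 4) :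
    xi e f s c (Fin.natAdd 2 i) = c 1 * hev v (f i) s := (xi_eq_iff.1 rfl).2.2 i

/-- Since f has no base point at s, the last four coordinates force c₁ = 0, and then c₀s = 0 forces
c₀ = 0. Hence the centre misses the scroll and rulings embed. -/
lemma xi_ne_zero {s c : Fin 2 → ℂ} (hs : s ≠ 0) (hc : c ≠ 0) (hf : ∃ i, hev v (f i) s ≠ 0) :
    xi e f s c ≠ 0 := by
  intro h
  obtain ⟨h0, h1, h2⟩ := xi_eq_iff.1 h.symm
  obtain ⟨i, hi⟩ := hf
  have hc1 : c 1 = 0 := by simpa [hi] using (h2 i).symm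
  obtain ⟨z, w, hzw⟩ := exists_linear_eq_one hs
  apply hc
  ext j
  fin_cases j
  · simp only [hc1, zero_mul, add_zero, Pi.zero_apply] at h0 h1
    simp only [Fin.zero_eta, Pi.zero_apply]
    linear_combination (-c 0) * hzw - z * h0 - w * h1
  · exact hc1

lemma dotProduct_xi (k : Fin (5 + 1) → ℂ) (s c : Fin 2 → ℂ) :
    k ⬝ᵥ xi e f s c = c 0 * (k 0 * s 0 + k 1 * s 1) + c 1 * (k 0 * hev v (e 0) s +
      k 1 * hev v (e 1) s + ∑ i : Fin 4, k (Fin.natAdd 2 i) * hev v (f i) s) := by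
  have : k ⬝ᵥ xi e f s c = k 0 * xi e f s c 0 + k 1 * xi e f s c 1 +
      ∑ i : Fin 4, k (Fin.natAdd 2 i) * xi e f s c (Fin.natAdd 2 i) :=
    by
      rw [dotProduct, Fin.sum_univ_succ, Fin.sum_univ_succ, ← add_assoc]
      rfl
  rw [this]
  simp only [xi_zero, xi_one, xi_natAdd]
  simp only [mul_add, Finset.mul_sum]
  have : ∀ i : Fin 4, c 1 * (k (Fin.natAdd 2 i) * hev v (f i) s) =
    k (Fin.natAdd 2 i) * (c 1 * hev v (f i) s) := fun i => by ring
  simp only [this]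
  ring

/-- Evaluation of polynomials in the homogeneous coordinates of `ℙ⁵` on the scroll. -/
def pullback (e : Fin 2 → Fin (v + 1) → ℂ) (f : Fin 4 → Fin (v + 1) → ℂ) :
    MvPolynomial (Fin (5 + 1)) ℂ →ₐ[ℂ] ((Fin 2 → ℂ) × (Fin 2 → ℂ) → ℂ) :=
  MvPolynomial.aeval fun k q => xi e f q.1 q.2 k

lemma pullback_apply (F : MvPolynomial (Fin (5 + 1)) ℂ) (q : (Fin 2 → ℂ) × (Fin 2 → ℂ)) :
    pullback e f F q = MvPolynomial.eval (xi e f q.1 q.2) F := by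
  have : (Pi.evalAlgHom ℂ _ q).comp (pullback e f) = MvPolynomial.aeval (xi e f q.1 q.2) := by
    ext i
    simp [pullback]
  exact DFunLike.congr_fun this F

/-- The linear form with coefficients `k`. -/
def linForm (k : Fin (5 + 1) → ℂ) : MvPolynomial (Fin (5 + 1)) ℂ :=
  ∑ i, MvPolynomial.C (k i) * MvPolynomial.X i

lemma linForm_isHomogeneous (k : Fin (5 + 1) → ℂ) : (linForm k).IsHomogeneous 1 := by
  refine MvPolynomial.IsHomogeneous.sum _ _ _ fun i _ => ?_
  simpa using (MvPolynomial.isHomogeneous_C _ (k i)).mul (MvPolynomial.isHomogeneous_X ℂ i)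

lemma eval_linForm (k p : Fin (5 + 1) → ℂ) : MvPolynomial.eval p (linForm k) = k ⬝ᵥ p := by
  simp [linForm, dotProduct]

lemma linForm_mem_formsVanishingAt {k p : Fin (5 + 1) → ℂ} (h : k ⬝ᵥ p = 0)
    {α β : (Fin 2 → ℂ) → ℂ} (hα : ∀ s, k 0 * s 0 + k 1 * s 1 = α s)
    (hβ : ∀ s, k 0 * hev v (e 0) s + k 1 * hev v (e 1) s +
      ∑ i : Fin 4, k (Fin.natAdd 2 i) * hev v (f i) s = β s) :
    (fun q => q.2 0 * α q.1 + q.2 1 * β q.1) ∈ formsVanishingAt (pullback e f) p := by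
  refine ⟨linForm k, ⟨linForm_isHomogeneous k, ?_⟩, ?_⟩
  · exact (eval_linForm k p).trans h
  · ext q
    change pullback e f (linForm k) q = _
    rw [pullback_apply, eval_linForm, dotProduct_xi, hα, hβ]

lemma apply_eq_zero_of_mem_formsVanishingAt {q : (Fin 2 → ℂ) × (Fin 2 → ℂ)}
    {l : (Fin 2 → ℂ) × (Fin 2 → ℂ) → ℂ}
    (h : l ∈ formsVanishingAt (pullback e f) (xi e f q.1 q.2)) : l q = 0 := by
  obtain ⟨l, ⟨-, hl⟩, rfl⟩ := h
  change pullback e f l q = 0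
  rw [pullback_apply]
  exact hl

lemma yform_mem_binaryForms (e : Fin 2 → Fin (v + 1) → ℂ) (f : Fin 4 → Fin (v + 1) → ℂ)
    (x y : ℂ) (z : Fin 4 → ℂ) : (fun s => x * hev v (e 0) s + y * hev v (e 1) s +
      ∑ i : Fin 4, z i * hev v (f i) s) ∈ binaryForms v := by
  refine add_mem_binaryForms (add_mem_binaryForms
    (const_mul_mem_binaryForms _ (hev_mem_binaryForms _ _))
    (const_mul_mem_binaryForms _ (hev_mem_binaryForms _ _))) ?_
  have : (fun s : Fin 2 → ℂ => ∑ i : Fin 4, z i * hev v (f i) s) =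
      ∑ i : Fin 4, z i • fun s => hev v (f i) s := by
    ext s; simp
  rw [this]
  exact Submodule.sum_mem _ fun i _ => Submodule.smul_mem _ _ (hev_mem_binaryForms _ _)

lemma exists_dotProduct_eq {n m : ℕ} {M : Fin m → Fin n → ℂ} (h : LinearIndependent ℂ M)
    (z : Fin m → ℂ) : ∃ k : Fin n → ℂ, ∀ i, k ⬝ᵥ M i = z i := by
  obtain ⟨φ, hφ⟩ := (Module.Basis.span h).constr ℂ z |>.exists_extend
  refine ⟨fun j => φ (Pi.single j 1), fun i => ?_⟩
  have h1 : φ (M i) = z i := by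
    have := LinearMap.congr_fun hφ (Module.Basis.span h i)
    rw [Module.Basis.constr_basis] at this
    rw [← this, LinearMap.comp_apply, Submodule.subtype_apply, Module.Basis.span_apply]
  rw [← h1, dotProduct]
  conv_rhs => rw [← Finset.univ_sum_single (M i), map_sum]
  refine Finset.sum_congr rfl fun j _ => ?_
  have : Pi.single j (M i j) = M i j • (Pi.single j 1 : Fin n → ℂ) := by
    rw [← Pi.single_smul, smul_eq_mul, mul_one]
  rw [this, map_smul, smul_eq_mul, mul_comm]

/-- The system of linear forms vanishing at `p` separates points on rulings that miss `p`. -/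
lemma exists_mem_formsVanishingAt {b : Fin 2 → ℂ} (hb : b ≠ 0)
    (hf : ∃ i, hev v (f i) b ≠ 0) {p : Fin (5 + 1) → ℂ} (hp : ∀ c, xi e f b c ≠ p) (x y : ℂ) :
    ∃ α ∈ binaryForms 1, ∃ β ∈ binaryForms v,
      (fun q => q.2 0 * α q.1 + q.2 1 * β q.1) ∈ formsVanishingAt (pullback e f) p ∧
      α b = x ∧ β b = y := by
  -- `p` and the two points spanning the ruling are independent, so the values of a linear form at
  -- all three can be prescribed.
  have hlin : LinearIndependent ℂ ![xi e f b ![1, 0], xi e f b ![0, 1], p] := by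
    have key : ∀ c : Fin 2 → ℂ, xi e f b c = c 0 • xi e f b ![1, 0] + c 1 • xi e f b ![0, 1] := by
      intro c
      ext i
      fin_cases i <;> simp [xi]
    rw [Fintype.linearIndependent_iff]
    intro g hg
    rw [Fin.sum_univ_three] at hg
    change g 0 • xi e f b ![1, 0] + g 1 • xi e f b ![0, 1] + g 2 • p = 0 at hg
    have hkey := key ![g 0, g 1]
    simp only [Matrix.cons_val_zero, Matrix.cons_val_one] at hkey
    rw [← hkey] at hg
    have h2 : g 2 = 0 := by
      by_contra h2
      apply hp ((-(g 2)⁻¹) • ![g 0, g 1])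
      rw [xi_smul, eq_neg_of_add_eq_zero_left hg, neg_smul, smul_neg, neg_neg, smul_smul,
        inv_mul_cancel₀ h2, one_smul]
    rw [h2, zero_smul, add_zero] at hg
    have h3 : ![g 0, g 1] = 0 := by
      by_contra h3
      exact xi_ne_zero hb h3 hf hg
    intro i
    fin_cases i
    exacts [congrFun h3 0, congrFun h3 1, h2]
  obtain ⟨k, hk⟩ := exists_dotProduct_eq hlin ![x, y, 0]
  have h0 : k ⬝ᵥ xi e f b ![1, 0] = x := hk 0
  have h1 : k ⬝ᵥ xi e f b ![0, 1] = y := hk 1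
  have h2 : k ⬝ᵥ p = 0 := hk 2
  rw [dotProduct_xi] at h0 h1
  simp only [Matrix.cons_val_zero, Matrix.cons_val_one, one_mul, zero_mul, add_zero, zero_add]
    at h0 h1
  exact ⟨_, linear_mem_binaryForms _ _, _, yform_mem_binaryForms e f _ _ _,
    linForm_mem_formsVanishingAt h2 (fun _ => rfl) (fun _ => rfl), h0, h1⟩

lemma consCoeff_natAdd (x y : ℂ) (z : Fin 4 → ℂ) (i : Fin 4) :
    (![x, y, z 0, z 1, z 2, z 3] : Fin (5 + 1) → ℂ) (Fin.natAdd 2 i) = z i := by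
  fin_cases i <;> rfl

lemma linForm_consCoeff_mem {p : Fin (5 + 1) → ℂ} (x y : ℂ) (z : Fin 4 → ℂ)
    (h : x * p 0 + y * p 1 + ∑ i, z i * p (Fin.natAdd 2 i) = 0)
    {α β : (Fin 2 → ℂ) → ℂ} (hα : ∀ s, x * s 0 + y * s 1 = α s)
    (hβ : ∀ s, x * hev v (e 0) s + y * hev v (e 1) s + ∑ i : Fin 4, z i * hev v (f i) s = β s) :
    (fun q => q.2 0 * α q.1 + q.2 1 * β q.1) ∈ formsVanishingAt (pullback e f) p := by
  refine linForm_mem_formsVanishingAt (k := ![x, y, z 0, z 1, z 2, z 3]) ?_ hα fun s => ?_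
  · rw [← h, dotProduct, Fin.sum_univ_succ, Fin.sum_univ_succ, ← add_assoc]
    rfl
  · simp only [consCoeff_natAdd]
    exact hβ s

/-- If the image of the point `(a, g)` of the scroll lies on no other ruling, then the forms of the
linear system vanishing there generate, in high degree, everything that vanishes at `(a, g)`. -/
lemma exists_degree_forall_mem_mul (hv : 1 ≤ v) {a g : Fin 2 → ℂ} (ha : a ≠ 0) (hg : g ≠ 0)
    (hf : ∀ b : Fin 2 → ℂ, b ≠ 0 → ∃ i, hev v (f i) b ≠ 0)
    (him : ∃ k : Fin 4 → ℂ, ∃ u ∈ binaryForms (v - 1),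
      (∀ s, ∑ i, k i * hev v (f i) s = wd s a * u s) ∧ u a ≠ 0)
    (huniq : ∀ b c : Fin 2 → ℂ, b ≠ 0 → xi e f b c = xi e f a g → wd b a = 0) :
    ∃ N ≥ 1, ∀ t ∈ scrollForms v (N + 1), t (a, g) = 0 →
      t ∈ formsVanishingAt (pullback e f) (xi e f a g) * scrollForms v N := by
  have hJ0 : ∀ l ∈ formsVanishingAt (pullback e f) (xi e f a g), l (a, g) = 0 :=
    fun l hl => apply_eq_zero_of_mem_formsVanishingAt (q := (a, g)) hl
  have hJ : ∀ b : Fin 2 → ℂ, b ≠ 0 → wd b a ≠ 0 → ∀ x y : ℂ, ∃ α ∈ binaryForms 1,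
      ∃ β ∈ binaryForms v, (fun q => q.2 0 * α q.1 + q.2 1 * β q.1) ∈
        formsVanishingAt (pullback e f) (xi e f a g) ∧ α b = x ∧ β b = y :=
    fun b hb hba => exists_mem_formsVanishingAt hb (hf b hb) fun c hc => hba (huniq b c hb hc)
  obtain ⟨i₀, hi₀⟩ := hf a ha
  -- On the directrix every c₁fᵢ vanishes at the point, and one with `fᵢ a ≠ 0` starts the argument.
  -- Off the directrix the start is a hyperplane meeting the curve transversally at `a`, whose
  -- equation is `wd s a * u`.
  by_cases hg1 : g 1 = 0
  · have hg0 : g 0 ≠ 0 := fun h => hg (by ext i; fin_cases i <;> assumption)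
    have hl : (fun q => q.2 1 * hev v (f i₀) q.1) ∈
        formsVanishingAt (pullback e f) (xi e f a g) := by
      have := linForm_consCoeff_mem (e := e) (f := f) (p := xi e f a g) 0 0 (Pi.single i₀ 1)
        (α := fun _ => 0) (β := fun s => hev v (f i₀) s) (by simp [xi_natAdd, hg1])
        (by simp) (by simp [Pi.single_apply])
      simpa using this
    obtain ⟨β, hβ, hl'⟩ : ∃ β ∈ binaryForms v, (fun q => q.2 0 * wd q.1 a + q.2 1 * β q.1) ∈
        formsVanishingAt (pullback e f) (xi e f a g) :=
      ⟨_, yform_mem_binaryForms e f (a 1) (-a 0) 0,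
        linForm_consCoeff_mem (p := xi e f a g) (a 1) (-a 0) 0
          (α := fun s => wd s a) (by simp [xi_zero, xi_one, hg1]; ring)
          (fun s => by simp [wd]; ring) (fun s => rfl)⟩
    refine exists_mem_mul_of_eq hv ha hg0 hJ0 ?_ (hev_mem_binaryForms v (f i₀)) hi₀ hl
    refine EventuallyIn.of_mul hv hJ v (hev_mem_binaryForms v (f i₀)) hi₀ (wd_mem_binaryForms a) ?_
    exact eventuallyIn_of_mem (hev_mem_binaryForms v (f i₀)) hl hl' rfl (wd_mem_binaryForms a)
      (fun s => by ring) hβ (fun s => by ring)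
  · obtain ⟨k, u, hu, hku, hua⟩ := him
    obtain ⟨z, w, hzw⟩ := exists_linear_eq_one ha
    have hlu : (fun q => q.2 1 * (wd q.1 a * u q.1)) ∈
        formsVanishingAt (pullback e f) (xi e f a g) := by
      have := linForm_consCoeff_mem (e := e) (f := f) (p := xi e f a g) 0 0 k
        (α := fun _ => 0) (β := fun s => wd s a * u s) (by
          simp only [xi_natAdd, zero_mul, zero_add, mul_left_comm _ (g 1), ← Finset.mul_sum, hku,
            wd_self, mul_zero])
        (by simp) (by simpa using hku)
      simpa using this
    have hsys : ∀ x y : ℂ, ∃ β ∈ binaryForms v, (fun q => q.2 0 * (x * q.1 0 + y * q.1 1) +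
        q.2 1 * β q.1) ∈ formsVanishingAt (pullback e f) (xi e f a g) := by
      intro x y
      -- The value at the point of the part of the form in the first two coordinates, divided by `g
      -- 1`; the coefficient of `f i₀` is chosen to cancel it.
      let t := x * hev v (e 0) a + y * hev v (e 1) a + g 0 / g 1 * (x * a 0 + y * a 1)
      refine ⟨_, yform_mem_binaryForms e f x y (Pi.single i₀ (-t / hev v (f i₀) a)),
        linForm_consCoeff_mem x y (Pi.single i₀ (-t / hev v (f i₀) a)) ?_ (fun s => rfl)
        fun s => rfl⟩
      rw [Finset.sum_eq_single i₀ (fun i _ hi => by simp [hi]) (by simp)]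
      simp only [xi_natAdd, xi_zero, xi_one, t, Pi.single_eq_same]
      field_simp
      ring
    obtain ⟨β, hβ, hl⟩ := hsys z w
    obtain ⟨β', hβ', hl'⟩ := hsys (a 1) (-a 0)
    have hwd : ∀ s : Fin 2 → ℂ, a 1 * s 0 + -a 0 * s 1 = wd s a := fun s => by unfold wd; ring
    simp only [hwd] at hl'
    have hβ'a : β' a = 0 := by simpa [wd_self, hg1] using hJ0 _ hl'
    refine exists_mem_mul_of_ne hv ha hg1 hJ0 ?_ (linear_mem_binaryForms z w) hβ hzw hl
    refine EventuallyIn.of_mul hv hJ (v - 1) hu hua (wd_mem_binaryForms a) ?_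
    obtain ⟨v, rfl⟩ : ∃ v', v = v' + 1 := ⟨v - 1, by omega⟩
    obtain ⟨w', hw', hw1⟩ := exists_eq_wd_mul ha hβ' hβ'a
    exact eventuallyIn_of_mem (u := fun s => wd s a * u s) hu hlu hl' (m := 0) rfl
      (const_mem_binaryForms 1)
      (fun s => by ring) hw' (fun s => by rw [hw1]; ring)

/-- Near a point of the scroll whose image lies on no other ruling, the ruling can be recovered
rationally from the image point. -/
lemma exists_inverse_forms (hv : 1 ≤ v) {a g : Fin 2 → ℂ} (ha : a ≠ 0) (hg : g ≠ 0)
    (hf : ∀ b : Fin 2 → ℂ, b ≠ 0 → ∃ i, hev v (f i) b ≠ 0)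
    (him : ∃ k : Fin 4 → ℂ, ∃ u ∈ binaryForms (v - 1),
      (∀ s, ∑ i, k i * hev v (f i) s = wd s a * u s) ∧ u a ≠ 0)
    (huniq : ∀ b c : Fin 2 → ℂ, b ≠ 0 → xi e f b c = xi e f a g → wd b a = 0) :
    ∃ (n : ℕ) (P : Fin 2 → MvPolynomial (Fin (5 + 1)) ℂ), (∀ i, (P i).IsHomogeneous n) ∧
      (∀ s c, MvPolynomial.eval (xi e f s c) (P 0) * s 1 =
        MvPolynomial.eval (xi e f s c) (P 1) * s 0) ∧
      ∃ i, MvPolynomial.eval (xi e f a g) (P i) ≠ 0 := by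
  obtain ⟨N, hN, h⟩ := exists_degree_forall_mem_mul hv ha hg hf him huniq
  obtain ⟨k, hk⟩ : ∃ k : Fin (5 + 1) → ℂ, k ⬝ᵥ xi e f a g = 1 := by
    obtain ⟨k, hk⟩ := exists_dotProduct_eq (M := ![xi e f a g])
      (by simpa using xi_ne_zero ha hg (hf a ha)) ![1]
    exact ⟨k, hk 0⟩
  have hl : pullback e f (linForm k) ∈ scrollForms v 1 := by
    have h1 := mem_scrollForms (v := v) (N := 1) (i := 1) (j := 0) rfl (by omega)
      (linear_mem_binaryForms (k 0) (k 1))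
    have h2 := mem_scrollForms (v := v) (N := 1) (i := 0) (j := 1) rfl (by omega)
      (yform_mem_binaryForms e f (k 0) (k 1) fun i => k (Fin.natAdd 2 i))
    convert Submodule.add_mem _ h1 h2 using 1
    ext q
    rw [pullback_apply, eval_linForm, dotProduct_xi]
    simp
  obtain ⟨n, M, hM, hM0, hMW⟩ := exists_form_mul_mem_range (pullback e f) (xi e f a g)
    (linForm_isHomogeneous k) ((eval_linForm _ _).trans hk) N (scrollForms_fg v N) (by
      -- The form `l₀` is 1 at the point, so subtracting `t (a, g)` times its power leaves something
      -- vanishing there.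
      intro t ht
      refine ⟨t (a, g), h _ (Submodule.sub_mem _ ?_ (Submodule.smul_mem _ _ ?_)) ?_⟩
      · rw [add_comm]; exact mul_mem_scrollForms hl ht
      · exact pow_mem_scrollForms hl N
      · simp [pullback_apply, eval_linForm, hk])
  -- Any `m` with both m s₀ and m s₁ in degree `N` serves: the forms with pullback M m sᵢ have the
  -- ratio of the sᵢ, and their values at the point do not both vanish.
  obtain ⟨m, hm, hmt⟩ : ∃ m : (Fin 2 → ℂ) × (Fin 2 → ℂ) → ℂ, m (a, g) ≠ 0 ∧
      ∀ i, (fun q => m q * q.1 i) ∈ scrollForms v N := by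
    have hX : ∀ i : Fin 2, (fun s : Fin 2 → ℂ => s i) ∈ binaryForms 1 := by
      intro i
      fin_cases i
      · simpa using linear_mem_binaryForms 1 0
      · simpa using linear_mem_binaryForms 0 1
    by_cases hg1 : g 1 = 0
    · have hg0 : g 0 ≠ 0 := fun h => hg (by ext i; fin_cases i <;> assumption)
      obtain ⟨w, hw, hwa⟩ := exists_mem_binaryForms_apply ha (N - 1) 1
      refine ⟨fun q => q.2 0 ^ N * w q.1, by simp [hwa, hg0], fun i => ?_⟩
      convert mem_scrollForms (v := v) (N := N) (i := N) (j := 0) rfl (by omega)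
        (mul_mem_binaryForms_of_eq (d := N) (by omega) hw (hX i)) using 1
      ext q
      simp; ring
    · have : 0 < v * N := by positivity
      obtain ⟨w, hw, hwa⟩ := exists_mem_binaryForms_apply ha (v * N - 1) 1
      refine ⟨fun q => q.2 1 ^ N * w q.1, by simp [hwa, hg1], fun i => ?_⟩
      convert mem_scrollForms (v := v) (N := N) (i := 0) (j := N) (by omega) (by omega)
        (mul_mem_binaryForms_of_eq (d := v * N) (by omega) hw (hX i)) using 1
      ext q
      simp; ring
  choose P hP1 hP2 using fun i => hMW _ (hmt i)
  have hP : ∀ i s c, MvPolynomial.eval (xi e f s c) (P i) =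
      MvPolynomial.eval (xi e f s c) M * (m (s, c) * s i) := by
    intro i s c
    have := congrFun (hP2 i) (s, c)
    rwa [Pi.mul_apply, pullback_apply, pullback_apply] at this
  refine ⟨_, P, hP1, fun s c => by rw [hP, hP]; ring, ?_⟩
  obtain ⟨i, hi⟩ : ∃ i, a i ≠ 0 := Function.ne_iff.1 ha
  exact ⟨i, by rw [hP]; exact mul_ne_zero hM0 (mul_ne_zero hm hi)⟩

end

/-! ### Double points of the curve and tangent spaces over the dual numbers -/

section
variable {v : ℕ} {e : Fin 2 → Fin (v + 1) → ℂ} {f : Fin 4 → Fin (v + 1) → ℂ}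

lemma map_xi {A B : Type*} [CommRing A] [Algebra ℂ A] [CommRing B] [Algebra ℂ B] (g : A →ₐ[ℂ] B)
    (s c : Fin 2 → A) (k : Fin (5 + 1)) :
    g (xi e f s c k) = xi e f (fun i => g (s i)) (fun i => g (c i)) k := by
  fin_cases k <;> simp [xi, map_hev]

/-- The torus acting trivially on the parametrization. -/
lemma xi_torus {A : Type*} [CommRing A] [Algebra ℂ A] {k k' : A} (h : k * k' = 1)
    (s c : Fin 2 → A) : xi e f (fun i => k * s i) ![k' * c 0, k' ^ v * c 1] = xi e f s c := by
  have hv : k ^ v * k' ^ v = 1 := by rw [← mul_pow, h, one_pow]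
  symm
  rw [xi_eq_iff]
  refine ⟨?_, ?_, fun i => ?_⟩
  · simp only [xi_zero, Matrix.cons_val_zero, Matrix.cons_val_one, hev_mul]
    linear_combination (-c 0 * s 0) * h - (c 1 * hev v (e 0) s) * hv
  · simp only [xi_one, Matrix.cons_val_zero, Matrix.cons_val_one, hev_mul]
    linear_combination (-c 0 * s 1) * h - (c 1 * hev v (e 1) s) * hv
  · simp only [xi_natAdd, Matrix.cons_val_zero, Matrix.cons_val_one, hev_mul]
    linear_combination (- c 1 * hev v (f i) s) * hv

lemma eval_smul_of_isHomogeneous {σ : Type*} {n : ℕ} {F : MvPolynomial σ ℂ}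
    (hF : F.IsHomogeneous n) (k : ℂ) (x : σ → ℂ) :
    MvPolynomial.eval (k • x) F = k ^ n * MvPolynomial.eval x F := by
  rw [MvPolynomial.eval_eq, MvPolynomial.eval_eq, Finset.mul_sum]
  refine Finset.sum_congr rfl fun d hd => ?_
  have := hF (MvPolynomial.mem_support_iff.1 hd)
  simp only [Pi.smul_apply, smul_eq_mul, mul_pow, Finset.prod_mul_distrib, Finset.prod_pow_eq_pow_sum]
  rw [← this, Finsupp.weight_apply, Finsupp.sum]
  simp only [Pi.one_apply, smul_eq_mul, mul_one]
  ring

lemma exists_smul_normal_form {s : Fin 2 → ℂ} (hs : s ≠ 0) :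
    ∃ k : ℂ, k ≠ 0 ∧ (s = k • ![0, 1] ∨ ∃ t, s = k • ![1, t]) := by
  by_cases h : s 0 = 0
  · refine ⟨s 1, fun h1 => hs ?_, Or.inl ?_⟩ <;> ext i <;> fin_cases i <;> simp [h]
    exact h1
  · refine ⟨s 0, h, Or.inr ⟨s 1 / s 0, ?_⟩⟩
    ext i
    fin_cases i <;> simp
    field_simp

lemma hev_smul (co : Fin (v + 1) → ℂ) (k : ℂ) (s : Fin 2 → ℂ) :
    hev v co (k • s) = k ^ v * hev v co s := hev_mul v co k s

/-- A curve that is injective over the image of one point is injective up to finitely many points. -/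
lemma exists_finset_of_double_points (hv : 1 ≤ v)
    (hf : ∀ b : Fin 2 → ℂ, b ≠ 0 → ∃ i, hev v (f i) b ≠ 0)
    (him : ∀ a : Fin 2 → ℂ, a ≠ 0 → ∃ k : Fin 4 → ℂ, ∃ u ∈ binaryForms (v - 1),
      (∀ s, ∑ i, k i * hev v (f i) s = wd s a * u s) ∧ u a ≠ 0)
    {t₀ : ℂ} (ht₀ : ∀ (b : Fin 2 → ℂ) (k : ℂ), b ≠ 0 →
      (∀ i, k * hev v (f i) b = hev v (f i) ![1, t₀]) → wd b ![1, t₀] = 0) :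
    ∃ D : Finset (Fin 2 → ℂ), (∀ z ∈ D, z ≠ 0) ∧ ∀ (s t : Fin 2 → ℂ) (k : ℂ), s ≠ 0 → t ≠ 0 →
      wd s t ≠ 0 → (∀ i, hev v (f i) t = k * hev v (f i) s) → ∃ z ∈ D, ∃ m : ℂ, s = m • z := by
  classical
  have h1 : (![1, t₀] : Fin 2 → ℂ) ≠ 0 := fun h => by simpa using congrFun h 0
  -- For `e = 0` the slice c = (0, 1) is the curve itself, placed in 0 × ℂ⁴, so the inverse forms
  -- recover s from f(s).
  obtain ⟨n, P, hPn, hP, i₀, hi₀⟩ := exists_inverse_forms (e := 0) (f := f) hv h1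
    (g := ![0, 1]) (fun h => by simpa using congrFun h 1) hf (him _ h1) (fun b c hb hbc => by
      refine ht₀ b (c 1) hb fun i => ?_
      have := congrFun hbc (Fin.natAdd 2 i)
      simpa [xi_natAdd] using this)
  let p : Polynomial ℂ := MvPolynomial.aeval
    (xi (A := Polynomial ℂ) 0 f ![1, Polynomial.X] ![0, 1]) (P i₀)
  have hp : ∀ t, p.eval t = MvPolynomial.eval (xi (A := ℂ) 0 f ![1, t] ![0, 1]) (P i₀) := by
    intro t
    have : (Polynomial.aeval t).comp (MvPolynomial.aeval
        (xi (A := Polynomial ℂ) 0 f ![1, Polynomial.X] ![0, 1])) =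
        MvPolynomial.aeval (xi (A := ℂ) 0 f ![1, t] ![0, 1]) := by
      ext k
      simp only [AlgHom.comp_apply, MvPolynomial.aeval_X, map_xi]
      congr 1 <;> ext j <;> fin_cases j <;> simp
    exact DFunLike.congr_fun this (P i₀)
  have hp0 : p ≠ 0 := fun h => hi₀ (by rw [← hp, h, Polynomial.eval_zero])
  refine ⟨insert ![0, 1] (p.roots.toFinset.image fun t => ![1, t]), ?_, ?_⟩
  · intro z hz h
    rw [Finset.mem_insert, Finset.mem_image] at hz
    rcases hz with rfl | ⟨t, -, rfl⟩
    · simpa using congrFun h 1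
    · simpa using congrFun h 0
  · intro s t k hs ht hst hk
    obtain ⟨m, hm, rfl | ⟨τ, rfl⟩⟩ := exists_smul_normal_form hs
    · exact ⟨_, Finset.mem_insert_self _ _, m, rfl⟩
    · refine ⟨![1, τ], Finset.mem_insert_of_mem (Finset.mem_image_of_mem _ ?_), m, rfl⟩
      rw [Multiset.mem_toFinset, Polynomial.mem_roots hp0, Polynomial.IsRoot, hp]
      -- If `P i₀` does not vanish at f(s), then `P` recovers both s and t from proportional
      -- vectors, so s and t are proportional.
      by_contra h0
      apply hst
      have hx : xi (A := ℂ) 0 f t ![0, 1] = (k * m ^ v) • xi (A := ℂ) 0 f ![1, τ] ![0, 1] := by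
        symm
        rw [xi_eq_iff]
        refine ⟨by simp [xi_zero, hev], by simp [xi_one, hev], fun i => ?_⟩
        simp only [Pi.smul_apply, xi_natAdd, Matrix.cons_val_one, hk, hev_smul, smul_eq_mul]
        simp; ring
      have hkm : k * m ^ v ≠ 0 := by
        intro h
        rw [h, zero_smul] at hx
        exact xi_ne_zero ht (c := ![0, 1]) (fun h => by simpa using congrFun h 1) (hf t ht) hx
      have e1 := hP t ![0, 1]
      rw [hx, eval_smul_of_isHomogeneous (hPn _), eval_smul_of_isHomogeneous (hPn _), mul_assoc,
        mul_assoc] at e1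
      replace e1 := mul_left_cancel₀ (pow_ne_zero n hkm) e1
      have e2 := hP ![1, τ] ![0, 1]
      simp only [Matrix.cons_val_zero, Matrix.cons_val_one, mul_one] at e2
      rw [wd_smul_left]
      simp only [wd, Matrix.cons_val_zero, Matrix.cons_val_one, one_mul]
      apply mul_eq_zero_of_right
      have hi : ∀ i, MvPolynomial.eval (xi (A := ℂ) 0 f ![1, τ] ![0, 1]) (P i) *
          (t 1 - τ * t 0) = 0 := by
        intro i
        fin_cases i
        · simp only [Fin.zero_eta]; linear_combination e1 - t 0 * e2
        · simp only [Fin.mk_one]; rw [← e2]; linear_combination τ * e1 - τ * t 0 * e2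
      exact (mul_eq_zero.1 (hi i₀)).resolve_left h0

/-- First-order Taylor expansion over the dual numbers. -/
lemma aeval_dualNumber {σ : Type*} [Fintype σ] (x w : σ → ℂ) (F : MvPolynomial σ ℂ) :
    MvPolynomial.aeval (fun i => (TrivSqZeroExt.inl (x i) + TrivSqZeroExt.inr (w i) :
      DualNumber ℂ)) F = TrivSqZeroExt.inl (MvPolynomial.eval x F) +
      TrivSqZeroExt.inr (∑ i, w i * MvPolynomial.eval x (MvPolynomial.pderiv i F)) := by
  classical
  induction F using MvPolynomial.induction_on with
  | C a => simp [TrivSqZeroExt.algebraMap_eq_inl]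
  | add p q hp hq =>
    rw [map_add, hp, hq]
    ext <;> simp [mul_add, Finset.sum_add_distrib]
  | mul_X p i hp =>
    rw [map_mul, hp, MvPolynomial.aeval_X]
    ext
    · simp
    · have h1 : ∑ j, w j * (MvPolynomial.eval x p * (Pi.single j (1 : ℂ) : σ → ℂ) i) =
          w i * MvPolynomial.eval x p := by
        rw [Finset.sum_eq_single i (fun j _ hj => by simp [hj.symm]) (by simp)]
        simp
      have h2 : ∑ j, w j * MvPolynomial.eval x (MvPolynomial.pderiv j (p * MvPolynomial.X i)) =
          w i * MvPolynomial.eval x p +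
            (∑ j, w j * MvPolynomial.eval x (MvPolynomial.pderiv j p)) * x i := by
        rw [← h1, Finset.sum_mul, ← Finset.sum_add_distrib]
        refine Finset.sum_congr rfl fun j _ => ?_
        rw [Derivation.leibniz, MvPolynomial.pderiv_X]
        simp only [smul_eq_mul, map_add, map_mul, MvPolynomial.eval_X]
        have : MvPolynomial.eval x ((Pi.single j 1 : σ → MvPolynomial σ ℂ) i) =
            (Pi.single j (1 : ℂ) : σ → ℂ) i := by
          simp only [Pi.single_apply]; split_ifs <;> simp
        rw [this]
        ring
      rw [h2]
      simp
      ring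

/-- The Jacobian of the parametrization. -/
def jac (e : Fin 2 → Fin (v + 1) → ℂ) (f : Fin 4 → Fin (v + 1) → ℂ) (s c : Fin 2 → ℂ) :
    (Fin 2 ⊕ Fin 2 → ℂ) →ₗ[ℂ] (Fin (5 + 1) → ℂ) where
  toFun w k := ∑ j, w j * MvPolynomial.eval (Sum.elim s c) (MvPolynomial.pderiv j
    (xi e f (fun i => MvPolynomial.X (Sum.inl i)) (fun i => MvPolynomial.X (Sum.inr i)) k))
  map_add' w w' := by ext k; simp [add_mul, Finset.sum_add_distrib]
  map_smul' z w := by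
    ext k
    simp only [Pi.smul_apply, smul_eq_mul, RingHom.id_apply, Finset.mul_sum, mul_assoc]

lemma xi_dualNumber (s c : Fin 2 → ℂ) (w : Fin 2 ⊕ Fin 2 → ℂ) (k : Fin (5 + 1)) :
    xi (A := DualNumber ℂ) e f
      (fun i => TrivSqZeroExt.inl (s i) + TrivSqZeroExt.inr (w (Sum.inl i)))
      (fun i => TrivSqZeroExt.inl (c i) + TrivSqZeroExt.inr (w (Sum.inr i))) k =
      TrivSqZeroExt.inl (xi e f s c k) + TrivSqZeroExt.inr (jac e f s c w k) := by
  have h := aeval_dualNumber (Sum.elim s c) w (xi e f (fun i => MvPolynomial.X (Sum.inl i))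
    (fun i => MvPolynomial.X (Sum.inr i)) k)
  rw [map_xi] at h
  simp only [MvPolynomial.aeval_X, Sum.elim_inl, Sum.elim_inr] at h
  rw [h]
  have h' := map_xi (e := e) (f := f) (MvPolynomial.aeval (Sum.elim s c) :
    MvPolynomial (Fin 2 ⊕ Fin 2) ℂ →ₐ[ℂ] ℂ) (fun i => MvPolynomial.X (Sum.inl i))
    (fun i => MvPolynomial.X (Sum.inr i)) k
  simp only [MvPolynomial.aeval_X, Sum.elim_inl, Sum.elim_inr] at h'
  rw [← h']
  rfl

lemma xi_dualNumber' (s c : Fin 2 → DualNumber ℂ) (k : Fin (5 + 1)) :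
    xi e f s c k = TrivSqZeroExt.inl (xi e f (fun i => (s i).fst) (fun i => (c i).fst) k) +
      TrivSqZeroExt.inr (jac e f (fun i => (s i).fst) (fun i => (c i).fst)
        (Sum.elim (fun i => (s i).snd) (fun i => (c i).snd)) k) := by
  rw [← xi_dualNumber]
  simp only [Sum.elim_inl, Sum.elim_inr, TrivSqZeroExt.inl_fst_add_inr_snd_eq]

/-- The torus of `xi_torus` moves (s, c) without moving the image. Its tangent vector, obtained from
the parameter 1 + ε, is nonzero and lies in the kernel of a map with source of dimension 4. -/
lemma finrank_range_jac_le {s : Fin 2 → ℂ} (hs : s ≠ 0) (c : Fin 2 → ℂ) :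
    Module.finrank ℂ (LinearMap.range (jac e f s c)) ≤ 3 := by
  let k : DualNumber ℂ := 1 + TrivSqZeroExt.inr 1
  let k' : DualNumber ℂ := 1 - TrivSqZeroExt.inr 1
  have hk : k * k' = 1 := by
    ext <;> simp [k, k']
  let s' : Fin 2 → DualNumber ℂ := fun i => TrivSqZeroExt.inl (s i)
  let c' : Fin 2 → DualNumber ℂ := fun i => TrivSqZeroExt.inl (c i)
  have h1 := xi_torus (e := e) (f := f) hk s' c'
  let w : Fin 2 ⊕ Fin 2 → ℂ := Sum.elim (fun i => (k * s' i).snd)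
    fun i => (![k' * c' 0, k' ^ v * c' 1] i).snd
  have hw : jac e f s c w = 0 := by
    ext j
    have h2 := congrArg TrivSqZeroExt.snd (congrFun h1 j)
    rw [xi_dualNumber', xi_dualNumber' s' c'] at h2
    have e1 : (fun i => (k * s' i).fst) = s := by ext i; simp [k, s']
    have e2 : (fun i => (![k' * c' 0, k' ^ v * c' 1] i).fst) = c := by
      ext i; fin_cases i <;> simp [k', c']
    have e3 : (Sum.elim (fun i => (s' i).snd) fun i => (c' i).snd) = (0 : Fin 2 ⊕ Fin 2 → ℂ) := by
      ext i; rcases i with i | i <;> simp [s', c']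
    rw [e1, e2, e3, map_zero] at h2
    simpa only [TrivSqZeroExt.snd_add, TrivSqZeroExt.snd_inl, TrivSqZeroExt.snd_inr, zero_add,
      Pi.zero_apply] using h2
  have hw0 : w ≠ 0 := by
    obtain ⟨i, hi⟩ := Function.ne_iff.1 hs
    refine Function.ne_iff.2 ⟨Sum.inl i, ?_⟩
    simpa [w, k, s'] using hi
  have h3 := LinearMap.finrank_range_add_finrank_ker (jac e f s c)
  have h4 : 0 < Module.finrank ℂ (LinearMap.ker (jac e f s c)) := by
    rw [Module.finrank_pos_iff_exists_ne_zero]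
    exact ⟨⟨w, hw⟩, fun h => hw0 (congrArg Subtype.val h)⟩
  rw [Module.finrank_fintype_fun_eq_card] at h3
  rw [Fintype.card_sum, Fintype.card_fin] at h3
  omega

lemma algHom_aeval_xi {B : Type*} [CommRing B] [Algebra ℂ B]
    (g : MvPolynomial (Fin 2 ⊕ Fin 2) ℂ →ₐ[ℂ] B) (F : MvPolynomial (Fin (5 + 1)) ℂ) :
    g (MvPolynomial.aeval (xi e f (fun i => MvPolynomial.X (Sum.inl i))
      (fun i => MvPolynomial.X (Sum.inr i))) F) =
      MvPolynomial.aeval (xi e f (fun i => g (MvPolynomial.X (Sum.inl i)))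
        (fun i => g (MvPolynomial.X (Sum.inr i)))) F := by
  rw [← AlgHom.comp_apply]
  congr 1
  ext k
  simp only [AlgHom.comp_apply, MvPolynomial.aeval_X, map_xi]

/-- Tangent vectors of the parametrization are tangent to the cone. -/
lemma range_jac_le {S : Set (ℙ ℂ (Fin (5 + 1) → ℂ))}
    (hS : ∀ s c : Fin 2 → ℂ, ∀ (h : xi e f s c ≠ 0), Projectivization.mk ℂ _ h ∈ S)
    (s c : Fin 2 → ℂ) : LinearMap.range (jac e f s c) ≤ coneTangentSpace S (xi e f s c) := by
  rintro _ ⟨w, rfl⟩ k F hF hFS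
  have hp0 : ∀ s c : Fin 2 → ℂ, xi e f s c ≠ 0 → MvPolynomial.eval (xi e f s c) F = 0 := by
    intro s c h
    obtain ⟨z, hz⟩ := Projectivization.exists_smul_eq_mk_rep ℂ (xi e f s c) h
    have h1 := hFS _ (hS s c h)
    rw [← hz, Units.smul_def, eval_smul_of_isHomogeneous hF] at h1
    exact (mul_eq_zero.1 h1).resolve_left (pow_ne_zero _ z.ne_zero)
  have h0 : MvPolynomial.eval 0 F = 0 := by
    have hne : xi (A := ℂ) e f ![1, 0] ![1, 0] ≠ 0 := fun h => by
      simpa [xi_zero] using congrFun h 0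
    have := eval_smul_of_isHomogeneous hF 0 (xi e f ![1, 0] ![1, 0])
    rwa [hp0 _ _ hne, mul_zero, zero_smul] at this
  -- The pullback of `F` is zero as a polynomial and not just at complex points, so it may be
  -- evaluated at dual numbers.
  have hq : MvPolynomial.aeval (xi e f (fun i => MvPolynomial.X (Sum.inl i))
      (fun i => MvPolynomial.X (Sum.inr i)) : Fin (5 + 1) → MvPolynomial (Fin 2 ⊕ Fin 2) ℂ) F = 0 := by
    refine MvPolynomial.funext fun x => ?_
    rw [map_zero]
    refine (algHom_aeval_xi (MvPolynomial.aeval x) F).trans ?_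
    simp only [MvPolynomial.aeval_X]
    by_cases h : xi e f (fun i => x (Sum.inl i)) (fun i => x (Sum.inr i)) = 0
    · rw [h]; exact h0
    · exact hp0 _ _ h
  have h1 := algHom_aeval_xi (e := e) (f := f) (MvPolynomial.aeval (fun j =>
    (TrivSqZeroExt.inl (Sum.elim s c j) + TrivSqZeroExt.inr (w j) : DualNumber ℂ))) F
  rw [hq, map_zero] at h1
  simp only [MvPolynomial.aeval_X, Sum.elim_inl, Sum.elim_inr] at h1
  have h2 : xi e f (fun i => TrivSqZeroExt.inl (s i) + TrivSqZeroExt.inr (w (Sum.inl i)))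
      (fun i => TrivSqZeroExt.inl (c i) + TrivSqZeroExt.inr (w (Sum.inr i))) =
      fun k => (TrivSqZeroExt.inl (xi e f s c k) + TrivSqZeroExt.inr (jac e f s c w k) :
        DualNumber ℂ) := funext fun k => xi_dualNumber s c w k
  rw [h2, aeval_dualNumber] at h1
  have h3 := congrArg TrivSqZeroExt.snd h1
  simpa only [TrivSqZeroExt.snd_add, TrivSqZeroExt.snd_inl, TrivSqZeroExt.snd_inr, zero_add,
      TrivSqZeroExt.snd_zero] using h3.symm

lemma isHomogeneous_hev {n : ℕ} {P : Fin 2 → MvPolynomial (Fin (5 + 1)) ℂ}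
    (hP : ∀ i, (P i).IsHomogeneous n) (co : Fin (v + 1) → ℂ) :
    (hev v co P).IsHomogeneous (n * v) := by
  refine MvPolynomial.IsHomogeneous.sum _ _ _ fun j _ => ?_
  have := (MvPolynomial.isHomogeneous_C (Fin (5 + 1)) (co j)).mul
    (((hP 0).pow (v - (j : ℕ))).mul ((hP 1).pow (j : ℕ)))
  have e : 0 + (n * (v - (j : ℕ)) + n * (j : ℕ)) = n * v := by
    rw [zero_add, ← mul_add]
    congr 1
    omega
  rwa [e] at this

lemma xi_injective {s : Fin 2 → ℂ} (hs : s ≠ 0) (hf : ∃ i, hev v (f i) s ≠ 0) {c c' : Fin 2 → ℂ}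
    (h : xi e f s c = xi e f s c') : c = c' := by
  rw [← sub_eq_zero]
  by_contra hc
  apply xi_ne_zero (e := e) hs hc hf
  rw [← sub_eq_zero] at h
  rw [← h]
  ext i
  fin_cases i <;> simp [xi] <;> ring

/-- Where the ruling can be recovered rationally, the cone has dimension at most `3`. -/
lemma finrank_coneTangentSpace_le {S : Set (ℙ ℂ (Fin (5 + 1) → ℂ))}
    (hS : ∀ q ∈ S, ∃ s c : Fin 2 → ℂ, s ≠ 0 ∧ q.rep = xi e f s c)
    (hf : ∀ b : Fin 2 → ℂ, b ≠ 0 → ∃ i, hev v (f i) b ≠ 0)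
    {n : ℕ} {P : Fin 2 → MvPolynomial (Fin (5 + 1)) ℂ} (hPn : ∀ i, (P i).IsHomogeneous n)
    (hP : ∀ s c, MvPolynomial.eval (xi e f s c) (P 0) * s 1 =
        MvPolynomial.eval (xi e f s c) (P 1) * s 0)
    {s c : Fin 2 → ℂ} (hs : s ≠ 0) (hPs : ∃ i, MvPolynomial.eval (xi e f s c) (P i) ≠ 0) :
    Module.finrank ℂ (coneTangentSpace S (xi e f s c)) ≤ 3 := by
  -- the forms
  have hk : ∀ s c : Fin 2 → ℂ, s ≠ 0 → ∃ k : ℂ, ∀ i,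
      MvPolynomial.eval (xi e f s c) (P i) = k * s i := by
    intro s c hs
    obtain ⟨k, hk⟩ := exists_smul_of_wd_eq_zero (b := fun i => MvPolynomial.eval (xi e f s c) (P i))
      hs (by unfold wd; rw [hP]; ring)
    exact ⟨k, fun i => congrFun hk i⟩
  have hev_eval : ∀ (co : Fin (v + 1) → ℂ) (x : Fin (5 + 1) → ℂ), MvPolynomial.eval x (hev v co P) =
      hev v co fun i => MvPolynomial.eval x (P i) :=
    fun co x => map_hev (MvPolynomial.aeval x : MvPolynomial (Fin (5 + 1)) ℂ →ₐ[ℂ] ℂ) v co P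
  -- Equations of the scroll written through `P`: `G₁` says that y is proportional to f(P), and `G₂`
  -- that x minus the same multiple of e(P) is proportional to P.
  let G₁ : Fin 4 → Fin 4 → MvPolynomial (Fin (5 + 1)) ℂ := fun i j =>
    hev v (f i) P * MvPolynomial.X (Fin.natAdd 2 j) - hev v (f j) P * MvPolynomial.X (Fin.natAdd 2 i)
  let G₂ : Fin 4 → MvPolynomial (Fin (5 + 1)) ℂ := fun i =>
    hev v (f i) P * (MvPolynomial.X 0 * P 1 - MvPolynomial.X 1 * P 0) -
      MvPolynomial.X (Fin.natAdd 2 i) * (hev v (e 0) P * P 1 - hev v (e 1) P * P 0)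
  have hG₁ : ∀ i j, (G₁ i j).IsHomogeneous (n * v + 1) := fun i j =>
    ((isHomogeneous_hev hPn _).mul (MvPolynomial.isHomogeneous_X ℂ _)).sub
      ((isHomogeneous_hev hPn _).mul (MvPolynomial.isHomogeneous_X ℂ _))
  have hG₂ : ∀ i, (G₂ i).IsHomogeneous (n * v + (1 + n)) := by
    intro i
    refine ((isHomogeneous_hev hPn _).mul (((MvPolynomial.isHomogeneous_X ℂ _).mul (hPn 1)).sub
      ((MvPolynomial.isHomogeneous_X ℂ _).mul (hPn 0)))).sub ?_
    have := (MvPolynomial.isHomogeneous_X ℂ (Fin.natAdd 2 i : Fin (5 + 1))).mul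
      (((isHomogeneous_hev hPn (e 0)).mul (hPn 1)).sub ((isHomogeneous_hev hPn (e 1)).mul (hPn 0)))
    rwa [show 1 + (n * v + n) = n * v + (1 + n) by ring] at this
  have hG₁0 : ∀ i j s c, s ≠ 0 → MvPolynomial.eval (xi e f s c) (G₁ i j) = 0 := by
    intro i j s c hs
    obtain ⟨k, hk⟩ := hk s c hs
    simp only [G₁, map_sub, map_mul, MvPolynomial.eval_X, hev_eval, hk, hev_mul, xi_natAdd]
    ring
  have hG₂0 : ∀ i s c, s ≠ 0 → MvPolynomial.eval (xi e f s c) (G₂ i) = 0 := by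
    intro i s c hs
    obtain ⟨k, hk⟩ := hk s c hs
    simp only [G₂, map_sub, map_mul, MvPolynomial.eval_X, hev_eval, hk, hev_mul, xi_natAdd, xi_zero,
      xi_one]
    ring
  -- a tangent vector is a point of the cone over the dual numbers, which lifts
  have key : ∀ w ∈ coneTangentSpace S (xi e f s c), ∃ c' : Fin 2 → DualNumber ℂ,
      ∃ s' : Fin 2 → DualNumber ℂ,
      (∀ i, (s' i).fst = MvPolynomial.eval (xi e f s c) (P i)) ∧
      ∀ k, TrivSqZeroExt.inl (xi e f s c k) + TrivSqZeroExt.inr (w k) = xi e f s' c' k := by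
    intro w hw
    let x : Fin (5 + 1) → DualNumber ℂ :=
      fun k => TrivSqZeroExt.inl (xi e f s c k) + TrivSqZeroExt.inr (w k)
    have hx : ∀ (m : ℕ) (F : MvPolynomial (Fin (5 + 1)) ℂ), F.IsHomogeneous m →
        (∀ s c, s ≠ 0 → MvPolynomial.eval (xi e f s c) F = 0) → MvPolynomial.aeval x F = 0 := by
      intro m F hF hF0
      have h1 := hw m F hF fun q hq => by
        obtain ⟨s, c, hs, hq⟩ := hS q hq
        rw [hq, hF0 s c hs]
      simp only [x]
      rw [aeval_dualNumber, hF0 s c hs, h1]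
      simp
    let π : Fin 2 → DualNumber ℂ := fun i => MvPolynomial.aeval x (P i)
    have hπ : ∀ i, (π i).fst = MvPolynomial.eval (xi e f s c) (P i) := by
      intro i
      simp only [π, x]
      rw [aeval_dualNumber]
      simp
    have hev_x : ∀ co, MvPolynomial.aeval x (hev v co P) = hev v co π :=
      fun co => map_hev (MvPolynomial.aeval x : MvPolynomial (Fin (5 + 1)) ℂ →ₐ[ℂ] DualNumber ℂ)
        v co P
    have h1 : ∀ i j, hev v (f i) π * x (Fin.natAdd 2 j) = hev v (f j) π * x (Fin.natAdd 2 i) := by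
      intro i j
      have := hx _ _ (hG₁ i j) (hG₁0 i j)
      simp only [G₁, map_sub, map_mul, hev_x, MvPolynomial.aeval_X] at this
      exact sub_eq_zero.1 this
    have h2 : ∀ i, hev v (f i) π * (x 0 * π 1 - x 1 * π 0) =
        x (Fin.natAdd 2 i) * (hev v (e 0) π * π 1 - hev v (e 1) π * π 0) := by
      intro i
      have := hx _ _ (hG₂ i) (hG₂0 i)
      simp only [G₂, map_sub, map_mul, hev_x, MvPolynomial.aeval_X] at this
      exact sub_eq_zero.1 this
    have hπ0 : (fun i => (π i).fst) ≠ 0 := by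
      obtain ⟨i, hi⟩ := hPs
      exact Function.ne_iff.2 ⟨i, by rw [hπ]; exact hi⟩
    obtain ⟨i, hi⟩ := hf _ hπ0
    have hfst : (hev v (f i) π).fst = hev v (f i) fun i => (π i).fst :=
      map_hev (TrivSqZeroExt.fstHom ℂ ℂ ℂ) v (f i) π
    obtain ⟨y, hy⟩ : ∃ y, y * hev v (f i) π = 1 := by
      have : IsUnit (hev v (f i) π) := by
        rw [TrivSqZeroExt.isUnit_iff_isUnit_fst, hfst]
        exact hi.isUnit
      exact this.exists_left_inv
    obtain ⟨z, w', hzw⟩ := exists_linear_eq_one hπ0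
    obtain ⟨r, hr⟩ : ∃ r, r * (TrivSqZeroExt.inl z * π 0 + TrivSqZeroExt.inl w' * π 1) = 1 := by
      have : IsUnit (TrivSqZeroExt.inl z * π 0 + TrivSqZeroExt.inl w' * π 1) := by
        rw [TrivSqZeroExt.isUnit_iff_isUnit_fst]
        simp only [TrivSqZeroExt.fst_add, TrivSqZeroExt.fst_mul, TrivSqZeroExt.fst_inl, hzw]
        exact isUnit_one
      exact this.exists_left_inv
    -- This is the coordinate c₁ of the lift, read off through the unit fᵢ(π). By `h3` what remains
    -- of x is a multiple of π, and that multiple is c₀.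
    let d : DualNumber ℂ := y * x (Fin.natAdd 2 i)
    have h3 : (x 0 - d * hev v (e 0) π) * π 1 = (x 1 - d * hev v (e 1) π) * π 0 := by
      simp only [d]
      linear_combination (y) * h2 i - (x 0 * π 1 - x 1 * π 0) * hy
    refine ⟨![r * (TrivSqZeroExt.inl z * (x 0 - d * hev v (e 0) π) +
      TrivSqZeroExt.inl w' * (x 1 - d * hev v (e 1) π)), d], π, hπ, fun k => ?_⟩
    refine congrFun (?_ : x = _) k
    rw [xi_eq_iff]
    refine ⟨?_, ?_, fun j => ?_⟩
    · simp only [Matrix.cons_val_zero, Matrix.cons_val_one]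
      linear_combination (-(x 0 - d * hev v (e 0) π)) * hr + r * TrivSqZeroExt.inl w' * h3
    · simp only [Matrix.cons_val_zero, Matrix.cons_val_one]
      linear_combination (-(x 1 - d * hev v (e 1) π)) * hr - r * TrivSqZeroExt.inl z * h3
    · simp only [Matrix.cons_val_one, Matrix.cons_val_zero, d]
      linear_combination (-x (Fin.natAdd 2 j)) * hy + y * h1 i j
  let p : Fin 2 → ℂ := fun i => MvPolynomial.eval (xi e f s c) (P i)
  have hp : p ≠ 0 := Function.ne_iff.2 hPs
  have key' : ∀ w ∈ coneTangentSpace S (xi e f s c), ∃ c' : Fin 2 → ℂ, xi e f s c = xi e f p c' ∧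
      w ∈ LinearMap.range (jac e f p c') := by
    intro w hw
    obtain ⟨c', s', hs', h⟩ := key w hw
    have e1 : (fun i => (s' i).fst) = p := funext hs'
    simp only [xi_dualNumber', e1] at h
    refine ⟨fun i => (c' i).fst, ?_, Sum.elim (fun i => (s' i).snd) (fun i => (c' i).snd),
      funext fun k => ?_⟩
    · ext k
      simpa using congrArg TrivSqZeroExt.fst (h k)
    · have := congrArg TrivSqZeroExt.snd (h k)
      simpa only [TrivSqZeroExt.snd_add, TrivSqZeroExt.snd_inl, TrivSqZeroExt.snd_inr, zero_add]
        using this.symm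
  obtain ⟨c₀, hc₀, -⟩ := key' 0 (Submodule.zero_mem _)
  refine (Submodule.finrank_mono ?_).trans (finrank_range_jac_le hp c₀ (e := e) (f := f))
  intro w hw
  obtain ⟨c', hc', hw'⟩ := key' w hw
  rwa [xi_injective hp (hf p hp) (hc₀.symm.trans hc')]

end

/-! ### Intersections of rulings and the linear projection -/

section
variable {v : ℕ} {e : Fin 2 → Fin (v + 1) → ℂ} {f : Fin 4 → Fin (v + 1) → ℂ}

lemma hev_inl (n : ℕ) (co : Fin (n + 1) → ℂ) (s : Fin 2 → ℂ) :
    hev n co (fun i => (TrivSqZeroExt.inl (s i) : DualNumber ℂ)) =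
      TrivSqZeroExt.inl (hev n co s) :=
  (map_hev (TrivSqZeroExt.inlAlgHom ℂ ℂ ℂ) n co s).symm

lemma aeval_hev_X {A : Type*} [CommRing A] [Algebra ℂ A] (x : Fin 2 → A) (n : ℕ)
    (co : Fin (n + 1) → ℂ) :
    MvPolynomial.aeval x (hev n co (MvPolynomial.X : Fin 2 → MvPolynomial (Fin 2) ℂ)) =
      hev n co x := by
  rw [map_hev]
  simp only [MvPolynomial.aeval_X]

/-- The Leibniz rule at a zero: only the derivative of `wd` contributes. The factorisation is first
lifted to an identity of polynomials so that it holds over the dual numbers. -/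
lemma sum_hev_dualNumber {k : Fin 4 → ℂ} {a : Fin 2 → ℂ} {u : (Fin 2 → ℂ) → ℂ}
    (hu : u ∈ binaryForms (v - 1)) (h : ∀ s, ∑ i, k i * hev v (f i) s = wd s a * u s)
    (d : Fin 2 → ℂ) : (∑ i, TrivSqZeroExt.inl (k i) * hev v (f i)
      (fun j => (TrivSqZeroExt.inl (a j) + TrivSqZeroExt.inr (d j) : DualNumber ℂ))).snd =
      wd d a * u a := by
  obtain ⟨co, hco⟩ := exists_hev_eq hu
  have hq : ∑ i, MvPolynomial.C (k i) * hev v (f i) (MvPolynomial.X : Fin 2 → MvPolynomial (Fin 2) ℂ)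
      = (MvPolynomial.X 0 * MvPolynomial.C (a 1) - MvPolynomial.X 1 * MvPolynomial.C (a 0)) *
        hev (v - 1) co MvPolynomial.X := by
    refine MvPolynomial.funext fun s => ?_
    have e1 : ∀ (n : ℕ) (co : Fin (n + 1) → ℂ), MvPolynomial.eval s (hev n co MvPolynomial.X) =
        hev n co s := fun n co => aeval_hev_X s n co
    simp only [map_sum, map_mul, map_sub, MvPolynomial.eval_C, MvPolynomial.eval_X, e1, h, ← hco]
    rfl
  let x : Fin 2 → DualNumber ℂ := fun j => TrivSqZeroExt.inl (a j) + TrivSqZeroExt.inr (d j)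
  have h1 := congrArg (MvPolynomial.aeval x) hq
  simp only [map_sum, map_mul, map_sub, MvPolynomial.aeval_C, MvPolynomial.aeval_X, aeval_hev_X,
    TrivSqZeroExt.algebraMap_eq_inl] at h1
  change (∑ i, TrivSqZeroExt.inl (k i) * hev v (f i) x).snd = _
  rw [h1]
  have h2 : (hev (v - 1) co x).fst = u a := by
    have := map_hev (TrivSqZeroExt.fstHom ℂ ℂ ℂ) (v - 1) co x
    rw [hco]
    refine this.trans ?_
    congr 1
    ext i
    simp [x]
  generalize hev (v - 1) co x = y at h2 ⊢
  simp [x, h2, wd]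
  left
  ring

/-- Two rulings meet outside the directrix. -/
lemma snd_ne_zero_of_xi_eq (hf : ∀ b : Fin 2 → ℂ, b ≠ 0 → ∃ i, hev v (f i) b ≠ 0)
    {a b c d : Fin 2 → ℂ} (hc : c ≠ 0) (hab : wd a b ≠ 0) (h : xi e f a c = xi e f b d) :
    c 1 ≠ 0 := by
  have hb : b ≠ 0 := by rintro rfl; simp [wd] at hab
  intro hc1
  obtain ⟨i, hi⟩ := hf b hb
  have h0 := congrFun h (Fin.natAdd 2 i)
  rw [xi_natAdd, xi_natAdd, hc1, zero_mul] at h0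
  have hd1 : d 1 = 0 := by simpa [hi] using h0.symm
  have e0 := congrFun h 0
  have e1 := congrFun h 1
  rw [xi_zero, xi_zero, hc1, hd1] at e0
  rw [xi_one, xi_one, hc1, hd1] at e1
  have : c 0 * wd a b = 0 := by
    unfold wd; linear_combination b 1 * e0 - b 0 * e1
  apply hc
  ext i
  fin_cases i
  exacts [(mul_eq_zero.1 this).resolve_right hab, hc1]

/-- At the intersection of two rulings the cone has a tangent space of dimension at least `4`. -/
lemma three_lt_finrank_coneTangentSpace {S : Set (ℙ ℂ (Fin (5 + 1) → ℂ))}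
    (hS : ∀ s c : Fin 2 → ℂ, ∀ (h : xi e f s c ≠ 0), Projectivization.mk ℂ _ h ∈ S)
    (hf : ∀ b : Fin 2 → ℂ, b ≠ 0 → ∃ i, hev v (f i) b ≠ 0)
    (him : ∀ a : Fin 2 → ℂ, a ≠ 0 → ∃ k : Fin 4 → ℂ, ∃ u ∈ binaryForms (v - 1),
      (∀ s, ∑ i, k i * hev v (f i) s = wd s a * u s) ∧ u a ≠ 0)
    {a b c d : Fin 2 → ℂ} (hc : c ≠ 0) (hab : wd a b ≠ 0) (h : xi e f a c = xi e f b d) :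
    3 < Module.finrank ℂ (coneTangentSpace S (xi e f a c)) := by
  have ha : a ≠ 0 := by rintro rfl; simp [wd] at hab
  have hc1 : c 1 ≠ 0 := snd_ne_zero_of_xi_eq hf hc hab h
  obtain ⟨k, u, hu, hku, hua⟩ := him a ha
  -- tangent vectors
  let T := coneTangentSpace S (xi e f a c)
  have hT1 : ∀ w, jac e f a c w ∈ T := fun w => range_jac_le hS a c ⟨w, rfl⟩
  have hT2 : ∀ w, jac e f b d w ∈ T := fun w => by
    have := range_jac_le hS b d ⟨w, rfl⟩
    rwa [← h] at this
  have hjc : ∀ s c c' : Fin 2 → ℂ, jac e f s c (Sum.elim 0 c') = xi e f s c' := by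
    intro s c c'
    ext j
    have h1 := xi_dualNumber (e := e) (f := f) s c (Sum.elim 0 c') j
    have h2 : (fun i => (TrivSqZeroExt.inl (s i) +
        TrivSqZeroExt.inr ((Sum.elim 0 c' : Fin 2 ⊕ Fin 2 → ℂ) (Sum.inl i)) : DualNumber ℂ)) =
        fun i => TrivSqZeroExt.inl (s i) := by
      ext i <;> simp
    rw [h2] at h1
    have h4 := congrArg TrivSqZeroExt.snd h1
    rw [TrivSqZeroExt.snd_add, TrivSqZeroExt.snd_inl, TrivSqZeroExt.snd_inr, zero_add] at h4
    rw [← h4]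
    fin_cases j <;> simp [xi, hev_inl]
  have hD : ∑ i, k i * jac e f a c (Sum.elim b 0) (Fin.natAdd 2 i) = c 1 * (wd b a * u a) := by
    rw [← sum_hev_dualNumber hu hku b, TrivSqZeroExt.snd_sum, Finset.mul_sum]
    refine Finset.sum_congr rfl fun i _ => ?_
    have h1 := congrArg TrivSqZeroExt.snd
      (xi_dualNumber (e := e) (f := f) a c (Sum.elim b 0) (Fin.natAdd 2 i))
    rw [TrivSqZeroExt.snd_add, TrivSqZeroExt.snd_inl, TrivSqZeroExt.snd_inr, zero_add,
      xi_natAdd] at h1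
    rw [← h1]
    simp
    ring
  -- The two directrix points on the rulings, a second point of the ruling over `a`, and the
  -- derivative moving `a` towards `b`. The transversal hyperplane `k` detects the last vector, `f a
  -- ≠ 0` the third, and `wd a b ≠ 0` the first two.
  let M : Fin 4 → Fin (5 + 1) → ℂ := ![jac e f a c (Sum.elim 0 ![1, 0]),
    jac e f b d (Sum.elim 0 ![1, 0]), jac e f a c (Sum.elim 0 ![0, 1]), jac e f a c (Sum.elim b 0)]
  have hM : ∀ i, M i ∈ T := by
    intro i
    fin_cases i
    exacts [hT1 _, hT2 _, hT1 _, hT1 _]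
  have hlin : LinearIndependent ℂ M := by
    rw [Fintype.linearIndependent_iff]
    intro g hg
    rw [Fin.sum_univ_four] at hg
    simp only [M, hjc] at hg
    change g 0 • xi e f a ![1, 0] + g 1 • xi e f b ![1, 0] + g 2 • xi e f a ![0, 1] +
      g 3 • jac e f a c (Sum.elim b 0) = 0 at hg
    have hy : ∀ i : Fin 4, g 2 * hev v (f i) a +
        g 3 * jac e f a c (Sum.elim b 0) (Fin.natAdd 2 i) = 0 := by
      intro i
      have := congrFun hg (Fin.natAdd 2 i)
      simpa [xi_natAdd] using this
    have h3 : g 3 = 0 := by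
      have h1 : ∑ i, k i * (g 2 * hev v (f i) a +
        g 3 * jac e f a c (Sum.elim b 0) (Fin.natAdd 2 i)) = 0 := by simp [hy]
      have h2 : g 2 * ∑ i, k i * hev v (f i) a +
          g 3 * ∑ i, k i * jac e f a c (Sum.elim b 0) (Fin.natAdd 2 i) = 0 := by
        rw [← h1, Finset.mul_sum, Finset.mul_sum, ← Finset.sum_add_distrib]
        exact Finset.sum_congr rfl fun i _ => by ring
      rw [hku, wd_self, zero_mul, mul_zero, zero_add, hD] at h2
      refine (mul_eq_zero.1 h2).resolve_right (mul_ne_zero hc1 (mul_ne_zero ?_ hua))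
      rw [wd_swap]; exact neg_ne_zero.2 hab
    have h2 : g 2 = 0 := by
      obtain ⟨i, hi⟩ := hf a ha
      have := hy i
      rw [h3, zero_mul, add_zero] at this
      exact (mul_eq_zero.1 this).resolve_right hi
    have e0 := congrFun hg 0
    have e1 := congrFun hg 1
    simp only [h2, h3, zero_smul, add_zero, Pi.add_apply, Pi.smul_apply, xi_zero, xi_one,
      smul_eq_mul, Matrix.cons_val_zero, Matrix.cons_val_one, one_mul, zero_mul, Pi.zero_apply]
      at e0 e1
    have h0 : g 0 * wd a b = 0 := by unfold wd; linear_combination b 1 * e0 - b 0 * e1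
    have h1 : g 1 * wd a b = 0 := by unfold wd; linear_combination a 0 * e1 - a 1 * e0
    intro i
    fin_cases i
    exacts [(mul_eq_zero.1 h0).resolve_right hab, (mul_eq_zero.1 h1).resolve_right hab, h2, h3]
  have h1 := finrank_span_eq_card hlin
  rw [Fintype.card_fin] at h1
  have h2 : Submodule.span ℂ (Set.range M) ≤ T := by
    rw [Submodule.span_le]
    rintro _ ⟨i, rfl⟩
    exact hM i
  have := Submodule.finrank_mono h2
  change 3 < Module.finrank ℂ T
  omega

/-- The linear projection with `L (scrollVec 1 v s c) = xi e f s c`. -/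
def scrollProj (e : Fin 2 → Fin (v + 1) → ℂ) (f : Fin 4 → Fin (v + 1) → ℂ) :
    (Fin (1 + 1) ⊕ Fin (v + 1) → ℂ) →ₗ[ℂ] (Fin (5 + 1) → ℂ) where
  toFun x := ![x (Sum.inl 0) + ∑ j, e 0 j * x (Sum.inr j), x (Sum.inl 1) + ∑ j, e 1 j * x (Sum.inr j),
    ∑ j, f 0 j * x (Sum.inr j), ∑ j, f 1 j * x (Sum.inr j), ∑ j, f 2 j * x (Sum.inr j),
    ∑ j, f 3 j * x (Sum.inr j)]
  map_add' x y := by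
    ext k
    fin_cases k <;> simp [mul_add, Finset.sum_add_distrib] <;> ring
  map_smul' z x := by
    ext k
    fin_cases k <;> simp [Finset.mul_sum, mul_add, mul_left_comm]

lemma scrollProj_scrollVec (s c : Fin 2 → ℂ) :
    scrollProj e f (scrollVec 1 v s c) = xi e f s c := by
  have : ∀ co : Fin (v + 1) → ℂ, ∑ j, co j * (c 1 * (s 0 ^ (v - (j : ℕ)) * s 1 ^ (j : ℕ))) =
      c 1 * hev v co s := by
    intro co
    rw [hev, Finset.mul_sum]
    refine Finset.sum_congr rfl fun j _ => ?_
    simp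
    ring
  ext k
  fin_cases k <;> simp [scrollProj, scrollVec, xi, this]

lemma scrollVec_smul (u : ℕ) (k : ℂ) (s c : Fin 2 → ℂ) :
    scrollVec u v s (k • c) = k • scrollVec u v s c := by
  ext i
  rcases i with i | i <;> simp [scrollVec, mul_assoc]

/-- A linear form vanishing on the image vanishes on the directrix, which kills its first two
coefficients. Over a point of `A i` only `f i` is nonzero, which kills the one at `i`. -/
lemma scrollProj_surjective (hf : ∀ b : Fin 2 → ℂ, b ≠ 0 → ∃ i, hev v (f i) b ≠ 0)
    {A : Fin 4 → Finset ℂ} (hA : ∀ i, (A i).Nonempty)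
    (hfA : ∀ i j, j ≠ i → ∀ t ∈ A i, hev v (f j) ![1, t] = 0) :
    Function.Surjective (scrollProj e f) := by
  rw [← LinearMap.range_eq_top]
  by_contra hne
  obtain ⟨φ, hφ, hle⟩ := Submodule.exists_le_ker_of_lt_top _ (lt_top_iff_ne_top.2 hne)
  have h0 : ∀ s c : Fin 2 → ℂ, φ (xi e f s c) = 0 := fun s c =>
    hle ⟨scrollVec 1 v s c, scrollProj_scrollVec s c⟩
  let k : Fin (5 + 1) → ℂ := fun j => φ (Pi.single j 1)
  have hk : ∀ x, φ x = k ⬝ᵥ x := by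
    intro x
    conv_lhs => rw [← Finset.univ_sum_single x, map_sum]
    refine Finset.sum_congr rfl fun j _ => ?_
    have : Pi.single j (x j) = x j • (Pi.single j 1 : Fin (5 + 1) → ℂ) := by
      rw [← Pi.single_smul, smul_eq_mul, mul_one]
    rw [this, map_smul, smul_eq_mul, mul_comm]
  simp only [hk, dotProduct_xi] at h0
  have e0 := h0 ![1, 0] ![1, 0]
  have e1 := h0 ![0, 1] ![1, 0]
  simp at e0 e1
  have hy : ∀ i : Fin 4, k (Fin.natAdd 2 i) = 0 := by
    intro i
    obtain ⟨t, ht⟩ := hA i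
    have h1 : (![1, t] : Fin 2 → ℂ) ≠ 0 := fun h => by simpa using congrFun h 0
    have h2 := h0 ![1, t] ![0, 1]
    rw [Finset.sum_eq_single i (fun j _ hj => by rw [hfA i j hj t ht, mul_zero]) (by simp)] at h2
    simp only [e0, e1, Matrix.cons_val_zero, Matrix.cons_val_one, zero_mul, add_zero, zero_add,
      one_mul] at h2
    obtain ⟨j, hj⟩ := hf _ h1
    obtain rfl : j = i := by
      by_contra h
      exact hj (hfA i j h t ht)
    exact (mul_eq_zero.1 h2).resolve_right hj
  apply hφ
  ext j
  have hkj : k j = 0 := by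
    fin_cases j
    exacts [e0, e1, hy 0, hy 1, hy 2, hy 3]
  simpa using hkj

lemma exists_rep_of_mem_ruling {σ : ℙ ℂ (Fin 2 → ℂ)} {p : ℙ ℂ (Fin (1 + 1) ⊕ Fin (v + 1) → ℂ)}
    (hp : p ∈ ruling 1 v σ) : ∃ c : Fin 2 → ℂ, c ≠ 0 ∧ p.rep = scrollVec 1 v σ.rep c := by
  obtain ⟨c, h, rfl⟩ := hp
  obtain ⟨z, hz⟩ := Projectivization.exists_smul_eq_mk_rep ℂ _ h
  refine ⟨(z : ℂ) • c, ?_, ?_⟩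
  · refine smul_ne_zero z.ne_zero ?_
    rintro rfl
    apply h
    ext i
    rcases i with i | i <;> simp [scrollVec]
  · rw [← hz, scrollVec_smul]; rfl

/-- Rescaling a representative of a point of ℙ¹ is absorbed by the coordinates along the ruling. -/
lemma exists_torus {s t : Fin 2 → ℂ} {k : ℂ} (hk : k ≠ 0) (hst : s = k • t) (c : Fin 2 → ℂ) :
    ∃ c' : Fin 2 → ℂ, xi e f s c' = xi e f t c := by
  refine ⟨![k⁻¹ * c 0, k⁻¹ ^ v * c 1], ?_⟩
  rw [← xi_torus (mul_inv_cancel₀ hk) t c, hst]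
  rfl

lemma mem_projImage_ruling_iff {s : Fin 2 → ℂ} (hs : s ≠ 0) (q : ℙ ℂ (Fin (5 + 1) → ℂ)) :
    q ∈ projImage (scrollProj e f) (ruling 1 v (Projectivization.mk ℂ s hs)) ↔
      ∃ c : Fin 2 → ℂ, q.rep = xi e f s c := by
  obtain ⟨z, hz⟩ := Projectivization.exists_smul_eq_mk_rep ℂ s hs
  constructor
  · rintro ⟨p, hp, h, rfl⟩
    obtain ⟨c, hc, hpc⟩ := exists_rep_of_mem_ruling hp
    obtain ⟨w, hw⟩ := Projectivization.exists_smul_eq_mk_rep ℂ _ h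
    obtain ⟨c', hc'⟩ := exists_torus (e := e) (f := f) (s := s) (t := (z : ℂ) • s)
      (inv_ne_zero z.ne_zero) (by rw [smul_smul, inv_mul_cancel₀ z.ne_zero, one_smul]) c
    refine ⟨(w : ℂ) • c', ?_⟩
    rw [← hw, xi_smul, hc', hpc, scrollProj_scrollVec, ← hz]
    rfl
  · rintro ⟨c, hc⟩
    obtain ⟨c', hc'⟩ := exists_torus (e := e) (f := f) (s := (z : ℂ) • s) (t := s) z.ne_zero rfl c
    have hne : scrollVec 1 v (Projectivization.mk ℂ s hs).rep c' ≠ 0 := by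
      intro h
      apply q.rep_nonzero
      rw [hc, ← hc', ← scrollProj_scrollVec]
      have : scrollVec 1 v ((z : ℂ) • s) c' = 0 := by rw [← h, ← hz]; rfl
      rw [this, map_zero]
    obtain ⟨w, hw⟩ := Projectivization.exists_smul_eq_mk_rep ℂ _ hne
    have hL : scrollProj e f (Projectivization.mk ℂ _ hne).rep = (w : ℂ) • q.rep := by
      rw [← hw, Units.smul_def, map_smul, scrollProj_scrollVec, hc, ← hc', ← hz]
      rfl
    refine ⟨Projectivization.mk ℂ _ hne, ⟨c', hne, rfl⟩, ?_, ?_⟩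
    · rw [hL]; exact smul_ne_zero w.ne_zero q.rep_nonzero
    · refine q.mk_rep.symm.trans ((Projectivization.mk_eq_mk_iff' ℂ _ _ _ _).2 ⟨(w : ℂ)⁻¹, ?_⟩)
      rw [hL, smul_smul, inv_mul_cancel₀ w.ne_zero, one_smul]

lemma mem_projImage_scroll_iff (q : ℙ ℂ (Fin (5 + 1) → ℂ)) :
    q ∈ projImage (scrollProj e f) (rationalNormalScroll 1 v) ↔
      ∃ s c : Fin 2 → ℂ, s ≠ 0 ∧ q.rep = xi e f s c := by
  constructor
  · rintro ⟨p, hp, h, rfl⟩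
    obtain ⟨σ, hσ⟩ := Set.mem_iUnion.1 hp
    have h1 := (mem_projImage_ruling_iff (e := e) (f := f) σ.rep_nonzero
      (Projectivization.mk ℂ _ h)).1 ⟨p, by rwa [σ.mk_rep], h, rfl⟩
    obtain ⟨c, hc⟩ := h1
    exact ⟨_, c, σ.rep_nonzero, hc⟩
  · rintro ⟨s, c, hs, hq⟩
    obtain ⟨p, hp, h, h'⟩ := (mem_projImage_ruling_iff (e := e) (f := f) hs q).2 ⟨c, hq⟩
    exact ⟨p, Set.mem_iUnion.2 ⟨_, hp⟩, h, h'⟩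

end

/-! ### The general choice of e, and birationality -/

section
variable {v : ℕ} {e : Fin 2 → Fin (v + 1) → ℂ} {f : Fin 4 → Fin (v + 1) → ℂ}

lemma xi_sub (s c d : Fin 2 → ℂ) : xi e f s (c - d) = xi e f s c - xi e f s d := by
  ext i
  fin_cases i <;> simp [xi] <;> ring

lemma cons_one_ne_zero (t : ℂ) : (![1, t] : Fin 2 → ℂ) ≠ 0 := fun h => by simpa using congrFun h 0

lemma wd_cons_one (t t' : ℂ) : wd ![1, t] ![1, t'] = t' - t := by simp [wd]

/-- For a general choice of `e`, no three rulings over points of one `A i` are concurrent. -/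
lemma exists_no_three_concurrent (hv : 2 ≤ v)
    (hf : ∀ b : Fin 2 → ℂ, b ≠ 0 → ∃ i, hev v (f i) b ≠ 0) {A : Fin 4 → Finset ℂ}
    (hfA : ∀ i j, j ≠ i → ∀ t ∈ A i, hev v (f j) ![1, t] = 0) :
    ∃ e : Fin 2 → Fin (v + 1) → ℂ, ∀ i, ∀ t₁ ∈ A i, ∀ t₂ ∈ A i, ∀ t₃ ∈ A i, t₁ ≠ t₂ → t₁ ≠ t₃ →
      t₂ ≠ t₃ → ∀ c₁ c₂ c₃ : Fin 2 → ℂ, xi e f ![1, t₁] c₁ = xi e f ![1, t₂] c₂ →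
      xi e f ![1, t₁] c₁ = xi e f ![1, t₃] c₃ → c₁ = 0 := by
  have hfi : ∀ i, ∀ t ∈ A i, hev v (f i) ![1, t] ≠ 0 := by
    intro i t ht
    obtain ⟨j, hj⟩ := hf _ (cons_one_ne_zero t)
    obtain rfl : j = i := by
      by_contra h
      exact hj (hfA i j h t ht)
    exact hj
  let ι := {x : (i : Fin 4) × (A i × A i × A i) // x.2.1 ≠ x.2.2.1 ∧ x.2.1 ≠ x.2.2.2 ∧
    x.2.2.1 ≠ x.2.2.2}
  let ev : ℂ → (Fin 2 → Fin (v + 1) → ℂ) →ₗ[ℂ] ℂ := fun t =>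
    { toFun := fun e => hev v (e 0) ![1, t] * t - hev v (e 1) ![1, t]
      map_add' := fun e e' => by simp [hev, add_mul, Finset.sum_add_distrib]; ring
      map_smul' := fun z e => by
        simp [hev, mul_assoc, ← Finset.mul_sum]; ring }
  -- At a common point (x, y) of the rulings, c₁ on the j-th one is yᵢ / κⱼ with κⱼ = fᵢ(1, tⱼ), and
  -- c₁ times `ev tⱼ` equals x₀tⱼ - x₁. So `ev tⱼ / κⱼ` is affine in tⱼ, and `Λ` is the relation
  -- satisfied by the values of an affine function at three points.
  let Λ : ι → Module.Dual ℂ (Fin 2 → Fin (v + 1) → ℂ) := fun x =>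
    (((x.1.2.2.1 : ℂ) - x.1.2.2.2) / hev v (f x.1.1) ![1, (x.1.2.1 : ℂ)]) • ev x.1.2.1 +
    (((x.1.2.2.2 : ℂ) - x.1.2.1) / hev v (f x.1.1) ![1, (x.1.2.2.1 : ℂ)]) • ev x.1.2.2.1 +
    (((x.1.2.1 : ℂ) - x.1.2.2.1) / hev v (f x.1.1) ![1, (x.1.2.2.2 : ℂ)]) • ev x.1.2.2.2
  obtain ⟨e, he⟩ := Module.Dual.exists_forall_ne_zero_of_forall_exists Λ (by
    rintro ⟨⟨i, ⟨t₁, h₁⟩, ⟨t₂, h₂⟩, ⟨t₃, h₃⟩⟩, h12, h13, h23⟩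
    simp only [ne_eq, Subtype.mk.injEq] at h12 h13 h23
    obtain ⟨w, hw, hw1⟩ := exists_mem_binaryForms_apply (cons_one_ne_zero t₁) (v - 2) 1
    obtain ⟨co, hco⟩ := exists_hev_eq (mul_mem_binaryForms_of_eq (d := v) (by omega)
      (mul_mem_binaryForms (wd_mem_binaryForms ![1, t₂]) (wd_mem_binaryForms ![1, t₃])) hw)
    -- `co` vanishes at t₂ and t₃ but not at t₁, so just one term of `Λ` survives.
    refine ⟨![0, co], ?_⟩
    have e0 : ∀ t : ℂ, hev v (0 : Fin (v + 1) → ℂ) ![1, t] = 0 := fun t => by simp [hev]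
    simp [Λ, ev, e0, ← hco, wd_cons_one, hw1]
    exact ⟨⟨sub_ne_zero.2 h23, hfi i t₁ h₁⟩, sub_ne_zero.2 (Ne.symm h12), sub_ne_zero.2 (Ne.symm h13)⟩)
  refine ⟨e, fun i t₁ h₁ t₂ h₂ t₃ h₃ h12 h13 h23 c₁ c₂ c₃ hc2 hc3 => ?_⟩
  by_contra hc
  have hc1 : c₁ 1 ≠ 0 := snd_ne_zero_of_xi_eq hf hc
    (by rw [wd_cons_one]; exact sub_ne_zero.2 (Ne.symm h12)) hc2
  refine he ⟨⟨i, ⟨t₁, h₁⟩, ⟨t₂, h₂⟩, ⟨t₃, h₃⟩⟩, by simpa using h12, by simpa using h13,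
    by simpa using h23⟩ ?_
  have k1 := hfi i t₁ h₁
  have k2 := hfi i t₂ h₂
  have k3 := hfi i t₃ h₃
  have y2 := congrFun hc2 (Fin.natAdd 2 i)
  have y3 := congrFun hc3 (Fin.natAdd 2 i)
  have x20 := congrFun hc2 0
  have x21 := congrFun hc2 1
  have x30 := congrFun hc3 0
  have x31 := congrFun hc3 1
  simp only [xi_natAdd, xi_zero, xi_one, Matrix.cons_val_zero, Matrix.cons_val_one, mul_one]
    at y2 y3 x20 x21 x30 x31
  simp only [Λ, ev, LinearMap.add_apply, LinearMap.smul_apply, LinearMap.coe_mk, AddHom.coe_mk,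
    smul_eq_mul]
  generalize hev v (f i) ![1, t₁] = κ₁ at *
  generalize hev v (f i) ![1, t₂] = κ₂ at *
  generalize hev v (f i) ![1, t₃] = κ₃ at *
  have hc2' : c₂ 1 = c₁ 1 * κ₁ / κ₂ := by field_simp; linear_combination -y2
  have hc3' : c₃ 1 = c₁ 1 * κ₁ / κ₃ := by field_simp; linear_combination -y3
  refine (mul_eq_zero.1 (?_ : (c₁ 1 * κ₁) * _ = 0)).resolve_left (mul_ne_zero hc1 k1)
  have h4 : ∀ E₁ E₂ E₃ : ℂ, c₁ 1 * κ₁ * ((t₂ - t₃) / κ₁ * E₁ + (t₃ - t₁) / κ₂ * E₂ +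
      (t₁ - t₂) / κ₃ * E₃) = (t₂ - t₃) * (c₁ 1 * E₁) + (t₃ - t₁) * (c₂ 1 * E₂) +
      (t₁ - t₂) * (c₃ 1 * E₃) := by
    intro E₁ E₂ E₃
    rw [hc2', hc3']
    field_simp
  rw [h4]
  linear_combination -(t₃ - t₁) * (t₂ * x20 - x21) - (t₁ - t₂) * (t₃ * x30 - x31)

lemma exists_mk_rep_eq {s c : Fin 2 → ℂ} (h : xi e f s c ≠ 0) :
    ∃ z : ℂ, z ≠ 0 ∧ (Projectivization.mk ℂ _ h).rep = xi e f s (z • c) := by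
  obtain ⟨z, hz⟩ := Projectivization.exists_smul_eq_mk_rep ℂ _ h
  exact ⟨z, z.ne_zero, by rw [xi_smul, ← hz]; rfl⟩

lemma ne_zero_of_rep_eq {q : ℙ ℂ (Fin (5 + 1) → ℂ)} {s c : Fin 2 → ℂ} (h : q.rep = xi e f s c) :
    c ≠ 0 := by
  rintro rfl
  apply q.rep_nonzero
  rw [h]
  ext i
  fin_cases i <;> simp [xi]

lemma mk_xi_mem (hv : 1 ≤ v) (s c : Fin 2 → ℂ) (h : xi e f s c ≠ 0) :
    Projectivization.mk ℂ _ h ∈ projImage (scrollProj e f) (rationalNormalScroll 1 v) := by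
  obtain ⟨z, -, hz⟩ := exists_mk_rep_eq h
  refine (mem_projImage_scroll_iff _).2 ⟨s, z • c, ?_, hz⟩
  rintro rfl
  apply h
  have h0 : ∀ co : Fin (v + 1) → ℂ, hev v co (0 : Fin 2 → ℂ) = 0 := by
    intro co
    have := hev_smul co 0 (0 : Fin 2 → ℂ)
    rwa [zero_smul, zero_pow (by omega), zero_mul] at this
  ext i
  fin_cases i <;> simp [xi, h0]

/-- The projection of the scroll to `ℙ⁵` is birational. -/
lemma scrollProj_birational (hv : 1 ≤ v)
    (hf : ∀ b : Fin 2 → ℂ, b ≠ 0 → ∃ i, hev v (f i) b ≠ 0)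
    (him : ∀ a : Fin 2 → ℂ, a ≠ 0 → ∃ k : Fin 4 → ℂ, ∃ u ∈ binaryForms (v - 1),
      (∀ s, ∑ i, k i * hev v (f i) s = wd s a * u s) ∧ u a ≠ 0) :
    ∃ (d : ℕ) (G : Fin (1 + 1) ⊕ Fin (v + 1) → MvPolynomial (Fin (5 + 1)) ℂ),
    (∀ i, (G i).IsHomogeneous d) ∧
    (∀ p ∈ rationalNormalScroll 1 v, ∃ k : ℂ,
      (fun i => MvPolynomial.eval (scrollProj e f p.rep) (G i)) = k • p.rep) ∧
    (∃ p ∈ rationalNormalScroll 1 v, ∃ i, MvPolynomial.eval (scrollProj e f p.rep) (G i) ≠ 0) := by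
  let σ : ℙ ℂ (Fin 2 → ℂ) := Projectivization.mk ℂ ![1, 0] (cons_one_ne_zero 0)
  have hσ := σ.rep_nonzero
  have hg : (![1, 0] : Fin 2 → ℂ) ≠ 0 := cons_one_ne_zero 0
  -- The chosen point lies on the directrix, where no two rulings meet.
  obtain ⟨n, P, hPn, hP, i₁, hi₁⟩ := exists_inverse_forms (e := e) (f := f) hv hσ hg hf (him _ hσ)
    (fun b c hb h => by
      by_contra hba
      exact snd_ne_zero_of_xi_eq hf hg (fun h0 => hba (by rw [wd_swap, h0, neg_zero])) h.symm
        (by simp))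
  obtain ⟨i₀, hi₀⟩ := hf _ hσ
  have hk : ∀ s c : Fin 2 → ℂ, s ≠ 0 → ∃ k : ℂ, ∀ i,
      MvPolynomial.eval (xi e f s c) (P i) = k * s i := by
    intro s c hs
    obtain ⟨k, hk⟩ := exists_smul_of_wd_eq_zero (b := fun i => MvPolynomial.eval (xi e f s c) (P i))
      hs (by unfold wd; rw [hP]; ring)
    exact ⟨k, fun i => congrFun hk i⟩
  have hev_eval : ∀ (co : Fin (v + 1) → ℂ) (x : Fin (5 + 1) → ℂ), MvPolynomial.eval x (hev v co P) =
      hev v co fun i => MvPolynomial.eval x (P i) :=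
    fun co x => map_hev (MvPolynomial.aeval x : MvPolynomial (Fin (5 + 1)) ℂ →ₐ[ℂ] ℂ) v co P
  let X' : Fin (1 + 1) → MvPolynomial (Fin (5 + 1)) ℂ := ![MvPolynomial.X 0, MvPolynomial.X 1]
  have hX' : ∀ i, (X' i).IsHomogeneous 1 := by
    intro i
    fin_cases i
    exacts [MvPolynomial.isHomogeneous_X _ _, MvPolynomial.isHomogeneous_X _ _]
  -- With P = k s, subtracting the e-part isolates c₀s, and every component acquires the common
  -- factor kᵛ f_{i₀}(s).
  let G : Fin (1 + 1) ⊕ Fin (v + 1) → MvPolynomial (Fin (5 + 1)) ℂ := Sum.elim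
    (fun i => hev v (f i₀) P * X' i - MvPolynomial.X (Fin.natAdd 2 i₀) * hev v (e i) P)
    (fun j => MvPolynomial.X (Fin.natAdd 2 i₀) * (P 0 ^ (v - (j : ℕ)) * P 1 ^ (j : ℕ)))
  have hG : ∀ s c : Fin 2 → ℂ, ∀ k : ℂ, (∀ i, MvPolynomial.eval (xi e f s c) (P i) = k * s i) →
      (fun i => MvPolynomial.eval (xi e f s c) (G i)) =
        (k ^ v * hev v (f i₀) s) • scrollVec 1 v s c := by
    intro s c k hk
    ext i
    rcases i with i | j
    · simp only [G, Sum.elim_inl, map_sub, map_mul, MvPolynomial.eval_X, hev_eval, hk, hev_mul,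
        xi_natAdd, Pi.smul_apply, scrollVec, smul_eq_mul]
      fin_cases i
      · simp [X', xi_zero]; ring
      · simp [X', xi_one]; ring
    · have hj : k ^ v = k ^ (v - (j : ℕ)) * k ^ (j : ℕ) := by rw [← pow_add]; congr 1; omega
      simp only [G, Sum.elim_inr, map_pow, map_mul, MvPolynomial.eval_X, hk, 
        xi_natAdd, Pi.smul_apply, scrollVec, smul_eq_mul]
      rw [hj]
      ring
  refine ⟨n * v + 1, G, ?_, ?_, ?_⟩
  · rintro (i | j)
    · refine ((isHomogeneous_hev hPn _).mul (hX' i)).sub ?_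
      rw [add_comm (n * v) 1]
      exact (MvPolynomial.isHomogeneous_X _ _).mul (isHomogeneous_hev hPn _)
    · have := (MvPolynomial.isHomogeneous_X ℂ (Fin.natAdd 2 i₀ : Fin (5 + 1))).mul
        (((hPn 0).pow (v - (j : ℕ))).mul ((hPn 1).pow (j : ℕ)))
      have h1 : 1 + (n * (v - (j : ℕ)) + n * (j : ℕ)) = n * v + 1 := by
        rw [← mul_add, add_comm, show v - (j : ℕ) + j = v by omega]
      rwa [h1] at this
  · intro p hp
    obtain ⟨τ, hτ⟩ := Set.mem_iUnion.1 hp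
    obtain ⟨c, -, hc⟩ := exists_rep_of_mem_ruling hτ
    obtain ⟨k, hk⟩ := hk τ.rep c τ.rep_nonzero
    refine ⟨k ^ v * hev v (f i₀) τ.rep, ?_⟩
    rw [hc, scrollProj_scrollVec]
    exact hG _ _ _ hk
  · have hne : scrollVec 1 v σ.rep ![1, 0] ≠ 0 := by
      intro h
      apply xi_ne_zero (e := e) hσ hg ⟨i₀, hi₀⟩
      rw [← scrollProj_scrollVec, h, map_zero]
    refine ⟨Projectivization.mk ℂ _ hne, Set.mem_iUnion.2 ⟨σ, ![1, 0], hne, rfl⟩, ?_⟩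
    obtain ⟨w, hw⟩ := Projectivization.exists_smul_eq_mk_rep ℂ _ hne
    have hr : (Projectivization.mk ℂ _ hne).rep = scrollVec 1 v σ.rep ((w : ℂ) • ![1, 0]) := by
      rw [scrollVec_smul, ← hw]; rfl
    obtain ⟨k, hk⟩ := hk σ.rep ((w : ℂ) • ![1, 0]) hσ
    have hk0 : k ≠ 0 := by
      rintro rfl
      have h1 := hk i₁
      rw [xi_smul, eval_smul_of_isHomogeneous (hPn _), zero_mul] at h1
      exact hi₁ ((mul_eq_zero.1 h1).resolve_left (pow_ne_zero _ w.ne_zero))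
    have h2 : (fun i => MvPolynomial.eval
        (scrollProj e f (Projectivization.mk ℂ _ hne).rep) (G i)) ≠ 0 := by
      rw [hr, scrollProj_scrollVec, hG _ _ _ hk, ← hr]
      exact smul_ne_zero (mul_ne_zero (pow_ne_zero _ hk0) hi₀) (Projectivization.rep_nonzero _)
    exact Function.ne_iff.1 h2

end

/-! ### Finiteness and counting of the singular points -/

section
variable {v : ℕ} {e : Fin 2 → Fin (v + 1) → ℂ} {f : Fin 4 → Fin (v + 1) → ℂ}

/-- As soon as `R` has two elements, each of them has a partner and is therefore represented by an
element of `D`. -/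
lemma finite_rulings_of_finset {D : Finset (Fin 2 → ℂ)} (hD : ∀ z ∈ D, z ≠ 0)
    {R : Set (ℙ ℂ (Fin 2 → ℂ))}
    (hR : ∀ σ ∈ R, ∀ τ ∈ R, σ ≠ τ → ∃ z ∈ D, ∃ m : ℂ, σ.rep = m • z) : R.Finite := by
  by_cases h : R.Subsingleton
  · exact h.finite
  · rw [Set.not_subsingleton_iff] at h
    refine Set.Finite.subset (D.finite_toSet.biUnion (t := fun z => {σ : ℙ ℂ (Fin 2 → ℂ) |
      ∃ m : ℂ, σ.rep = m • z}) fun z hz => Set.Subsingleton.finite ?_) ?_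
    · have : ∀ σ : ℙ ℂ (Fin 2 → ℂ), (∃ m : ℂ, σ.rep = m • z) →
          σ = Projectivization.mk ℂ z (hD z hz) := by
        rintro σ ⟨m, hm⟩
        exact σ.mk_rep.symm.trans ((Projectivization.mk_eq_mk_iff' ℂ _ _ _ _).2 ⟨m, hm.symm⟩)
      intro σ hσ τ hτ
      rw [this σ hσ, this τ hτ]
    · intro σ hσ
      obtain ⟨τ, hτ, hne⟩ := h.exists_ne σ
      obtain ⟨z, hz, hm⟩ := hR σ hσ τ hτ hne.symm
      exact Set.mem_biUnion hz hm

lemma wd_rep_ne_zero {σ τ : ℙ ℂ (Fin 2 → ℂ)} (h : σ ≠ τ) : wd σ.rep τ.rep ≠ 0 := by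
  intro h0
  obtain ⟨k, hk⟩ := exists_smul_of_wd_eq_zero τ.rep_nonzero h0
  apply h
  rw [← σ.mk_rep, ← τ.mk_rep]
  exact (Projectivization.mk_eq_mk_iff' ℂ _ _ _ _).2 ⟨k, hk.symm⟩

lemma exists_mul_of_xi_eq (hf : ∀ b : Fin 2 → ℂ, b ≠ 0 → ∃ i, hev v (f i) b ≠ 0)
    {a b c d : Fin 2 → ℂ} (hd : d ≠ 0) (hab : wd a b ≠ 0) (h : xi e f a c = xi e f b d) :
    ∃ k : ℂ, ∀ i, hev v (f i) b = k * hev v (f i) a := by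
  have hd1 : d 1 ≠ 0 := snd_ne_zero_of_xi_eq hf hd
    (fun h0 => hab (by rw [wd_swap, h0, neg_zero])) h.symm
  refine ⟨c 1 / d 1, fun i => ?_⟩
  have := congrFun h (Fin.natAdd 2 i)
  rw [xi_natAdd, xi_natAdd] at this
  field_simp
  linear_combination -this

/-- Two given rulings meet in at most one point. -/
lemma subsingleton_inter (hf : ∀ b : Fin 2 → ℂ, b ≠ 0 → ∃ i, hev v (f i) b ≠ 0)
    {a b : Fin 2 → ℂ} (hab : wd a b ≠ 0) : {q : ℙ ℂ (Fin (5 + 1) → ℂ) |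
      ∃ c d, q.rep = xi e f a c ∧ q.rep = xi e f b d}.Subsingleton := by
  rintro q ⟨c, d, hc, hd⟩ q' ⟨c', d', hc', hd'⟩
  have h1 : c 1 ≠ 0 := snd_ne_zero_of_xi_eq hf (ne_zero_of_rep_eq hc) hab (hc.symm.trans hd)
  have h2 : c' 1 ≠ 0 := snd_ne_zero_of_xi_eq hf (ne_zero_of_rep_eq hc') hab (hc'.symm.trans hd')
  -- This combination has second coordinate zero. Were it nonzero, the rulings would meet on the
  -- directrix.
  have h3 : c' 1 • c - c 1 • c' = 0 := by
    by_contra h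
    refine snd_ne_zero_of_xi_eq (e := e) (b := b) (d := c' 1 • d - c 1 • d') hf h hab ?_ ?_
    · rw [xi_sub, xi_sub, xi_smul, xi_smul, xi_smul, xi_smul, ← hc, ← hc', ← hd, ← hd']
    · simp; ring
  have h4 : c' 1 • q.rep = c 1 • q'.rep := by
    rw [← sub_eq_zero, hc, hc', ← xi_smul, ← xi_smul, ← xi_sub, h3]
    ext i
    fin_cases i <;> simp [xi]
  rw [← q.mk_rep, ← q'.mk_rep]
  refine (Projectivization.mk_eq_mk_iff' ℂ _ _ _ _).2 ⟨c 1 / c' 1, ?_⟩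
  rw [div_eq_inv_mul, mul_smul, ← h4, smul_smul, inv_mul_cancel₀ h2, one_smul]

/-- Singular points of the scroll lie on two rulings. -/
lemma exists_two_rulings (hv : 1 ≤ v)
    (hf : ∀ b : Fin 2 → ℂ, b ≠ 0 → ∃ i, hev v (f i) b ≠ 0)
    (him : ∀ a : Fin 2 → ℂ, a ≠ 0 → ∃ k : Fin 4 → ℂ, ∃ u ∈ binaryForms (v - 1),
      (∀ s, ∑ i, k i * hev v (f i) s = wd s a * u s) ∧ u a ≠ 0) {q : ℙ ℂ (Fin (5 + 1) → ℂ)}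
    (hq : q ∈ surfaceSingularLocus (projImage (scrollProj e f) (rationalNormalScroll 1 v))) :
    ∃ a b c d : Fin 2 → ℂ, wd a b ≠ 0 ∧ q.rep = xi e f a c ∧ q.rep = xi e f b d := by
  obtain ⟨hqS, hq3⟩ := hq
  obtain ⟨s, c, hs, hqr⟩ := (mem_projImage_scroll_iff q).1 hqS
  by_contra hcon
  obtain ⟨n, P, hPn, hP, hPs⟩ := exists_inverse_forms (e := e) (f := f) hv hs
    (ne_zero_of_rep_eq hqr) hf (him s hs) (fun b d hb h => by
      by_contra hbs
      exact hcon ⟨b, s, d, c, hbs, hqr.trans h.symm, hqr⟩)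
  have := finrank_coneTangentSpace_le (S := projImage (scrollProj e f) (rationalNormalScroll 1 v))
    (fun q hq => (mem_projImage_scroll_iff q).1 hq) hf hPn hP hs hPs
  rw [← hqr] at this
  omega

/-- Both f(a) and f(b) are the i-th coordinate point, so the two rulings are coplanar. After
normalising yᵢ = 1 the intersection is a linear system with determinant `wd a b` up to sign. -/
lemma exists_intersection_point (hv : 1 ≤ v)
    (hf : ∀ b : Fin 2 → ℂ, b ≠ 0 → ∃ i, hev v (f i) b ≠ 0)
    (him : ∀ a : Fin 2 → ℂ, a ≠ 0 → ∃ k : Fin 4 → ℂ, ∃ u ∈ binaryForms (v - 1),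
      (∀ s, ∑ i, k i * hev v (f i) s = wd s a * u s) ∧ u a ≠ 0)
    {i : Fin 4} {a b : Fin 2 → ℂ} (hab : wd a b ≠ 0)
    (ha : ∀ j ≠ i, hev v (f j) a = 0) (hb : ∀ j ≠ i, hev v (f j) b = 0) :
    ∃ q ∈ surfaceSingularLocus (projImage (scrollProj e f) (rationalNormalScroll 1 v)),
      (∃ c, q.rep = xi e f a c) ∧ (∃ d, q.rep = xi e f b d) ∧ q.rep (Fin.natAdd 2 i) ≠ 0 ∧
      ∀ j ≠ i, q.rep (Fin.natAdd 2 j) = 0 := by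
  have ha0 : a ≠ 0 := by rintro rfl; simp [wd] at hab
  have hb0 : b ≠ 0 := by rintro rfl; simp [wd] at hab
  have hi : ∀ s : Fin 2 → ℂ, s ≠ 0 → (∀ j ≠ i, hev v (f j) s = 0) → hev v (f i) s ≠ 0 := by
    intro s hs h
    obtain ⟨j, hj⟩ := hf s hs
    obtain rfl : j = i := by
      by_contra hji
      exact hj (h j hji)
    exact hj
  have hai := hi a ha0 ha
  have hbi := hi b hb0 hb
  -- Cramer's rule for c₀a - d₀b = w.
  let w : Fin 2 → ℂ := fun j => (hev v (f i) b)⁻¹ * hev v (e j) b - (hev v (f i) a)⁻¹ * hev v (e j) a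
  let c : Fin 2 → ℂ := ![wd w b / wd a b, (hev v (f i) a)⁻¹]
  let d : Fin 2 → ℂ := ![wd w a / wd a b, (hev v (f i) b)⁻¹]
  have hcd : xi e f a c = xi e f b d := by
    rw [xi_eq_iff]
    have hw : ∀ j, wd w b * a j - wd w a * b j = wd a b * w j := by
      intro j
      fin_cases j <;> simp [wd] <;> ring
    refine ⟨?_, ?_, fun j => ?_⟩
    · have := hw 0
      simp only [xi_zero, c, d, Matrix.cons_val_zero, Matrix.cons_val_one]
      have h2 : wd w b / wd a b * a 0 = w 0 + wd w a / wd a b * b 0 := by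
        field_simp; linear_combination this
      rw [h2]; simp only [w]; ring
    · have := hw 1
      simp only [xi_one, c, d, Matrix.cons_val_zero, Matrix.cons_val_one]
      have h2 : wd w b / wd a b * a 1 = w 1 + wd w a / wd a b * b 1 := by
        field_simp; linear_combination this
      rw [h2]; simp only [w]; ring
    · simp only [xi_natAdd, c, d, Matrix.cons_val_one, Matrix.cons_val_zero]
      by_cases hj : j = i
      · subst hj; rw [inv_mul_cancel₀ hai, inv_mul_cancel₀ hbi]
      · rw [ha j hj, hb j hj, mul_zero, mul_zero]
  have hc : c ≠ 0 := fun h => inv_ne_zero hai (congrFun h 1)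
  have hne := xi_ne_zero (e := e) ha0 hc (hf a ha0)
  obtain ⟨z, hz, hr⟩ := exists_mk_rep_eq hne
  refine ⟨Projectivization.mk ℂ _ hne, ⟨mk_xi_mem hv a c hne, ?_⟩, ⟨_, hr⟩, ⟨z • d, ?_⟩, ?_, ?_⟩
  · rw [hr]
    refine three_lt_finrank_coneTangentSpace (b := b) (d := z • d) (mk_xi_mem hv) hf him
      (smul_ne_zero hz hc) hab ?_
    rw [xi_smul, xi_smul, hcd]
  · rw [hr, xi_smul, xi_smul, hcd]
  · rw [hr, xi_natAdd]
    exact mul_ne_zero (mul_ne_zero hz (inv_ne_zero hai)) hai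
  · intro j hj
    rw [hr, xi_natAdd, ha j hj, mul_zero]

/-- A scroll with many isolated singularities over a space curve with multiple points at the
coordinate points. -/
theorem exists_scroll_of_curve (hv : 2 ≤ v)
    (hf : ∀ b : Fin 2 → ℂ, b ≠ 0 → ∃ i, hev v (f i) b ≠ 0)
    (him : ∀ a : Fin 2 → ℂ, a ≠ 0 → ∃ k : Fin 4 → ℂ, ∃ u ∈ binaryForms (v - 1),
      (∀ s, ∑ i, k i * hev v (f i) s = wd s a * u s) ∧ u a ≠ 0)
    {t₀ : ℂ} (ht₀ : ∀ (b : Fin 2 → ℂ) (k : ℂ), b ≠ 0 →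
      (∀ i, k * hev v (f i) b = hev v (f i) ![1, t₀]) → wd b ![1, t₀] = 0)
    {A : Fin 4 → Finset ℂ} (hA : ∀ i, (A i).Nonempty)
    (hfA : ∀ i j, j ≠ i → ∀ t ∈ A i, hev v (f j) ![1, t] = 0)
    {r : ℕ} (hr : r ≤ ∑ i, (A i).card.choose 2) :
    ∃ (L : (Fin (1 + 1) ⊕ Fin (v + 1) → ℂ) →ₗ[ℂ] (Fin (5 + 1) → ℂ))
      (S : Set (ℙ ℂ (Fin (5 + 1) → ℂ))),
      IsRationalScroll 1 v L S ∧ (surfaceSingularLocus S).Finite ∧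
      r ≤ (surfaceSingularLocus S).ncard ∧ r ≤ singularityCount 1 v L S := by
  classical
  have hv1 : 1 ≤ v := by omega
  obtain ⟨e, he⟩ := exists_no_three_concurrent hv hf hfA
  obtain ⟨D, hD0, hD⟩ := exists_finset_of_double_points hv1 hf him ht₀
  let S := projImage (scrollProj e f) (rationalNormalScroll 1 v)
  have hfin : (surfaceSingularLocus S).Finite := by
    -- A singular point lies on two rulings, both over points of `D`, and two rulings meet at most
    -- once.
    refine Set.Finite.subset (s := ⋃ z ∈ D, ⋃ z' ∈ D, {q : ℙ ℂ (Fin (5 + 1) → ℂ) |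
      wd z z' ≠ 0 ∧ ∃ c d, q.rep = xi e f z c ∧ q.rep = xi e f z' d}) ?_ ?_
    · refine D.finite_toSet.biUnion fun z _ => D.finite_toSet.biUnion fun z' _ => ?_
      by_cases hz : wd z z' = 0
      · simp [hz]
      · refine Set.Subsingleton.finite fun q hq q' hq' => subsingleton_inter hf hz hq.2 hq'.2
    · intro q hq
      obtain ⟨a, b, c, d, hab, hc, hd⟩ := exists_two_rulings hv1 hf him hq
      have ha0 : a ≠ 0 := by rintro rfl; simp [wd] at hab
      have hb0 : b ≠ 0 := by rintro rfl; simp [wd] at hab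
      have hba : wd b a ≠ 0 := fun h0 => hab (by rw [wd_swap, h0, neg_zero])
      obtain ⟨k, hk⟩ := exists_mul_of_xi_eq hf (ne_zero_of_rep_eq hd) hab (hc.symm.trans hd)
      obtain ⟨k', hk'⟩ := exists_mul_of_xi_eq hf (ne_zero_of_rep_eq hc) hba (hd.symm.trans hc)
      obtain ⟨z, hz, m, rfl⟩ := hD a b k ha0 hb0 hab hk
      obtain ⟨z', hz', m', rfl⟩ := hD b _ k' hb0 ha0 hba hk'
      have hm : m ≠ 0 := by rintro rfl; simp at ha0
      have hm' : m' ≠ 0 := by rintro rfl; simp at hb0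
      obtain ⟨c', hc'⟩ := exists_torus (e := e) (f := f) (s := z) (inv_ne_zero hm)
        (by rw [smul_smul, inv_mul_cancel₀ hm, one_smul]) c
      obtain ⟨d', hd'⟩ := exists_torus (e := e) (f := f) (s := z') (inv_ne_zero hm')
        (by rw [smul_smul, inv_mul_cancel₀ hm', one_smul]) d
      simp only [Set.mem_iUnion]
      refine ⟨z, hz, z', hz', ?_, c', d', hc.trans hc'.symm, hd.trans hd'.symm⟩
      intro h0
      rw [wd_smul_left, wd_smul_right, h0] at hab
      simp at hab
  -- the intersection points over the coordinate points
  have hpt : ∀ x : (i : Fin 4) × Finset ℂ, x.2 ∈ (A x.1).powersetCard 2 →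
      ∃ q ∈ surfaceSingularLocus S, (∀ t ∈ x.2, ∃ c, q.rep = xi e f ![1, t] c) ∧
        q.rep (Fin.natAdd 2 x.1) ≠ 0 ∧ ∀ j ≠ x.1, q.rep (Fin.natAdd 2 j) = 0 := by
    rintro ⟨i, u⟩ hu
    rw [Finset.mem_powersetCard] at hu
    obtain ⟨t, t', htt, rfl⟩ := Finset.card_eq_two.1 hu.2
    obtain ⟨q, hq, hc, hd, h1, h2⟩ := exists_intersection_point (e := e) (i := i) hv1 hf him
      (a := ![1, t]) (b := ![1, t']) (by rw [wd_cons_one]; exact sub_ne_zero.2 htt.symm)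
      (fun j hj => hfA i j hj t (hu.1 (by simp))) (fun j hj => hfA i j hj t' (hu.1 (by simp)))
    refine ⟨q, hq, ?_, h1, h2⟩
    intro s hs
    simp only [Finset.mem_insert, Finset.mem_singleton] at hs
    rcases hs with rfl | rfl
    exacts [hc, hd]
  choose! pt hpt1 hpt2 hpt3 hpt4 using hpt
  let I : Finset ((i : Fin 4) × Finset ℂ) :=
    Finset.univ.sigma fun i => (A i).powersetCard 2
  have hI : ∀ x ∈ I, x.2 ∈ (A x.1).powersetCard 2 := fun x hx => (Finset.mem_sigma.1 hx).2
  have hinj : Set.InjOn pt I := by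
    rintro ⟨i, u⟩ hx ⟨i', u'⟩ hx' hxx
    have hu := hI _ hx
    have hu' := hI _ hx'
    obtain rfl : i = i' := by
      by_contra hii
      have h1 := hpt4 ⟨i', u'⟩ hu' i hii
      rw [← hxx] at h1
      exact hpt3 ⟨i, u⟩ hu h1
    have h1 := Finset.mem_powersetCard.1 hu
    have h2 := Finset.mem_powersetCard.1 hu'
    -- Two different pairs in `A i` with the same intersection point would give three concurrent
    -- rulings.
    by_contra hne
    have hsub : ¬ u' ⊆ u := fun hs => hne (by
      rw [Finset.eq_of_subset_of_card_le hs (by rw [h1.2, h2.2])])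
    obtain ⟨t₃, ht₃, ht₃'⟩ := Finset.not_subset.1 hsub
    obtain ⟨t, t', htt, rfl⟩ := Finset.card_eq_two.1 h1.2
    obtain ⟨c₁, hc₁⟩ := hpt2 _ hu t (by simp)
    obtain ⟨c₂, hc₂⟩ := hpt2 _ hu t' (by simp)
    obtain ⟨c₃, hc₃⟩ := hpt2 _ hu' t₃ ht₃
    rw [← hxx] at hc₃
    simp only [Finset.mem_insert, Finset.mem_singleton, not_or] at ht₃'
    exact ne_zero_of_rep_eq hc₁ (he i t (h1.1 (by simp)) t' (h1.1 (by simp)) t₃ (h2.1 ht₃) htt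
      (Ne.symm ht₃'.1) (Ne.symm ht₃'.2) c₁ c₂ c₃ (hc₁.symm.trans hc₂) (hc₁.symm.trans hc₃))
  have hsub : ((I.image pt : Finset _) : Set (ℙ ℂ (Fin (5 + 1) → ℂ))) ⊆ surfaceSingularLocus S := by
    intro q hq
    rw [Finset.mem_coe, Finset.mem_image] at hq
    obtain ⟨x, hx, rfl⟩ := hq
    exact hpt1 x (hI x hx)
  have hcard : r ≤ (I.image pt).card := by
    rw [Finset.card_image_of_injOn hinj, Finset.card_sigma]
    simpa [Finset.card_powersetCard] using hr
  refine ⟨scrollProj e f, S, ⟨le_rfl, hv1, scrollProj_surjective hf hA hfA, ?_,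
    scrollProj_birational hv1 hf him, rfl⟩, hfin, ?_, ?_⟩
  · intro p hp
    obtain ⟨σ, hσ⟩ := Set.mem_iUnion.1 hp
    obtain ⟨c, hc0, hc⟩ := exists_rep_of_mem_ruling hσ
    rw [hc, scrollProj_scrollVec]
    exact xi_ne_zero σ.rep_nonzero hc0 (hf _ σ.rep_nonzero)
  · have := Set.ncard_le_ncard hsub hfin
    rw [Set.ncard_coe_finset] at this
    omega
  · rw [singularityCount, finsum_mem_eq_finite_toFinset_sum _ hfin]
    have h1 : I.image pt ⊆ hfin.toFinset := by
      intro q hq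
      rw [Set.Finite.mem_toFinset]
      exact hsub hq
    refine le_trans ?_ (Finset.sum_le_sum_of_subset h1)
    refine hcard.trans ?_
    rw [Finset.card_eq_sum_ones]
    refine Finset.sum_le_sum fun q hq => ?_
    rw [Finset.mem_image] at hq
    obtain ⟨⟨i, u⟩, hx, rfl⟩ := hq
    have hu := hI _ hx
    have h2 := Finset.mem_powersetCard.1 hu
    obtain ⟨t, t', htt, rfl⟩ := Finset.card_eq_two.1 h2.2
    obtain ⟨c₁, hc₁⟩ := hpt2 _ hu t (by simp)
    obtain ⟨c₂, hc₂⟩ := hpt2 _ hu t' (by simp)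
    -- Finiteness matters because `ncard` of an infinite set is 0; with it, each constructed point
    -- has weight at least 1.
    have hRfin : {s : ℙ ℂ (Fin 2 → ℂ) | pt ⟨i, {t, t'}⟩ ∈
        projImage (scrollProj e f) (ruling 1 v s)}.Finite := by
      refine finite_rulings_of_finset hD0 fun σ hσ τ hτ hne => ?_
      have hw := wd_rep_ne_zero hne
      rw [Set.mem_ofPred_eq, ← σ.mk_rep, mem_projImage_ruling_iff σ.rep_nonzero] at hσ
      rw [Set.mem_ofPred_eq, ← τ.mk_rep, mem_projImage_ruling_iff τ.rep_nonzero] at hτ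
      obtain ⟨c, hc⟩ := hσ
      obtain ⟨d, hd⟩ := hτ
      obtain ⟨k, hk⟩ := exists_mul_of_xi_eq hf (ne_zero_of_rep_eq hd) hw (hc.symm.trans hd)
      exact hD _ _ k σ.rep_nonzero τ.rep_nonzero hw hk
    have h3 : 1 < rulingsThrough 1 v (scrollProj e f) (pt ⟨i, {t, t'}⟩) := by
      rw [rulingsThrough, Set.one_lt_ncard hRfin]
      refine ⟨_, (mem_projImage_ruling_iff (cons_one_ne_zero t) _).2 ⟨c₁, hc₁⟩,
        _, (mem_projImage_ruling_iff (cons_one_ne_zero t') _).2 ⟨c₂, hc₂⟩, fun h => ?_⟩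
      obtain ⟨k, hk⟩ := (Projectivization.mk_eq_mk_iff' ℂ _ _ _ _).1 h
      have e0 := congrFun hk 0
      have e1 := congrFun hk 1
      simp at e0 e1
      rw [e0, one_mul] at e1
      exact htt e1.symm
    exact Nat.choose_pos h3

end

/-! ### Space curves with prescribed multiple points -/

/-- The binary form `F` of degree `n` has a simple zero at `a`. -/
def HasSimpleZero (n : ℕ) (F : (Fin 2 → ℂ) → ℂ) (a : Fin 2 → ℂ) : Prop :=
  ∃ u ∈ binaryForms (n - 1), (∀ s, F s = wd s a * u s) ∧ u a ≠ 0

lemma HasSimpleZero.mul {m n d : ℕ} {F G : (Fin 2 → ℂ) → ℂ} {a : Fin 2 → ℂ}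
    (hF : HasSimpleZero m F a) (hG : G ∈ binaryForms n) (ha : G a ≠ 0) (hm : 1 ≤ m)
    (hd : m + n = d) : HasSimpleZero d (fun s => F s * G s) a := by
  obtain ⟨u, hu, h1, h2⟩ := hF
  exact ⟨fun s => u s * G s, mul_mem_binaryForms_of_eq (by omega) hu hG,
    fun s => by simp only [h1]; ring, mul_ne_zero h2 ha⟩

lemma HasSimpleZero.smul {n : ℕ} {F : (Fin 2 → ℂ) → ℂ} {a : Fin 2 → ℂ}
    (hF : HasSimpleZero n F a) {k : ℂ} (hk : k ≠ 0) : HasSimpleZero n F (k • a) := by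
  obtain ⟨u, hu, h1, h2⟩ := hF
  refine ⟨fun s => k⁻¹ * u s, const_mul_mem_binaryForms _ hu, fun s => ?_, ?_⟩
  · rw [wd_smul_right, h1]; field_simp
  · simp only [binaryForms_smul hu]
    exact mul_ne_zero (inv_ne_zero hk) (mul_ne_zero (pow_ne_zero _ hk) h2)

/-- Differentiate P(t)Q(τ) - Q(t)P(τ) = (τ - t)R(t) at t = τ. -/
lemma eval_wronskian {n : ℕ} {F G u : (Fin 2 → ℂ) → ℂ} {P Q : Polynomial ℂ}
    (hP : ∀ t, F ![1, t] = P.eval t) (hQ : ∀ t, G ![1, t] = Q.eval t) (hu : u ∈ binaryForms n)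
    {τ : ℂ} (h : ∀ s, F s * G ![1, τ] - G s * F ![1, τ] = wd s ![1, τ] * u s) :
    (P.derivative * Q - Q.derivative * P).eval τ = -u ![1, τ] := by
  obtain ⟨R, -, hR, -⟩ := exists_polynomial_of_mem_binaryForms hu
  have h1 : P * Polynomial.C (Q.eval τ) - Q * Polynomial.C (P.eval τ) =
      (Polynomial.C τ - Polynomial.X) * R := by
    refine Polynomial.funext fun t => ?_
    have := h ![1, t]
    rw [wd_cons_one, hP, hQ, hP, hQ, hR] at this
    simpa using this
  have h2 := congrArg (fun p => (Polynomial.derivative p).eval τ) h1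
  simp only [Polynomial.derivative_sub, Polynomial.derivative_mul, Polynomial.derivative_C,
    Polynomial.derivative_X, Polynomial.eval_sub, Polynomial.eval_add, Polynomial.eval_mul,
    Polynomial.eval_C, Polynomial.eval_X, Polynomial.eval_zero, Polynomial.eval_one] at h2
  rw [hR]
  simp only [Polynomial.eval_sub, Polynomial.eval_mul]
  linear_combination h2

/-- The map to the projective line given by two forms of the same degree has finitely many
ramification points, provided that it is unramified somewhere. -/
lemma exists_ramification_finset {n : ℕ} {F G : (Fin 2 → ℂ) → ℂ} (hF : F ∈ binaryForms n)
    (hG : G ∈ binaryForms n) (hn : 1 ≤ n) {τ₀ : ℂ} (h0 : HasSimpleZero n G ![1, τ₀])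
    (hF0 : F ![1, τ₀] ≠ 0) :
    ∃ E : Finset ℂ, ∀ τ ∉ E,
      HasSimpleZero n (fun s => F s * G ![1, τ] - G s * F ![1, τ]) ![1, τ] := by
  obtain ⟨m, rfl⟩ : ∃ m, n = m + 1 := ⟨n - 1, by omega⟩
  obtain ⟨P, -, hP, -⟩ := exists_polynomial_of_mem_binaryForms hF
  obtain ⟨Q, -, hQ, -⟩ := exists_polynomial_of_mem_binaryForms hG
  -- The Wronskian is nonzero at τ₀, where `G` has a simple zero and `F` does not vanish.
  have hW : P.derivative * Q - Q.derivative * P ≠ 0 := by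
    obtain ⟨w, hw, h1, h2⟩ := h0
    intro h
    have h3 := eval_wronskian hP hQ (const_mul_mem_binaryForms (-F ![1, τ₀]) hw) (τ := τ₀)
      fun s => by rw [h1, h1, wd_self]; ring
    rw [h, Polynomial.eval_zero] at h3
    exact mul_ne_zero hF0 h2 (by linear_combination -h3)
  refine ⟨(P.derivative * Q - Q.derivative * P).roots.toFinset, fun τ hτ => ?_⟩
  obtain ⟨u, hu, h1⟩ := exists_eq_wd_mul (cons_one_ne_zero τ)
    (sub_mem_binaryForms (const_mul_mem_binaryForms (G ![1, τ]) hF)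
      (const_mul_mem_binaryForms (F ![1, τ]) hG)) (by ring)
  have h2 : ∀ s, F s * G ![1, τ] - G s * F ![1, τ] = wd s ![1, τ] * u s := fun s => by
    rw [← h1]; ring
  refine ⟨u, hu, h2, fun h3 => hτ ?_⟩
  rw [Multiset.mem_toFinset, Polynomial.mem_roots hW, Polynomial.IsRoot,
    eval_wronskian hP hQ hu h2, h3, neg_zero]

lemma eventually_add_mul_ne_zero {x y : ℂ} (h : ¬(x = 0 ∧ y = 0)) :
    ∀ᶠ β in Filter.cofinite, x + β * y ≠ 0 := by
  by_cases hy : y = 0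
  · exact Filter.Eventually.of_forall fun β => by simpa [hy] using h
  · filter_upwards [(Set.finite_singleton (-x / y)).compl_mem_cofinite] with β hβ h1
    exact hβ (by rw [Set.mem_singleton_iff]; field_simp; linear_combination h1)

lemma wd_cons_one_right (s : Fin 2 → ℂ) (β : ℂ) :
    wd s ![1, β] = wd s ![1, 0] + β * wd s ![0, 1] := by
  simp [wd]; ring

/-- Replace `![1, β]` by a vector b: the form is linear in b, and so is its quotient by `wd s a`.
For b = a the form is -γ(a)δ(s) wd(s, a), with a simple zero at `a`, so the value of the quotient at
`a` is not identically zero in b. -/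
lemma eventually_hasSimpleZero {n : ℕ} {γ δ : (Fin 2 → ℂ) → ℂ} (hγ : γ ∈ binaryForms (n + 1))
    (hδ : δ ∈ binaryForms n) {a : Fin 2 → ℂ} (ha : a ≠ 0) (hγa : γ a ≠ 0) (hδa : δ a ≠ 0) :
    ∀ᶠ β in Filter.cofinite, HasSimpleZero (n + 1)
      (fun s => γ s * (δ a * wd a ![1, β]) - δ s * wd s ![1, β] * γ a) a := by
  have h1 : ∀ b, ∃ u ∈ binaryForms n, ∀ s,
      γ s * (δ a * wd a b) - δ s * wd s b * γ a = wd s a * u s := fun b => by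
    obtain ⟨u, hu, h⟩ := exists_eq_wd_mul ha
      (sub_mem_binaryForms (const_mul_mem_binaryForms (δ a * wd a b) hγ)
        (const_mul_mem_binaryForms (γ a) (mul_mem_binaryForms hδ (wd_mem_binaryForms b)))) (by ring)
    exact ⟨u, hu, fun s => by rw [← h]; ring⟩
  obtain ⟨u₀, hu₀, h₀⟩ := h1 ![1, 0]
  obtain ⟨u₁, hu₁, h₂⟩ := h1 ![0, 1]
  have h3 := eq_zero_of_wd_mul_eq_zero
    (add_mem_binaryForms (add_mem_binaryForms (const_mul_mem_binaryForms (a 0) hu₀)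
      (const_mul_mem_binaryForms (a 1) hu₁)) (const_mul_mem_binaryForms (γ a) hδ)) ha
    (fun s => by
      have e1 : wd s a = a 0 * wd s ![1, 0] + a 1 * wd s ![0, 1] := by simp [wd]; ring
      have e2 : 0 = a 0 * wd a ![1, 0] + a 1 * wd a ![0, 1] := by simp [wd]; ring
      linear_combination (-a 0) * h₀ s - a 1 * h₂ s + γ a * δ s * e1 - γ s * δ a * e2) a
  have h4 : ¬(u₀ a = 0 ∧ u₁ a = 0) := by
    rintro ⟨h5, h6⟩
    rw [h5, h6] at h3
    exact mul_ne_zero hγa hδa (by linear_combination h3)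
  filter_upwards [eventually_add_mul_ne_zero h4] with β hβ
  refine ⟨fun s => u₀ s + β * u₁ s, add_mem_binaryForms hu₀ (const_mul_mem_binaryForms β hu₁),
    fun s => ?_, hβ⟩
  linear_combination h₀ s + β * h₂ s + γ s * δ a * wd_cons_one_right a β -
    δ s * γ a * wd_cons_one_right s β

/-- The difference of the two sides is linear in `![1, β]`, and not identically zero since replacing
that vector by `s` gives -y · wd t s. -/
lemma eventually_wd_ne_zero {x y : ℂ} {s t : Fin 2 → ℂ} (hy : y ≠ 0) (hst : wd t s ≠ 0) :
    ∀ᶠ β in Filter.cofinite, x * wd s ![1, β] ≠ y * wd t ![1, β] := by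
  have h : ¬(x * wd s ![1, 0] - y * wd t ![1, 0] = 0 ∧ x * wd s ![0, 1] - y * wd t ![0, 1] = 0) := by
    rintro ⟨h1, h2⟩
    refine mul_ne_zero hy hst ?_
    have e1 : wd t s = s 0 * wd t ![1, 0] + s 1 * wd t ![0, 1] := by simp [wd]; ring
    have e2 : 0 = s 0 * wd s ![1, 0] + s 1 * wd s ![0, 1] := by simp [wd]; ring
    linear_combination y * e1 - s 0 * h1 - s 1 * h2 - x * e2
  filter_upwards [eventually_add_mul_ne_zero h] with β hβ h1
  rw [wd_cons_one_right, wd_cons_one_right t] at h1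
  exact hβ (by linear_combination h1)

/-- The product of the linear forms that vanish at the points `(1 : τ)` for `τ ∈ Z`. -/
def prodForm (Z : Finset ℂ) (s : Fin 2 → ℂ) : ℂ := ∏ τ ∈ Z, wd s ![1, τ]

lemma prodForm_mem (Z : Finset ℂ) : prodForm Z ∈ binaryForms Z.card := by
  classical
  induction Z using Finset.induction_on with
  | empty => exact const_mem_binaryForms 1
  | insert τ Z h ih =>
    rw [Finset.card_insert_of_notMem h]
    refine cast (congrArg (· ∈ binaryForms (Z.card + 1)) ?_)
      (mul_mem_binaryForms ih (wd_mem_binaryForms ![1, τ]))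
    ext s
    exact (mul_comm _ _).trans (Finset.prod_insert (f := fun τ => wd s ![1, τ]) h).symm

lemma prodForm_insert {Z : Finset ℂ} {τ : ℂ} (h : τ ∉ Z) (s : Fin 2 → ℂ) :
    prodForm (insert τ Z) s = wd s ![1, τ] * prodForm Z s := Finset.prod_insert h

lemma prodForm_zero_one (Z : Finset ℂ) : prodForm Z ![0, 1] ≠ 0 :=
  Finset.prod_ne_zero_iff.2 fun τ _ => by simp [wd]

lemma prodForm_eq_zero_iff {Z : Finset ℂ} {t : ℂ} : prodForm Z ![1, t] = 0 ↔ t ∈ Z := by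
  simp [prodForm, Finset.prod_eq_zero_iff, wd_cons_one, sub_eq_zero]

lemma hasSimpleZero_prodForm {Z : Finset ℂ} {τ : ℂ} (h : τ ∈ Z) :
    HasSimpleZero Z.card (prodForm Z) ![1, τ] := by
  refine ⟨prodForm (Z.erase τ), ?_, fun s => (Finset.mul_prod_erase Z _ h).symm, ?_⟩
  · rw [← Finset.card_erase_of_mem h]; exact prodForm_mem _
  · rw [Ne, prodForm_eq_zero_iff]; simp

lemma exists_finset_card_disjoint (n : ℕ) (S : Finset ℂ) :
    ∃ Z : Finset ℂ, Z.card = n ∧ ∀ z ∈ Z, z ∉ S := by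
  obtain ⟨T, h1, h2⟩ := Infinite.exists_superset_card_eq S (S.card + n) (by omega)
  exact ⟨T \ S, by rw [Finset.card_sdiff_of_subset h1]; omega, fun z hz => (Finset.mem_sdiff.1 hz).2⟩

lemma binaryForms_smul_ne_zero {n : ℕ} {F : (Fin 2 → ℂ) → ℂ} (hF : F ∈ binaryForms n)
    {k : ℂ} (hk : k ≠ 0) {s : Fin 2 → ℂ} (hs : F s ≠ 0) : F (k • s) ≠ 0 := by
  rw [binaryForms_smul hF]
  exact mul_ne_zero (pow_ne_zero _ hk) hs

/-- A space curve of degree `v` with points of multiplicities `m₁, m₂, m₃, m₃` at the coordinate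
points, which is otherwise immersed and injective over the image of some point. -/
theorem exists_curve {m₁ m₂ m₃ v : ℕ} (h31 : m₃ ≤ m₁) (h32 : m₃ ≤ m₂) (h3 : 1 ≤ m₃)
    (hv : m₁ + m₂ + m₃ = v) :
    ∃ (f : Fin 4 → Fin (v + 1) → ℂ) (t₀ : ℂ) (A : Fin 4 → Finset ℂ),
      (∀ b : Fin 2 → ℂ, b ≠ 0 → ∃ i, hev v (f i) b ≠ 0) ∧
      (∀ a : Fin 2 → ℂ, a ≠ 0 → ∃ k : Fin 4 → ℂ,
        HasSimpleZero v (fun s => ∑ i, k i * hev v (f i) s) a) ∧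
      (∀ (b : Fin 2 → ℂ) (k : ℂ), b ≠ 0 →
        (∀ i, k * hev v (f i) b = hev v (f i) ![1, t₀]) → wd b ![1, t₀] = 0) ∧
      (∀ i j, j ≠ i → ∀ t ∈ A i, hev v (f j) ![1, t] = 0) ∧
      (A 0).card = m₁ ∧ (A 1).card = m₂ ∧ (A 2).card = m₃ ∧ (A 3).card = m₃ := by
  classical
  -- At a point of `Z₁`, `Z₂`, `A₃` or `Z₄` exactly one of φ₁g₃g₄, φ₂g₃g₄, γg₄, γg₃ survives. `Y₁`
  -- and `Y₂` bring φ₁ and φ₂ to the common degree m₁ + m₂ - m₃.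
  obtain ⟨Z₁, hZ₁, -⟩ := exists_finset_card_disjoint m₁ ∅
  obtain ⟨Z₂, hZ₂, dZ₂⟩ := exists_finset_card_disjoint m₂ Z₁
  obtain ⟨Y₁, hY₁, dY₁⟩ := exists_finset_card_disjoint (m₁ - m₃) (Z₁ ∪ Z₂)
  obtain ⟨Y₂, hY₂, dY₂⟩ := exists_finset_card_disjoint (m₂ - m₃) (Z₁ ∪ Z₂ ∪ Y₁)
  let φ₁ : (Fin 2 → ℂ) → ℂ := fun s => prodForm Y₁ s * prodForm Z₂ s
  let φ₂ : (Fin 2 → ℂ) → ℂ := fun s => prodForm Z₁ s * prodForm Y₂ s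
  let γ : (Fin 2 → ℂ) → ℂ := fun s => prodForm Z₁ s * prodForm Z₂ s
  have hφ₁ : φ₁ ∈ binaryForms (m₁ + m₂ - m₃) :=
    mul_mem_binaryForms_of_eq (by omega) (prodForm_mem Y₁) (prodForm_mem Z₂)
  have hφ₂ : φ₂ ∈ binaryForms (m₁ + m₂ - m₃) :=
    mul_mem_binaryForms_of_eq (by omega) (prodForm_mem Z₁) (prodForm_mem Y₂)
  have hγ : γ ∈ binaryForms (m₁ + m₂) :=
    mul_mem_binaryForms_of_eq (by omega) (prodForm_mem Z₁) (prodForm_mem Z₂)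
  obtain ⟨τ₀, hτ₀⟩ : Z₁.Nonempty := Finset.card_pos.1 (by omega)
  have hφ₁τ : φ₁ ![1, τ₀] ≠ 0 := by
    simp only [φ₁, Ne, mul_eq_zero, prodForm_eq_zero_iff]
    grind
  -- The ratio f₀ : f₁ = φ₁ : φ₂ already makes the curve immersed off `E` wherever g₃g₄ ≠ 0. The set
  -- `B` below contains the affine points which it does not separate from t₀.
  obtain ⟨E, hE⟩ := exists_ramification_finset hφ₁ hφ₂ (by omega) (τ₀ := τ₀)
    ((hasSimpleZero_prodForm hτ₀).mul (prodForm_mem Y₂)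
      (by rw [Ne, prodForm_eq_zero_iff]; grind) (by omega) (by omega)) hφ₁τ
  obtain ⟨t₀, ht₀⟩ := Infinite.exists_notMem_finset (Z₁ ∪ Z₂ ∪ Y₁ ∪ Y₂)
  have hφ₂t : φ₂ ![1, t₀] ≠ 0 := by
    simp only [φ₂, Ne, mul_eq_zero, prodForm_eq_zero_iff]
    grind
  have hγt : γ ![1, t₀] ≠ 0 := by
    simp only [γ, Ne, mul_eq_zero, prodForm_eq_zero_iff]
    grind
  obtain ⟨B, hB⟩ := finite_zeros_of_mem_binaryForms (s := ![1, τ₀])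
    (sub_mem_binaryForms (const_mul_mem_binaryForms (φ₂ ![1, t₀]) hφ₁)
      (const_mul_mem_binaryForms (φ₁ ![1, t₀]) hφ₂)) (by
        have : φ₂ ![1, τ₀] = 0 := by simp [φ₂, prodForm_eq_zero_iff, hτ₀]
        rw [this]
        simpa using ⟨hφ₂t, hφ₁τ⟩)
  obtain ⟨Z₄, hZ₄, dZ₄⟩ := exists_finset_card_disjoint m₃ (insert t₀ (Z₁ ∪ Z₂ ∪ Y₁ ∪ Y₂ ∪ E))
  obtain ⟨Z₃, hZ₃, dZ₃⟩ :=
    -- One zero of g₃ is left free: it will be β.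
    exists_finset_card_disjoint (m₃ - 1) (insert t₀ (Z₁ ∪ Z₂ ∪ Y₁ ∪ Y₂ ∪ E ∪ Z₄))
  let δ : (Fin 2 → ℂ) → ℂ := fun s => φ₁ s * prodForm Z₃ s
  obtain ⟨n, hn⟩ : ∃ n, m₁ + m₂ = n + 1 := ⟨m₁ + m₂ - 1, by omega⟩
  have hδ : δ ∈ binaryForms n := mul_mem_binaryForms_of_eq (by omega) hφ₁ (prodForm_mem Z₃)
  have h01 : (![0, 1] : Fin 2 → ℂ) ≠ 0 := fun h => by simpa using congrFun h 1
  have hγi : γ ![0, 1] ≠ 0 := mul_ne_zero (prodForm_zero_one _) (prodForm_zero_one _)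
  have hδi : δ ![0, 1] ≠ 0 :=
    mul_ne_zero (mul_ne_zero (prodForm_zero_one _) (prodForm_zero_one _)) (prodForm_zero_one _)
  rw [hn] at hγ
  have hwi : wd ![0, 1] ![1, t₀] ≠ 0 := by simp [wd]
  -- The second ratio, f₂ : f₀ = γ : δ · wd(·, β), must be unramified at the relevant points of `E`
  -- and at infinity, and must separate t₀ from `B` and from infinity. Each condition excludes only
  -- finitely many β.
  have ev1 : ∀ᶠ β in Filter.cofinite, ∀ t ∈ E, γ ![1, t] ≠ 0 → δ ![1, t] ≠ 0 →
      HasSimpleZero (n + 1) (fun s => γ s * (δ ![1, t] * wd ![1, t] ![1, β]) -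
        δ s * wd s ![1, β] * γ ![1, t]) ![1, t] := by
    rw [Filter.eventually_all_finset]
    intro t _
    simp only [Filter.eventually_imp_distrib_left]
    exact eventually_hasSimpleZero hγ hδ (cons_one_ne_zero t)
  have ev2 : ∀ᶠ β in Filter.cofinite, ∀ t ∈ B, δ ![1, t] * γ ![1, t₀] ≠ 0 →
      wd ![1, t] ![1, t₀] ≠ 0 → (δ ![1, t₀] * γ ![1, t]) * wd ![1, t₀] ![1, β] ≠
        (δ ![1, t] * γ ![1, t₀]) * wd ![1, t] ![1, β] := by
    rw [Filter.eventually_all_finset]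
    intro t _
    simp only [Filter.eventually_imp_distrib_left]
    exact eventually_wd_ne_zero
  obtain ⟨β, ⟨⟨⟨ev1, ev2⟩, ev3⟩, ev4⟩, dβ⟩ := (ev1.and ev2 |>.and
    (eventually_hasSimpleZero hγ hδ h01 hγi hδi) |>.and
    (eventually_wd_ne_zero (x := δ ![1, t₀] * γ ![0, 1]) (mul_ne_zero hδi hγt) hwi) |>.and
    (insert t₀ (Z₁ ∪ Z₂ ∪ Y₁ ∪ Y₂ ∪ E ∪ Z₄ ∪ Z₃)).finite_toSet.compl_mem_cofinite).exists
  replace dβ : β ∉ insert t₀ (Z₁ ∪ Z₂ ∪ Y₁ ∪ Y₂ ∪ E ∪ Z₄ ∪ Z₃) := dβ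
  let A₃ := insert β Z₃
  have hβ : β ∉ Z₃ := by grind
  have hA₃ : A₃.card = m₃ := by rw [Finset.card_insert_of_notMem hβ]; omega
  have hg₃ : ∀ s, prodForm A₃ s = wd s ![1, β] * prodForm Z₃ s := prodForm_insert hβ
  let F : Fin 4 → (Fin 2 → ℂ) → ℂ :=
    ![fun s => φ₁ s * (prodForm A₃ s * prodForm Z₄ s), fun s => φ₂ s * (prodForm A₃ s * prodForm Z₄ s),
      fun s => γ s * prodForm Z₄ s, fun s => γ s * prodForm A₃ s]
  have hg34 : (fun s => prodForm A₃ s * prodForm Z₄ s) ∈ binaryForms (m₃ + m₃) :=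
    mul_mem_binaryForms_of_eq (by omega) (prodForm_mem A₃) (prodForm_mem Z₄)
  have hF : ∀ i, F i ∈ binaryForms v := by
    intro i
    fin_cases i
    · exact mul_mem_binaryForms_of_eq (by omega) hφ₁ hg34
    · exact mul_mem_binaryForms_of_eq (by omega) hφ₂ hg34
    · exact mul_mem_binaryForms_of_eq (by omega) hγ (prodForm_mem Z₄)
    · exact mul_mem_binaryForms_of_eq (by omega) hγ (prodForm_mem A₃)
  have hFi : ∀ i, F i ![0, 1] ≠ 0 := by
    intro i
    fin_cases i <;> simp [F, φ₁, φ₂, γ, prodForm_zero_one]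
  have hF0 : F 0 = fun s => φ₁ s * (prodForm A₃ s * prodForm Z₄ s) := rfl
  have hF1 : F 1 = fun s => φ₂ s * (prodForm A₃ s * prodForm Z₄ s) := rfl
  have hF2 : F 2 = fun s => γ s * prodForm Z₄ s := rfl
  have hF3 : F 3 = fun s => γ s * prodForm A₃ s := rfl
  choose f hf using fun i => exists_hev_eq (hF i)
  refine ⟨f, t₀, ![Z₁, Z₂, A₃, Z₄], ?_, ?_, ?_, ?_, hZ₁, hZ₂, hA₃, hZ₄⟩
  · simp only [← hf]
    intro b hb
    obtain ⟨c, hc, rfl | ⟨t, rfl⟩⟩ := exists_smul_normal_form hb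
    · exact ⟨0, binaryForms_smul_ne_zero (hF 0) hc (hFi 0)⟩
    · suffices ∃ i, F i ![1, t] ≠ 0 from
        this.imp fun i hi => binaryForms_smul_ne_zero (hF i) hc hi
      by_cases h1 : t ∈ Z₁
      · refine ⟨0, ?_⟩
        simp only [hF0, φ₁, Ne, mul_eq_zero, prodForm_eq_zero_iff, A₃]
        grind
      by_cases h2 : t ∈ Z₂
      · refine ⟨1, ?_⟩
        simp only [hF1, φ₂, Ne, mul_eq_zero, prodForm_eq_zero_iff, A₃]
        grind
      by_cases h4 : t ∈ Z₄
      · refine ⟨3, ?_⟩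
        simp only [hF3, γ, Ne, mul_eq_zero, prodForm_eq_zero_iff, A₃]
        grind
      · refine ⟨2, ?_⟩
        simp only [hF2, γ, Ne, mul_eq_zero, prodForm_eq_zero_iff]
        grind
  · simp only [← hf, Fin.sum_univ_four]
    intro a ha
    obtain ⟨c, hc, h⟩ := exists_smul_normal_form ha
    have key : ∀ a', HasSimpleZero (n + 1) (fun s => γ s * (δ a' * wd a' ![1, β]) -
        δ s * wd s ![1, β] * γ a') a' → prodForm Z₄ a' ≠ 0 →
        ∃ k : Fin 4 → ℂ, HasSimpleZero v
          (fun s => k 0 * F 0 s + k 1 * F 1 s + k 2 * F 2 s + k 3 * F 3 s) a' := by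
      intro a' h1 h2
      -- Both f₀ and f₂ contain g₄, and f₀/g₄ is δ(s) wd(s, (1, β)); this combination is g₄ times
      -- the form in the hypothesis.
      refine ⟨![-γ a', 0, δ a' * wd a' ![1, β], 0], ?_⟩
      convert h1.mul (prodForm_mem Z₄) h2 (by omega) (show n + 1 + Z₄.card = v by omega) using 2 with s
      simp only [hF0, hF1, hF2, hF3, hg₃, δ]
      simp
      ring
    have single : ∀ i a', HasSimpleZero v (F i) a' → ∃ k : Fin 4 → ℂ, HasSimpleZero v
          (fun s => k 0 * F 0 s + k 1 * F 1 s + k 2 * F 2 s + k 3 * F 3 s) a' := by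
      intro i a' h1
      refine ⟨Pi.single i 1, ?_⟩
      convert h1 using 2 with s
      fin_cases i <;> simp
    rcases h with rfl | ⟨t, rfl⟩
    · exact (key _ ev3 (prodForm_zero_one _)).imp fun k hk => hk.smul hc
    · suffices ∃ k : Fin 4 → ℂ, HasSimpleZero v
          (fun s => k 0 * F 0 s + k 1 * F 1 s + k 2 * F 2 s + k 3 * F 3 s) ![1, t] from
        this.imp fun k hk => hk.smul hc
      by_cases h1 : t ∈ Z₁
      · refine single 2 _ ?_
        have := (hasSimpleZero_prodForm h1).mul (d := v)
          (mul_mem_binaryForms (prodForm_mem Z₂) (prodForm_mem Z₄)) (by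
            simp only [Ne, mul_eq_zero, prodForm_eq_zero_iff]; grind) (by omega) (by omega)
        convert this using 2 with s
        simp only [hF2, γ]; ring
      by_cases h2 : t ∈ Z₂
      · refine single 2 _ ?_
        have := (hasSimpleZero_prodForm h2).mul (d := v)
          (mul_mem_binaryForms (prodForm_mem Z₁) (prodForm_mem Z₄)) (by
            simp only [Ne, mul_eq_zero, prodForm_eq_zero_iff]; grind) (by omega) (by omega)
        convert this using 2 with s
        simp only [hF2, γ]; ring
      have hγa : γ ![1, t] ≠ 0 := by
        simp only [γ, Ne, mul_eq_zero, prodForm_eq_zero_iff]; grind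
      by_cases h4 : t ∈ Z₄
      · refine single 2 _ ?_
        have := (hasSimpleZero_prodForm h4).mul (d := v) hγ hγa (by omega) (by omega)
        convert this using 2 with s
        rw [hF2]; ring
      by_cases h3 : t ∈ A₃
      · refine single 3 _ ?_
        have := (hasSimpleZero_prodForm h3).mul (d := v) hγ hγa (by omega) (by omega)
        convert this using 2 with s
        rw [hF3]; ring
      have hg : prodForm A₃ ![1, t] * prodForm Z₄ ![1, t] ≠ 0 := by
        simp only [Ne, mul_eq_zero, prodForm_eq_zero_iff]; grind
      by_cases h5 : t ∈ E
      -- On `Y₁` the form δ vanishes and the condition on β says nothing, but there f₀ itself has a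
      -- simple zero.
      · by_cases h6 : t ∈ Y₁
        · refine single 0 _ ?_
          have := (hasSimpleZero_prodForm h6).mul (d := v)
            (mul_mem_binaryForms (prodForm_mem Z₂) hg34) (mul_ne_zero (by
              simp only [Ne, prodForm_eq_zero_iff]; grind) hg)
              (Finset.card_pos.2 ⟨t, h6⟩) (by omega)
          convert this using 2 with s
          simp only [hF0, φ₁]; ring
        · refine key _ (ev1 t h5 hγa ?_) (right_ne_zero_of_mul hg)
          simp only [δ, φ₁, Ne, mul_eq_zero, prodForm_eq_zero_iff]; grind
      · refine ⟨![φ₂ ![1, t], -φ₁ ![1, t], 0, 0], ?_⟩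
        convert (hE t h5).mul hg34 hg (by omega) (show _ = v by omega) using 2 with s
        simp [hF0, hF1]
        ring
  · intro b k hb h
    simp only [← hf] at h
    obtain ⟨c, hc, hc'⟩ := exists_smul_normal_form hb
    obtain ⟨p, rfl, hp⟩ : ∃ p, b = c • p ∧ (p = ![0, 1] ∨ ∃ t, p = ![1, t]) := by
      rcases hc' with rfl | ⟨t, rfl⟩
      · exact ⟨_, rfl, Or.inl rfl⟩
      · exact ⟨_, rfl, Or.inr ⟨t, rfl⟩⟩
    rw [wd_smul_left]
    refine mul_eq_zero_of_right _ (by_contra fun hw => ?_)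
    simp only [fun i => binaryForms_smul (hF i), ← mul_assoc] at h
    have e0 := h 0
    have e1 := h 1
    have e2 := h 2
    simp only [hF0, hF1, hF2] at e0 e1 e2
    have n0 : φ₁ ![1, t₀] * (prodForm A₃ ![1, t₀] * prodForm Z₄ ![1, t₀]) ≠ 0 := by
      simp only [φ₁, A₃, Ne, mul_eq_zero, prodForm_eq_zero_iff]; grind
    rw [← e0] at n0
    have n1 := left_ne_zero_of_mul n0
    have n2 := right_ne_zero_of_mul n0
    have r1 : φ₂ ![1, t₀] * φ₁ p - φ₁ ![1, t₀] * φ₂ p = 0 := by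
      refine (mul_eq_zero.1 ?_).resolve_left (mul_ne_zero n1 (right_ne_zero_of_mul n2))
      linear_combination φ₂ ![1, t₀] * e0 - φ₁ ![1, t₀] * e1
    have r2 : (δ ![1, t₀] * γ p) * wd ![1, t₀] ![1, β] = (δ p * γ ![1, t₀]) * wd p ![1, β] := by
      rw [← sub_eq_zero]
      refine (mul_eq_zero.1 ?_).resolve_left
        (mul_ne_zero n1 (right_ne_zero_of_mul (right_ne_zero_of_mul n2)))
      simp only [hg₃, δ] at e0 ⊢
      linear_combination φ₁ ![1, t₀] * prodForm Z₃ ![1, t₀] * wd ![1, t₀] ![1, β] * e2 -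
        γ ![1, t₀] * e0
    have n3 : δ p * γ ![1, t₀] ≠ 0 := by
      rw [hg₃] at n2
      exact mul_ne_zero (mul_ne_zero (left_ne_zero_of_mul n2)
        (right_ne_zero_of_mul (left_ne_zero_of_mul (right_ne_zero_of_mul n2)))) hγt
    rcases hp with rfl | ⟨t, rfl⟩
    · exact ev4 r2
    · exact ev2 t (hB t r1) n3 hw r2
  · simp only [← hf]
    intro i j hij t ht
    fin_cases i <;> fin_cases j <;>
      simp [F, φ₁, φ₂, γ, prodForm_eq_zero_iff] at hij ht ⊢ <;> grind

end

/-! ### The numerical conditions -/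

theorem proposition2p1 (v r : ℕ) (hv : 4 ≤ v) (a b c d : ℤ)
    (ha : Odd a) (hb : Odd b) (hc : Odd c) (hd : Odd d)
    (hab : b ≤ a) (hbc : c ≤ b) (hcd : d ≤ c) (hd0 : 0 < d)
    (hsum : 8 * (r : ℤ) + 4 = a ^ 2 + b ^ 2 + c ^ 2 + d ^ 2)
    (habc : a + b + c ≤ 2 * (v : ℤ) - 3) :
    ∃ (L : (Fin (1 + 1) ⊕ Fin (v + 1) → ℂ) →ₗ[ℂ] (Fin (5 + 1) → ℂ))
      (S : Set (ℙ ℂ (Fin (5 + 1) → ℂ))),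
      IsRationalScroll 1 v L S ∧
      (surfaceSingularLocus S).Finite ∧
      r ≤ (surfaceSingularLocus S).ncard ∧
      r ≤ singularityCount 1 v L S := by
  obtain ⟨a, rfl⟩ := ha
  obtain ⟨b, rfl⟩ := hb
  obtain ⟨c, rfl⟩ := hc
  obtain ⟨d, rfl⟩ := hd
  lift d to ℕ using by omega
  lift c to ℕ using by omega
  lift b to ℕ using by omega
  lift a to ℕ using by omega
  -- From (2n + 1)² = 8 · (n + 1 choose 2) + 1, summed over the four odd integers.
  have hr : r = (a + 1).choose 2 + (b + 1).choose 2 + (c + 1).choose 2 + (d + 1).choose 2 := by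
    have h : ∀ n : ℕ, ((n + 1).choose 2 : ℤ) * 2 = n * (n + 1) := fun n => by
      have h1 : (n + 1).choose 2 * 2 = (n + 1) * n := by
        rw [Nat.choose_two_right]
        exact Nat.div_mul_cancel (Nat.even_mul_pred_self (n + 1)).two_dvd
      zify at h1
      linarith
    have := h a
    have := h b
    have := h c
    have := h d
    zify
    nlinarith
  -- In terms of the halves the bound reads (a + 1) + (b + 1) + (c + 1) ≤ v. Spare degree goes to
  -- the first multiplicity, and the last one is raised from d + 1 to c + 1.
  obtain ⟨f, t₀, A, hf, him, ht₀, hfA, h0, h1, h2, h3⟩ :=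
    exists_curve (m₁ := v - (b + 1) - (c + 1)) (m₂ := b + 1) (m₃ := c + 1) (v := v)
      (by omega) (by omega) (by omega) (by omega)
  refine exists_scroll_of_curve (A := A) (by omega) hf ?_ ht₀ (fun i => Finset.card_pos.1 ?_) hfA ?_
  · intro a ha
    exact him a ha
  · fin_cases i
    exacts [h0 ▸ by omega, h1 ▸ by omega, h2 ▸ by omega, h3 ▸ by omega]
  · rw [Fin.sum_univ_four, h0, h1, h2, h3, hr]
    have e1 := Nat.choose_le_choose 2 (show a + 1 ≤ v - (b + 1) - (c + 1) by omega)
    have e2 := Nat.choose_le_choose 2 (show d + 1 ≤ c + 1 by omega)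
    omega
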